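/- Let $n\ge 5$. Label the vertices of a convex $n$-gon clockwise $1,\dots,n$ and write $(a,b)$, $a<b$, for the diagonal joining $a$ and $b$. A $2$-triangulation of the $n$-gon is a maximal set of diagonals no three of which pairwise cross. It contains all trivial diagonals (those with exactly one vertex on one side). Its non-trivial diagonals are drawn as crosses in the squares (row $a$, column $b$) of $\Lambda_n=\{(a,b): 1\le a<b-2\le n-2,\ a>b-n+2\}$, and $h_j=h_j(T)$ is the number of crosses of $T$ in column $j$. The corner $r=r(T)$ is the largest $r\le n-3$ with $(r,r+3)\in T$ (so $r=2$ for $n=5$), and the label of $T$ is $(h_{r+1},\dots,h_{n-1})$. For $n\ge6$ the parent of $T$ is the $2$-triangulation of the $(n-1)$-gon whose non-trivial diagonals are obtained from those of $T$ as follows: delete $(r,r+3)$; then delete $(r-1,r+2)$ if $\deg(r+1)=0$, delete $(1,r+1)$ if $\deg(r+1)>0$ and $\deg(r+2)=0$, and delete $(j,r+2)$ with $j=\max\{a<r:(a,r+2)\in T\}$ if both degrees are positive (degrees count non-trivial diagonals only); finally contract the side $(r+1,r+2)$ (vertices $v\ge r+2$ become $v-1$). Let $\mathcal D_m$ ($m\ge1$)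 be the set of pairs $(P,Q)$ of Dyck paths from $(0,0)$ to $(m,m)$ (steps $N=(0,1)$, $E=(1,0)$, never below $y=x$) such that $P$ never goes below $Q$. Write $P=NE^{p_m}NE^{p_{m-1}}\cdots NE^{p_1}E$ and $Q=NE^{q_m}NE^{q_{m-1}}\cdots NE^{q_1}E$, with $p_j=q_j=0$ for $j>m$. Let $s=\min\{j\ge2: p_jq_j=0\}$; the label of $(P,Q)$ is $(p_{s+1}+q_s,\,p_s+q_{s-1},\dots,p_2+q_1)$. For $m\ge2$ the parent of $(P,Q)$ is the pair in $\mathcal D_{m-1}$ whose $p$-sequence is $p_1,\dots,p_{s-2},\,p_{s-1}-1,\,p_s+p_{s+1},\,p_{s+2},\dots$ and whose $q$-sequence is $q_1,\dots,q_{s-2},\,q_{s-1}+q_s-1,\,q_{s+1},q_{s+2},\dots$. The coloring algorithm, applied to a $2$-triangulation $T$ of the $n$-gon, starts with the $n-3$ blocks $\{4\},\{5\},\dots,\{n\}$ of columns, all crosses being uncolored, and performs $n-5$ times the following iteration. Let $r$ be the largest index such that row $r$ has a cross (colored or not) in the $r$-th block from the left; color blue a leftmost uncolored cross in block $r$; merge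 blocks $r-2$ and $r-1$ (if $r=2$, block $1$ disappears from the list of blocks, and the merged block of this iteration means the old block $1$); color red a rightmost uncolored cross in the merged block. Ties are broken arbitrarily. If in the end $\alpha_j$ and $\beta_j$ are the numbers of blue and red crosses in column $j$, the output $\Phi(T)$ is the pair $P=NE^{\alpha_5}NE^{\alpha_6}\cdots NE^{\alpha_n}E$, $Q=NE^{\beta_4}NE^{\beta_5}\cdots NE^{\beta_{n-1}}E$. Claim. The parent relation makes the $2$-triangulations (level $\ell$: those of the $(\ell+5)$-gon) into a rooted tree, and the pairs of non-crossing Dyck paths (level $\ell$: $\mathcal D_{\ell+1}$) into a rooted tree; there is exactly one label-preserving isomorphism of these trees (a level-preserving bijection that respects parents and labels), which gives, for every $n\ge5$, a bijection $\widetilde\Psi$ from the $2$-triangulations of the $n$-gon to $\mathcal D_{n-4}$. For every $n\ge5$: (1) if $T$ is a $2$-triangulation of the $n$-gon and $\widetilde\Psi(T)=(P,Q)$, then $$(h_4,h_5,\dots,h_{n-1},h_n)=(q_{n-4},\,p_{n-4}+q_{n-5},\,\dots,\,p_2+q_1,\,p_1);$$ (2) in each of the $n-5$ iterations of the coloring algorithm,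 whatever choices were made before, the index $r$ exists and is at least $2$, and there is a cross to be colored blue and then a cross to be colored red; at the end two blocks remain, and all $2n-10$ crosses are colored, $n-5$ of them blue and $n-5$ red; (3) the output $\Phi(T)$ does not depend on how ties are broken, it is a pair of Dyck paths of size $n-4$ the first of which never goes below the second, $\Phi(T)=\widetilde\Psi(T)$ for all $T$, and $\Phi$ is a bijection from the $2$-triangulations of the $n$-gon to $\mathcal D_{n-4}$. -/

import Mathlib

namespace TwoTri

/-! ### Generalized triangulations of a convex polygon

The vertices of the convex `n`-gon are labelled clockwise `1, …, n`; the segment joining the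
vertices `a < b` is the pair `(a, b)`. -/

/-- The diagonals of the convex `n`-gon (segments between vertices that are not sides). -/
def diagonals (n : ℕ) : Finset (ℕ × ℕ) :=
  (Finset.Icc 1 n ×ˢ Finset.Icc 1 n).filter fun d => d.1 + 2 ≤ d.2 ∧ d ≠ (1, n)

/-- Two diagonals of a convex polygon cross (meet in their interiors): their endpoints are four
distinct vertices that alternate around the polygon. -/
def Crosses (d e : ℕ × ℕ) : Prop :=
  (d.1 < e.1 ∧ e.1 < d.2 ∧ d.2 < e.2) ∨ (e.1 < d.1 ∧ d.1 < e.2 ∧ e.2 < d.2)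

/-- An `m`-crossing: `m` diagonals, any two of which cross. -/
def IsCrossing (m : ℕ) (X : Finset (ℕ × ℕ)) : Prop :=
  X.card = m ∧ (X : Set (ℕ × ℕ)).Pairwise Crosses

/-- A `k`-triangulation of the `n`-gon: a maximal set of diagonals without `(k+1)`-crossing. -/
def IsKTriangulation (k n : ℕ) (T : Finset (ℕ × ℕ)) : Prop :=
  Maximal (fun S => S ⊆ diagonals n ∧ ∀ X ⊆ S, ¬ IsCrossing (k + 1) X) T

/-- The type of `2`-triangulations of the `n`-gon (as full sets of diagonals, the trivial diagonals
included). -/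
abbrev TwoTriangulation (n : ℕ) : Type := {T : Finset (ℕ × ℕ) // IsKTriangulation 2 n T}

/-- The shape `Λ_n`: the diagonals that have at least two vertices on either side, that is, the
non-trivial diagonals. The square `(a, b)` lies in row `a` and column `b`. -/
def shape (n : ℕ) : Finset (ℕ × ℕ) :=
  (Finset.Icc 1 n ×ˢ Finset.Icc 1 n).filter fun d => d.1 + 2 < d.2 ∧ d.2 + 2 < d.1 + n

/-- The diagram of `T` in `Λ_n`: its non-trivial diagonals, drawn as crosses. -/
def diagram (n : ℕ) (T : Finset (ℕ × ℕ)) : Finset (ℕ × ℕ) := T ∩ shape n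

/-- The number of members of `D` in column `j`. -/
def colCount (D : Finset (ℕ × ℕ)) (j : ℕ) : ℕ := (D.filter fun d => d.2 = j).card

/-- The degree of the vertex `v` with respect to the set `D` of diagonals. -/
def degree (D : Finset (ℕ × ℕ)) (v : ℕ) : ℕ := (D.filter fun d => d.1 = v ∨ d.2 = v).card

/-- The corner of `T`: the largest `r` with `1 ≤ r ≤ n - 3` and `(r, r + 3) ∈ T`. (For `n ≥ 6` all
the `(r, r + 3)` are non-trivial; for the pentagon the trivial diagonal `(2, 5)` gives corner 2.) -/
def corner (n : ℕ) (T : Finset (ℕ × ℕ)) : ℕ :=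
  ((Finset.Icc 1 (n - 3)).filter fun a => (a, a + 3) ∈ T).sup id

/-- The diagram, in `Λ_{n-1}`, of the parent of a `2`-triangulation `T` of the `n`-gon (`n ≥ 6`),
where `r` is the corner of `T`: delete `(r, r + 3)` and one further diagonal, then contract the
side `(r + 1, r + 2)`. Degrees count non-trivial diagonals only. -/
def parentDiagram (n : ℕ) (T : Finset (ℕ × ℕ)) : Finset (ℕ × ℕ) :=
  let r := corner n T
  let D := diagram n T
  let j := ((Finset.Ico 1 r).filter fun a => (a, r + 2) ∈ D).sup id
  let second : ℕ × ℕ :=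
    if degree D (r + 1) = 0 then (r - 1, r + 2)
    else if degree D (r + 2) = 0 then (1, r + 1)
    else (j, r + 2)
  let contract : ℕ → ℕ := fun v => if v ≤ r + 1 then v else v - 1
  ((D.erase (r, r + 3)).erase second).image fun d => (contract d.1, contract d.2)

/-- The label `(h_{r+1}, …, h_{n-1})` of `T`, with `r` the corner and `h_j` the number of crosses in
column `j` of the diagram of `T`. -/
def triLabel (n : ℕ) (T : Finset (ℕ × ℕ)) : List ℕ :=
  (List.range' (corner n T + 1) (n - 1 - corner n T)).map (colCount (diagram n T))

/-! ### Pairs of non-crossing Dyck paths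

A Dyck path of size `m` is a Mathlib `DyckWord` of semilength `m`; the letter `U` is the north step
`N = (0, 1)` and the letter `D` is the east step `E = (1, 0)`. -/

/-- `P` never goes below `Q`: after any number of steps, `P` has made at least as many north steps
as `Q`, i.e. on each antidiagonal `P` is weakly above and to the left of `Q`. -/
def NeverBelow (P Q : DyckWord) : Prop :=
  ∀ i, (Q.toList.take i).count DyckStep.U ≤ (P.toList.take i).count DyckStep.U

/-- Pairs `(P, Q)` of Dyck paths of size `m` such that `P` never goes below `Q`. -/
abbrev DyckPair (m : ℕ) : Type :=
  {x : DyckWord × DyckWord //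
    x.1.semilength = m ∧ x.2.semilength = m ∧ NeverBelow x.1 x.2}

/-- The number of east steps of `w` that come after exactly `k` north steps. -/
def eastRun (w : List DyckStep) (k : ℕ) : ℕ :=
  ((Finset.range w.length).filter fun i =>
    w[i]? = some DyckStep.D ∧ (w.take i).count DyckStep.U = k).card

/-- The exponents in `P = N E^{p_m} N E^{p_{m-1}} ⋯ N E^{p_2} N E^{p_1} E`, where `m ≥ 1` is the
size of `P`. The value is `0` at `j = 0` and at all `j > m`. -/
def exponent (P : DyckWord) (j : ℕ) : ℕ :=
  eastRun P.toList (P.semilength + 1 - j) - if j = 1 then 1 else 0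

/-- `p_j(P, Q)`. -/
def DyckPair.p {m : ℕ} (x : DyckPair m) (j : ℕ) : ℕ := exponent x.1.1 j

/-- `q_j(P, Q)`. -/
def DyckPair.q {m : ℕ} (x : DyckPair m) (j : ℕ) : ℕ := exponent x.1.2 j

/-- `s(P, Q) = min {j ≥ 2 : p_j q_j = 0}`. -/
noncomputable def DyckPair.s {m : ℕ} (x : DyckPair m) : ℕ :=
  sInf {j | 2 ≤ j ∧ DyckPair.p x j * DyckPair.q x j = 0}

/-- `y` is the parent of `x`: with `s = s(x)`, the sequence `(p_j)` of `y` is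
`p_1, …, p_{s-2}, p_{s-1} - 1, p_s + p_{s+1}, p_{s+2}, …`, and its sequence `(q_j)` is
`q_1, …, q_{s-2}, q_{s-1} + q_s - 1, q_{s+1}, …`. -/
def IsDyckParent {m : ℕ} (y : DyckPair m) (x : DyckPair (m + 1)) : Prop :=
  let s := DyckPair.s x
  (∀ j, 1 ≤ j → j + 2 ≤ s →
    DyckPair.p y j = DyckPair.p x j ∧ DyckPair.q y j = DyckPair.q x j) ∧
  DyckPair.p y (s - 1) + 1 = DyckPair.p x (s - 1) ∧
  DyckPair.q y (s - 1) + 1 = DyckPair.q x s + DyckPair.q x (s - 1) ∧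
  DyckPair.p y s = DyckPair.p x (s + 1) + DyckPair.p x s ∧
  DyckPair.q y s = DyckPair.q x (s + 1) ∧
  ∀ j, s < j → DyckPair.p y j = DyckPair.p x (j + 1) ∧ DyckPair.q y j = DyckPair.q x (j + 1)

/-- The label `(p_{s+1} + q_s, p_s + q_{s-1}, …, p_2 + q_1)` of a pair. -/
noncomputable def dyckLabel {m : ℕ} (x : DyckPair m) : List ℕ :=
  ((List.range' 1 (DyckPair.s x)).reverse).map fun j => DyckPair.p x (j + 1) + DyckPair.q x j

/-! ### Labelled generating trees -/

/-- The data of a tree graded by levels, with nodes labelled by lists of numbers. `IsParent x y`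
says that `x` is the parent of `y`. -/
structure LabelledTree where
  Node : ℕ → Type
  IsParent : ∀ {l : ℕ}, Node l → Node (l + 1) → Prop
  label : ∀ {l : ℕ}, Node l → List ℕ

/-- The data form a rooted tree: one node at level `0`, and each other node has one parent. -/
def LabelledTree.IsTree (A : LabelledTree) : Prop :=
  (∃! _x : A.Node 0, True) ∧ ∀ (l : ℕ) (y : A.Node (l + 1)), ∃! x : A.Node l, A.IsParent x y

/-- A label-preserving isomorphism of trees, given level by level. -/
def LabelledTree.IsIso (A B : LabelledTree) (f : ∀ l, A.Node l ≃ B.Node l) : Prop :=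
  (∀ (l : ℕ) (x : A.Node l) (y : A.Node (l + 1)),
    A.IsParent x y ↔ B.IsParent (f l x) (f (l + 1) y)) ∧
  ∀ (l : ℕ) (x : A.Node l), B.label (f l x) = A.label x

/-- The generating tree of `2`-triangulations; at level `l` are those of the `(l + 5)`-gon. -/
def triTree : LabelledTree where
  Node l := TwoTriangulation (l + 5)
  IsParent {l} S T := diagram (l + 5) S.1 = parentDiagram (l + 6) T.1
  label {l} T := triLabel (l + 5) T.1

/-- The generating tree of pairs of non-crossing Dyck paths; at level `l` are those of size
`l + 1`. -/
noncomputable def dyckTree : LabelledTree where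
  Node l := DyckPair (l + 1)
  IsParent := IsDyckParent
  label := dyckLabel

/-! ### The coloring algorithm -/

/-- A stage of the algorithm: the blocks (sets of merged columns) from left to right, and the
crosses that have been colored blue and red. -/
structure ColoringState where
  blocks : List (Finset ℕ)
  blue : Finset (ℕ × ℕ)
  red : Finset (ℕ × ℕ)

/-- At the beginning each of the columns `4, …, n` is a block and no cross is colored. -/
def ColoringState.init (n : ℕ) : ColoringState where
  blocks := (List.range' 4 (n - 3)).map fun c => {c}
  blue := ∅
  red := ∅

namespace ColoringState

/-- The set of columns in block `j` (blocks are counted from `1`); there is nothing in block `0`. -/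
def block (S : ColoringState) (j : ℕ) : Finset ℕ :=
  if j = 0 then ∅ else S.blocks.getD (j - 1) ∅

/-- `r` is the largest index so that row `r` has a cross (colored or not) in block `r`. -/
def IsCorner (D : Finset (ℕ × ℕ)) (S : ColoringState) (r : ℕ) : Prop :=
  IsGreatest {a | ∃ c ∈ S.block a, (a, c) ∈ D} r

/-- The columns of the block obtained by merging blocks `r - 2` and `r - 1`. -/
def merged (S : ColoringState) (r : ℕ) : Finset ℕ := S.block (r - 2) ∪ S.block (r - 1)

/-- The list of blocks after blocks `r - 2` and `r - 1` have been merged; if `r = 2`, block `1`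
disappears. -/
def mergedBlocks (S : ColoringState) (r : ℕ) : List (Finset ℕ) :=
  S.blocks.take (r - 3) ++ (if r = 2 then [] else [S.merged r]) ++ S.blocks.drop (r - 1)

/-- `x` is an uncolored cross of `D` in one of the columns of `B`. -/
def Uncolored (D : Finset (ℕ × ℕ)) (S : ColoringState) (B : Finset ℕ) (x : ℕ × ℕ) : Prop :=
  x ∈ D ∧ x ∉ S.blue ∧ x ∉ S.red ∧ x.2 ∈ B

/-- `x` is a leftmost uncolored cross in the columns of `B`. -/
def Leftmost (D : Finset (ℕ × ℕ)) (S : ColoringState) (B : Finset ℕ) (x : ℕ × ℕ) : Prop :=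
  Uncolored D S B x ∧ ∀ y, Uncolored D S B y → x.2 ≤ y.2

/-- `x` is a rightmost uncolored cross in the columns of `B`. -/
def Rightmost (D : Finset (ℕ × ℕ)) (S : ColoringState) (B : Finset ℕ) (x : ℕ × ℕ) : Prop :=
  Uncolored D S B x ∧ ∀ y, Uncolored D S B y → y.2 ≤ x.2

/-- Color the cross `x` blue, then merge blocks `r - 2` and `r - 1`. -/
def blueMerge (S : ColoringState) (r : ℕ) (x : ℕ × ℕ) : ColoringState :=
  ⟨S.mergedBlocks r, insert x S.blue, S.red⟩

/-- Color the cross `y` red. -/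
def addRed (S : ColoringState) (y : ℕ × ℕ) : ColoringState :=
  ⟨S.blocks, S.blue, insert y S.red⟩

/-- One iteration of the algorithm, with an arbitrary choice in case of ties. -/
def Step (D : Finset (ℕ × ℕ)) (S S₂ : ColoringState) : Prop :=
  ∃ r x y, IsCorner D S r ∧ Leftmost D S (S.block r) x ∧
    Rightmost D (S.blueMerge r x) (S.merged r) y ∧ S₂ = (S.blueMerge r x).addRed y

end ColoringState

/-- `Reaches n D k S`: `S` is a possible stage of the algorithm after `k` iterations, for the
diagram `D` in `Λ_n`. -/
inductive Reaches (n : ℕ) (D : Finset (ℕ × ℕ)) : ℕ → ColoringState → Prop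
  | start : Reaches n D 0 (ColoringState.init n)
  | next {k : ℕ} {S S₂ : ColoringState} :
      Reaches n D k S → ColoringState.Step D S S₂ → Reaches n D (k + 1) S₂

/-- The word `N E^{c_u} N E^{c_{u+1}} ⋯ N E^{c_{u+t-1}} E`, where `c_j` is the number of members of
`C` in column `j`. -/
def pathWord (C : Finset (ℕ × ℕ)) (u t : ℕ) : List DyckStep :=
  (List.range' u t).flatMap
    (fun j => DyckStep.U :: List.replicate (colCount C j) DyckStep.D) ++ [DyckStep.D]

/-- `(P, Q)` is a possible output of the algorithm for the `2`-triangulation `T` of the `n`-gon: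
after `n - 5` iterations with `α_j` blue and `β_j` red crosses in column `j`,
`P = N E^{α_5} ⋯ N E^{α_n} E` and `Q = N E^{β_4} ⋯ N E^{β_{n-1}} E`. -/
def IsOutput (n : ℕ) (T : Finset (ℕ × ℕ)) (P Q : List DyckStep) : Prop :=
  ∃ S : ColoringState, Reaches n (diagram n T) (n - 5) S ∧
    P = pathWord S.blue 5 (n - 4) ∧ Q = pathWord S.red 4 (n - 4)

end TwoTri

open TwoTri

/-! ### Labelled trees governed by a common succession rule -/

namespace TwoTri

/-! Both trees obey one succession rule. Attach to a node a number s and a sequence e: for a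
2-triangulation of the n-gon with corner r, take s = n - 1 - r and e_j = h_{n-j}; for a pair of
paths, take its own s and e_j = p_{j+1} + q_j. The label is (e_s, ..., e_1). A child is given by a
choice of t with 2 ≤ t ≤ s + 1 and of a ≤ e_{t-1} + 1, where a ≥ 1 unless t = 2. Its s is t; its
sequence arises by adding 1 to e_{t-2}, splitting e_{t-1} + 1 into a (at t - 1) and the rest (at t),
and shifting the later entries. Every choice occurs for exactly one child (`triRule`, `dyckRule`).
Matching choices level by level gives an isomorphism preserving s and all of e, which contains the
column counts (1). A label displays both t and a, so siblings have different labels and no other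
isomorphism exists (`GeneratingRule.iso_unique`).

For paths, both the Dyck condition and "P never below Q" are inequalities between the partial sums
of the exponents (`IsPairSeq`). Passing to the parent shifts these sums and lowers them by one.
Since p_s q_s = 0, the child's exponents are recovered from the parent's and from a = p_s + q_{s-1}.

For a 2-triangulation T with corner r, the vertices r + 1 and r + 2 have a common neighbour j < r,
the apex: column r + 1 occupies rows ≥ j, and column r + 2, above row r, occupies rows ≤ j
(`IsTwoTri.exists_isApex`). Contracting the side (r + 1, r + 2) thus superposes two columns that
share only row j. Conversely a child arises by cutting column r + 1 of the parent at any of its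
members j < r. Crossing pairs can be carried both ways, so maximality survives
(`IsTwoTri.contractSet`, `IsTwoTri.expandSet`). The rank of j in the column is h_{r+2} of the child,
up to a trivial diagonal; this is the free parameter a.

The coloring algorithm walks from T to the root: its blocks are the columns of the current ancestor,
and the uncolored crosses in a block are as many as the crosses in that column (`Stage`). To
identify the colors one goes back from the end (`Future`): the crosses still to be colored, sorted
by their eventual color, are counted in each block by the exponents of the pair of the ancestor, and
blue lies weakly left of red. When a merged block is separated again, blue in its right part
excludes red in its left part. This is the equation p_s q_s = 0, and with the known column count it
leaves only the exponents of the child (`StepData.future`). At the initial stage the blocks are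
single columns, so the output is the pair attached to T. -/

/-- The succession rule shared by the two generating trees: the data `(s', e')` of a node in terms
of the data `(s, e)` of its parent. -/
structure ChildData (s : ℕ) (e : ℕ → ℕ) (s' : ℕ) (e' : ℕ → ℕ) : Prop where
  two_le : 2 ≤ s'
  le_succ : s' ≤ s + 1
  low : ∀ j, j + 3 ≤ s' → e' j = e j
  inc : e' (s' - 2) = e (s' - 2) + 1
  split : e' (s' - 1) + e' s' = e (s' - 1) + 1
  high : ∀ j, s' ≤ j → e' (j + 1) = e j
  pos : 3 ≤ s' → 1 ≤ e' (s' - 1)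

theorem ChildData.ext_of_eq {s t : ℕ} {e e₁ e₂ : ℕ → ℕ} (h₁ : ChildData s e t e₁)
    (h₂ : ChildData s e t e₂) (h : e₁ (t - 1) = e₂ (t - 1)) : e₁ = e₂ := by
  funext j
  have ht := h₁.two_le
  rcases Nat.lt_or_ge (j + 2) t with hj | hj
  · rw [h₁.low j hj, h₂.low j hj]
  rcases hj.eq_or_lt with hj | hj
  · have := h₁.inc; have := h₂.inc
    obtain rfl : j = t - 2 := by omega
    omega
  rcases Nat.lt_or_ge t (j + 1) with hj' | hj'
  · rcases (Nat.lt_succ_iff.1 hj').eq_or_lt with hj' | hj'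
    · have := h₁.split; have := h₂.split
      subst hj'; omega
    · obtain ⟨i, rfl⟩ : ∃ i, j = i + 1 := ⟨j - 1, by omega⟩
      rw [h₁.high i (by omega), h₂.high i (by omega)]
  · obtain rfl : j = t - 1 := by omega
    exact h

/-- Data on the nodes of a labelled tree that determine the labels and obey the succession rule
`ChildData`, each admissible choice being realised by exactly one child. -/
structure GeneratingRule (A : LabelledTree) where
  s : ∀ {l : ℕ}, A.Node l → ℕ
  e : ∀ {l : ℕ}, A.Node l → ℕ → ℕ
  label_eq : ∀ {l : ℕ} (x : A.Node l), A.label x = ((List.range' 1 (s x)).reverse).map (e x)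
  root_s : ∀ x : A.Node 0, s x = 2
  root_e : ∀ x : A.Node 0, e x = 0
  child : ∀ {l : ℕ} (x : A.Node l) (y : A.Node (l + 1)), A.IsParent x y →
    ChildData (s x) (e x) (s y) (e y)
  exists_child : ∀ {l : ℕ} (x : A.Node l) (t a : ℕ), 2 ≤ t → t ≤ s x + 1 →
    a ≤ e x (t - 1) + 1 → (3 ≤ t → 1 ≤ a) → ∃ y, A.IsParent x y ∧ s y = t ∧ e y (t - 1) = a
  child_unique : ∀ {l : ℕ} (x : A.Node l) (y y' : A.Node (l + 1)), A.IsParent x y →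
    A.IsParent x y' → s y = s y' → e y (s y - 1) = e y' (s y - 1) → y = y'

theorem eq_of_map_range_reverse {s s' : ℕ} {e e' : ℕ → ℕ}
    (h : ((List.range' 1 s).reverse).map e = ((List.range' 1 s').reverse).map e') :
    s = s' ∧ ∀ j, 1 ≤ j → j ≤ s → e j = e' j := by
  have hs : s = s' := by simpa using congrArg List.length h
  subst hs
  refine ⟨rfl, fun j h1 h2 => ?_⟩
  exact List.map_inj_left.1 h j (by simp; omega)

namespace GeneratingRule

variable {A B : LabelledTree}

/-- A bijection between two levels that preserves the data. -/
def Preserves (GA : GeneratingRule A) (GB : GeneratingRule B) {l : ℕ}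
    (f : A.Node l ≃ B.Node l) : Prop :=
  ∀ x, GB.s (f x) = GA.s x ∧ GB.e (f x) = GA.e x

/-- Once s and the single entry at s - 1 agree, the rule forces all other entries, so the whole
sequence is matched and not only the part visible in the label. -/
theorem exists_child_match (GA : GeneratingRule A) (GB : GeneratingRule B) {l : ℕ}
    {x : A.Node l} {x' : B.Node l} (hs : GB.s x' = GA.s x) (he : GB.e x' = GA.e x)
    {y : A.Node (l + 1)} (hy : A.IsParent x y) :
    ∃ y', B.IsParent x' y' ∧ GB.s y' = GA.s y ∧ GB.e y' = GA.e y := by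
  have hc := GA.child x y hy
  obtain ⟨y', h1, h2, h3⟩ := GB.exists_child x' (GA.s y) (GA.e y (GA.s y - 1)) hc.two_le
    (by rw [hs]; exact hc.le_succ) (by rw [he]; have := hc.split; omega) hc.pos
  refine ⟨y', h1, h2, ?_⟩
  have hc' := GB.child x' y' h1
  rw [hs, he, h2] at hc'
  exact hc'.ext_of_eq hc h3

theorem exists_succ_equiv (GA : GeneratingRule A) (GB : GeneratingRule B) (hA : A.IsTree)
    (hB : B.IsTree) {l : ℕ} (f : A.Node l ≃ B.Node l) (hf : Preserves GA GB f) :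
    ∃ g : A.Node (l + 1) ≃ B.Node (l + 1), Preserves GA GB g ∧
      ∀ x y, A.IsParent x y ↔ B.IsParent (f x) (g y) := by
  have hA' : ∀ y, ∃ x, A.IsParent x y ∧ ∀ z : A.Node l, A.IsParent z y → z = x := hA.2 l
  have hB' : ∀ y, ∃ x, B.IsParent x y ∧ ∀ z : B.Node l, B.IsParent z y → z = x := hB.2 l
  choose pA hpA hpA' using hA'
  choose pB hpB hpB' using hB'
  have key : ∀ y, ∃ y', B.IsParent (f (pA y)) y' ∧ GB.s y' = GA.s y ∧ GB.e y' = GA.e y :=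
    fun y => exists_child_match GA GB (hf _).1 (hf _).2 (hpA y)
  choose g hg hgs hge using key
  have hpg : ∀ y, pB (g y) = f (pA y) := fun y => (hpB' _ _ (hg y)).symm
  have hinj : Function.Injective g := by
    intro y y' h
    have hp : pA y = pA y' := f.injective (by rw [← hpg, ← hpg, h])
    refine GA.child_unique (pA y) y y' (hpA y) (hp ▸ hpA y') ?_ ?_
    · rw [← hgs, ← hgs, h]
    · rw [← hge, ← hge, h]
  -- The same matching with the two trees exchanged produces a preimage; it is the right one because
  -- siblings are separated by their data.
  have hsurj : Function.Surjective g := by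
    intro z
    obtain ⟨x, hx⟩ := f.surjective (pB z)
    obtain ⟨y, hy1, hy2, hy3⟩ := exists_child_match GB GA (x := pB z) (x' := x)
      (by rw [← hx]; exact (hf x).1.symm) (by rw [← hx]; exact (hf x).2.symm) (hpB z)
    refine ⟨y, GB.child_unique (pB z) _ _ ?_ (hpB z) ?_ ?_⟩
    · rw [← hx, hpA' y x hy1]; exact hg y
    · rw [hgs, hy2]
    · rw [hge, hy3]
  refine ⟨Equiv.ofBijective g ⟨hinj, hsurj⟩, fun y => ⟨hgs y, hge y⟩, fun x y => ?_⟩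
  constructor
  · intro h
    rw [hpA' y x h]; exact hg y
  · intro h
    have : f x = f (pA y) := by rw [← hpg]; exact hpB' _ _ h
    rw [f.injective this]; exact hpA y

theorem exists_preserving_iso (GA : GeneratingRule A) (GB : GeneratingRule B) (hA : A.IsTree)
    (hB : B.IsTree) : ∃ f : ∀ l, A.Node l ≃ B.Node l, (∀ l, Preserves GA GB (f l)) ∧
      ∀ l x y, A.IsParent x y ↔ B.IsParent (f l x) (f (l + 1) y) := by
  obtain ⟨a, -, ha⟩ := hA.1
  obtain ⟨b, -, hb⟩ := hB.1
  let f₀ : A.Node 0 ≃ B.Node 0 :=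
    ⟨fun _ => b, fun _ => a, fun x => (ha x trivial).symm, fun x => (hb x trivial).symm⟩
  have h₀ : Preserves GA GB f₀ := fun x =>
    ⟨by rw [GA.root_s, GB.root_s], by rw [GA.root_e, GB.root_e]⟩
  let F : ∀ l, {f : A.Node l ≃ B.Node l // Preserves GA GB f} := fun l =>
    Nat.rec ⟨f₀, h₀⟩ (fun _ f => ⟨_, (exists_succ_equiv GA GB hA hB f.1 f.2).choose_spec.1⟩) l
  exact ⟨fun l => (F l).1, fun l => (F l).2,
    fun l => (exists_succ_equiv GA GB hA hB (F l).1 (F l).2).choose_spec.2⟩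

theorem Preserves.label_eq {GA : GeneratingRule A} {GB : GeneratingRule B} {l : ℕ}
    {f : A.Node l ≃ B.Node l} (hf : Preserves GA GB f) (x : A.Node l) :
    B.label (f x) = A.label x := by
  rw [GA.label_eq, GB.label_eq, (hf x).1, (hf x).2]

/-- The length of a label is s, and since s ≥ 2 the entry at s - 1 is visible in it. Hence siblings
have different labels, and an isomorphism is forced level by level. -/
theorem iso_unique (GB : GeneratingRule B) (hA : A.IsTree) (hB : B.IsTree)
    {f g : ∀ l, A.Node l ≃ B.Node l} (hf : LabelledTree.IsIso A B f)
    (hg : LabelledTree.IsIso A B g) : g = f := by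
  funext l
  induction l with
  | zero =>
    obtain ⟨b, -, hb⟩ := hB.1
    ext x
    rw [hb (g 0 x) trivial, hb (f 0 x) trivial]
  | succ l ih =>
    ext y
    obtain ⟨x, hx, -⟩ := hA.2 l y
    have h1 := (hf.1 l x y).1 hx
    have h2 := (hg.1 l x y).1 hx
    rw [ih] at h2
    have h3 := (hg.2 _ y).trans (hf.2 _ y).symm
    rw [GB.label_eq, GB.label_eq] at h3
    obtain ⟨h4, h5⟩ := eq_of_map_range_reverse h3
    have := (GB.child _ _ h2).two_le
    exact GB.child_unique _ _ _ h2 h1 h4 (h5 _ (by omega) (by omega))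

end GeneratingRule

end TwoTri
namespace TwoTri

open DyckStep

/-! ### Words and their runs of east steps -/

theorem eastRun_cons_U_zero (w : List DyckStep) : eastRun (U :: w) 0 = 0 := by
  unfold eastRun
  rw [Finset.card_eq_zero, Finset.filter_eq_empty_iff]
  rintro (_ | i) _ <;> simp

theorem eastRun_cons_U_succ (w : List DyckStep) (k : ℕ) :
    eastRun (U :: w) (k + 1) = eastRun w k := by
  unfold eastRun
  rw [Finset.card_filter, Finset.card_filter, List.length_cons, Finset.sum_range_succ']
  simp

theorem eastRun_cons_D_zero (w : List DyckStep) : eastRun (D :: w) 0 = eastRun w 0 + 1 := by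
  unfold eastRun
  rw [Finset.card_filter, Finset.card_filter, List.length_cons, Finset.sum_range_succ']
  simp

theorem eastRun_cons_D_succ (w : List DyckStep) (k : ℕ) :
    eastRun (D :: w) (k + 1) = eastRun w (k + 1) := by
  unfold eastRun
  rw [Finset.card_filter, Finset.card_filter, List.length_cons, Finset.sum_range_succ']
  simp

theorem eastRun_nil (k : ℕ) : eastRun [] k = 0 := by simp [eastRun]

theorem eastRun_of_lt {w : List DyckStep} {k : ℕ} (h : w.count U < k) : eastRun w k = 0 := by
  induction w generalizing k with
  | nil => exact eastRun_nil k
  | cons a w ih =>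
    obtain ⟨k, rfl⟩ : ∃ i, k = i + 1 := ⟨k - 1, by omega⟩
    cases a
    · rw [eastRun_cons_U_succ]; exact ih (by simpa using h)
    · rw [eastRun_cons_D_succ]; exact ih (by simpa using h)

/-- The number of east steps made before the `(k + 1)`-st north step. -/
def eastsBefore (w : List DyckStep) (k : ℕ) : ℕ := ∑ i ∈ Finset.range (k + 1), eastRun w i

theorem eastsBefore_nil (k : ℕ) : eastsBefore [] k = 0 := by simp [eastsBefore, eastRun_nil]

theorem eastsBefore_cons_U_zero (w : List DyckStep) : eastsBefore (U :: w) 0 = 0 := by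
  simp [eastsBefore, eastRun_cons_U_zero]

theorem eastsBefore_cons_U_succ (w : List DyckStep) (k : ℕ) :
    eastsBefore (U :: w) (k + 1) = eastsBefore w k := by
  unfold eastsBefore
  rw [Finset.sum_range_succ']
  simp [eastRun_cons_U_zero, eastRun_cons_U_succ]

theorem eastsBefore_cons_D (w : List DyckStep) (k : ℕ) :
    eastsBefore (D :: w) k = eastsBefore w k + 1 := by
  unfold eastsBefore
  rw [Finset.sum_range_succ', Finset.sum_range_succ' _ k]
  simp [eastRun_cons_D_zero, eastRun_cons_D_succ, add_assoc]

theorem eastsBefore_mono (w : List DyckStep) : Monotone (eastsBefore w) := fun a b h =>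
  Finset.sum_le_sum_of_subset (Finset.range_mono (by omega))

theorem eastsBefore_of_le {w : List DyckStep} {k : ℕ} (h : w.count U ≤ k) :
    eastsBefore w k = w.count D := by
  induction w generalizing k with
  | nil => simp [eastsBefore_nil]
  | cons a w ih =>
    cases a
    · obtain ⟨k, rfl⟩ : ∃ i, k = i + 1 := ⟨k - 1, by simp at h; omega⟩
      rw [eastsBefore_cons_U_succ, ih (by simpa using h)]; simp
    · rw [eastsBefore_cons_D, ih (by simpa using h)]; simp

theorem count_U_add_count_D (w : List DyckStep) : w.count U + w.count D = w.length := by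
  induction w with
  | nil => rfl
  | cons a w ih => cases a <;> simp <;> omega

/-- This prefix stops just before the (k + 1)-st north step, or at the end of the word. At such
places a path is furthest to the right for its height, so the inequalities on all prefixes need be
tested only there. -/
theorem count_U_take {w : List DyckStep} {k : ℕ} (h : k ≤ w.count U) :
    (w.take (k + eastsBefore w k)).count U = k := by
  induction w generalizing k with
  | nil => simp at h; simp [h]
  | cons a w ih =>
    cases a
    · cases k with
      | zero => simp [eastsBefore_cons_U_zero]
      | succ k =>
        rw [eastsBefore_cons_U_succ, show k + 1 + eastsBefore w k = k + eastsBefore w k + 1 by omega]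
        simp [ih (k := k) (by simpa using h)]
    · rw [eastsBefore_cons_D, ← add_assoc]
      simp [ih (k := k) (by simpa using h)]

theorem count_D_take_le (w : List DyckStep) (i : ℕ) :
    (w.take i).count D ≤ eastsBefore w ((w.take i).count U) := by
  induction w generalizing i with
  | nil => simp
  | cons a w ih =>
    cases i with
    | zero => simp
    | succ i =>
      cases a
      · simpa [eastsBefore_cons_U_succ] using ih i
      · simpa [eastsBefore_cons_D] using ih i

theorem add_eastsBefore_le_length {w : List DyckStep} {k : ℕ} (h : k ≤ w.count U) :
    k + eastsBefore w k ≤ w.length := by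
  have h1 := eastsBefore_mono w h
  rw [eastsBefore_of_le le_rfl] at h1
  have := count_U_add_count_D w
  omega

theorem count_D_take {w : List DyckStep} {k : ℕ} (h : k ≤ w.count U) :
    (w.take (k + eastsBefore w k)).count D = eastsBefore w k := by
  have h1 := count_U_add_count_D (w.take (k + eastsBefore w k))
  rw [count_U_take h, List.length_take, min_eq_left (add_eastsBefore_le_length h)] at h1
  omega

theorem count_D_le_count_U_iff (w : List DyckStep) :
    (∀ i, (w.take i).count D ≤ (w.take i).count U) ↔ ∀ k ≤ w.count U, eastsBefore w k ≤ k := by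
  constructor
  · intro h k hk
    have := h (k + eastsBefore w k)
    rwa [count_U_take hk, count_D_take hk] at this
  · intro h i
    exact (count_D_take_le w i).trans (h _ ((List.take_sublist i w).count_le U))

theorem count_U_take_mono (w : List DyckStep) {i j : ℕ} (h : i ≤ j) :
    (w.take i).count U ≤ (w.take j).count U :=
  ((List.take_prefix_take_left h).sublist).count_le U

/-- P stays above Q exactly when P makes each of its north steps after at most as many east steps as
Q does. -/
theorem neverBelow_iff {P Q : DyckWord} {m : ℕ} (hP : P.semilength = m) (hQ : Q.semilength = m) :
    NeverBelow P Q ↔ ∀ k ≤ m, eastsBefore P.toList k ≤ eastsBefore Q.toList k := by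
  have hP' : P.toList.count U = m := hP
  have hQ' : Q.toList.count U = m := hQ
  have hPl := P.two_mul_semilength_eq_length
  have hQl := Q.two_mul_semilength_eq_length
  constructor
  · intro h k hk
    have hi := add_eastsBefore_le_length (hP'.symm ▸ hk)
    have h1 := h (k + eastsBefore P.toList k)
    rw [count_U_take (hP'.symm ▸ hk)] at h1
    have h2 := count_U_add_count_D (Q.toList.take (k + eastsBefore P.toList k))
    rw [List.length_take, min_eq_left (by omega)] at h2
    have h3 := count_D_take_le Q.toList (k + eastsBefore P.toList k)
    have h4 := eastsBefore_mono Q.toList h1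
    omega
  · intro h i
    rcases Nat.lt_or_ge P.toList.length i with hi | hi
    · rw [List.take_of_length_le hi.le, List.take_of_length_le (by omega), hP', hQ']
    · set k := (P.toList.take i).count U with hk
      have hkm : k ≤ m := hP' ▸ (List.take_sublist i _).count_le U
      have h1 := count_D_take_le P.toList i
      have h2 := count_U_add_count_D (P.toList.take i)
      rw [List.length_take, min_eq_left hi] at h2
      have h3 := h k hkm
      rw [← hk] at h1 h2
      calc (Q.toList.take i).count U ≤ (Q.toList.take (k + eastsBefore Q.toList k)).count U :=
            count_U_take_mono _ (by omega)
        _ = k := count_U_take (hQ'.symm ▸ hkm)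

/-- The word `U D^{f 0} U D^{f 1} ⋯ U D^{f (t - 1)}`. -/
def runWord : (ℕ → ℕ) → ℕ → List DyckStep
  | _, 0 => []
  | f, t + 1 => U :: (List.replicate (f 0) D ++ runWord (fun i => f (i + 1)) t)

theorem eastRun_replicate_append_zero (c : ℕ) (w : List DyckStep) :
    eastRun (List.replicate c D ++ w) 0 = c + eastRun w 0 := by
  induction c with
  | zero => simp
  | succ c ih => rw [List.replicate_succ, List.cons_append, eastRun_cons_D_zero, ih]; omega

theorem eastRun_replicate_append_succ (c : ℕ) (w : List DyckStep) (k : ℕ) :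
    eastRun (List.replicate c D ++ w) (k + 1) = eastRun w (k + 1) := by
  induction c with
  | zero => simp
  | succ c ih => rw [List.replicate_succ, List.cons_append, eastRun_cons_D_succ, ih]

theorem eastRun_runWord_zero (f : ℕ → ℕ) (t : ℕ) : eastRun (runWord f t) 0 = 0 := by
  cases t
  · exact eastRun_nil 0
  · exact eastRun_cons_U_zero _

theorem eastRun_runWord_succ (f : ℕ → ℕ) (t k : ℕ) :
    eastRun (runWord f t) (k + 1) = if k < t then f k else 0 := by
  induction t generalizing f k with
  | zero => simp [runWord, eastRun_nil]
  | succ t ih =>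
    rw [runWord, eastRun_cons_U_succ]
    cases k with
    | zero => simp [eastRun_replicate_append_zero, eastRun_runWord_zero]
    | succ k => simp [eastRun_replicate_append_succ, ih]

theorem count_U_runWord (f : ℕ → ℕ) (t : ℕ) : (runWord f t).count U = t := by
  induction t generalizing f with
  | zero => rfl
  | succ t ih => simp [runWord, ih, List.count_replicate]

theorem runWord_congr {f g : ℕ → ℕ} {t : ℕ} (h : ∀ i < t, f i = g i) :
    runWord f t = runWord g t := by
  induction t generalizing f g with
  | zero => rfl
  | succ t ih =>
    rw [runWord, runWord, h 0 (by omega), ih fun i hi => h (i + 1) (by omega)]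

theorem eq_runWord (w : List DyckStep) : w = List.replicate (eastRun w 0) D ++
    runWord (fun i => eastRun w (i + 1)) (w.count U) := by
  induction w with
  | nil => simp [eastRun_nil, runWord]
  | cons a w ih =>
    cases a
    · simp only [eastRun_cons_U_zero, eastRun_cons_U_succ, List.count_cons_self, runWord,
        List.replicate_zero, List.nil_append]
      rw [← ih]
    · simp only [eastRun_cons_D_zero, eastRun_cons_D_succ, List.replicate_succ, List.cons_append]
      rw [List.count_cons_of_ne (by decide), ← ih]

theorem runWord_append_D (f : ℕ → ℕ) (t : ℕ) :
    runWord f (t + 1) ++ [D] = runWord (fun i => f i + if i = t then 1 else 0) (t + 1) := by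
  induction t generalizing f with
  | zero => simp [runWord, List.replicate_succ']
  | succ t ih =>
    rw [runWord, List.cons_append, List.append_assoc, ih]
    conv_rhs => rw [runWord]
    simp

theorem flatMap_range' (f : ℕ → ℕ) (u t : ℕ) :
    (List.range' u t).flatMap (fun j => U :: List.replicate (f j) D) =
      runWord (fun i => f (u + i)) t := by
  induction t generalizing u with
  | zero => rfl
  | succ t ih =>
    rw [List.range'_succ, List.flatMap_cons, ih, runWord]
    simp [add_assoc, add_comm 1]

/-! ### Dyck paths and sequences of exponents -/

/-- The sequences of exponents of the Dyck paths of size `m`. -/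
structure IsDyckSeq (m : ℕ) (c : ℕ → ℕ) : Prop where
  zero : c 0 = 0
  gt : ∀ j, m < j → c j = 0
  sum : ∑ j ∈ Finset.range (m + 1), c j + 1 = m
  lower : ∀ t ≤ m, t ≤ ∑ j ∈ Finset.range (t + 1), c j + 1

theorem eastRun_zero_dyckWord (P : DyckWord) : eastRun P.toList 0 = 0 := by
  have h := (count_D_le_count_U_iff _).1 P.count_D_le_count_U 0 (by omega)
  simpa [eastsBefore] using h

theorem eastsBefore_dyckWord_le (P : DyckWord) {k : ℕ} (hk : k ≤ P.semilength) :
    eastsBefore P.toList k ≤ k :=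
  (count_D_le_count_U_iff _).1 P.count_D_le_count_U k hk

theorem eastsBefore_dyckWord_self (P : DyckWord) :
    eastsBefore P.toList P.semilength = P.semilength := by
  rw [eastsBefore_of_le (w := P.toList) (k := P.semilength) le_rfl, ← P.count_U_eq_count_D]
  rfl

theorem eastsBefore_succ (w : List DyckStep) (k : ℕ) :
    eastsBefore w (k + 1) = eastsBefore w k + eastRun w (k + 1) :=
  Finset.sum_range_succ _ _

/-- The subtraction in `exponent` is never truncated: a nonempty Dyck path ends with an east step,
so its last run is positive. -/
theorem exponent_add_ite (P : DyckWord) {j : ℕ} (hP : 1 ≤ P.semilength) :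
    exponent P j + (if j = 1 then 1 else 0) = eastRun P.toList (P.semilength + 1 - j) := by
  unfold exponent
  split_ifs with h
  · subst h
    have h1 := eastsBefore_dyckWord_self P
    obtain ⟨m, hm⟩ : ∃ m, P.semilength = m + 1 := ⟨P.semilength - 1, by omega⟩
    have h2 := eastsBefore_dyckWord_le P (k := m) (by omega)
    rw [hm, eastsBefore_succ] at h1
    rw [hm]
    simp only [Nat.add_sub_cancel]
    omega
  · rfl

theorem exponent_zero (P : DyckWord) : exponent P 0 = 0 := by
  unfold exponent
  rw [eastRun_of_lt (w := P.toList) (k := P.semilength + 1 - 0) (Nat.lt_succ_self _)]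
  simp

theorem exponent_of_gt (P : DyckWord) {j : ℕ} (h : P.semilength < j) : exponent P j = 0 := by
  unfold exponent
  rw [show P.semilength + 1 - j = 0 by omega, eastRun_zero_dyckWord, Nat.zero_sub]

/-- Exponents are indexed from the end of the path, so the first t of them, with the final east step
added, count the east steps that follow the (m - t + 1)-st north step, m being the size. -/
theorem sum_exponent (P : DyckWord) {t : ℕ} (h1 : 1 ≤ t) (ht : t ≤ P.semilength) :
    ∑ j ∈ Finset.range (t + 1), exponent P j + 1 + eastsBefore P.toList (P.semilength - t) =
      P.semilength := by
  induction t, h1 using Nat.le_induction with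
  | base =>
    rw [Finset.sum_range_succ, Finset.sum_range_one, exponent_zero]
    have h2 := exponent_add_ite P (j := 1) ht
    have h3 := eastsBefore_dyckWord_self P
    obtain ⟨m, hm⟩ : ∃ m, P.semilength = m + 1 := ⟨P.semilength - 1, by omega⟩
    rw [hm, eastsBefore_succ] at h3
    rw [hm] at h2 ⊢
    simp at h2 ⊢
    omega
  | succ t h1 ih =>
    have h2 := exponent_add_ite P (j := t + 1) (by omega)
    rw [Finset.sum_range_succ]
    have h3 := ih (by omega)
    obtain ⟨m, hm⟩ : ∃ m, P.semilength = m + t + 1 := ⟨P.semilength - t - 1, by omega⟩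
    rw [show P.semilength - t = m + 1 by omega, eastsBefore_succ] at h3
    rw [show P.semilength - (t + 1) = m by omega]
    rw [show P.semilength + 1 - (t + 1) = m + 1 by omega, if_neg (by omega)] at h2
    omega

theorem isDyckSeq_exponent (P : DyckWord) (hP : 1 ≤ P.semilength) :
    IsDyckSeq P.semilength (exponent P) where
  zero := exponent_zero P
  gt _ h := exponent_of_gt P h
  sum := by
    have h := sum_exponent P hP le_rfl
    rw [Nat.sub_self, eastsBefore, Finset.sum_range_one, eastRun_zero_dyckWord] at h
    exact h
  lower t ht := by
    rcases Nat.eq_zero_or_pos t with rfl | h1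
    · omega
    have h := sum_exponent P h1 ht
    have := eastsBefore_dyckWord_le P (k := P.semilength - t) (by omega)
    omega

theorem toList_eq_runWord (P : DyckWord) (hP : 1 ≤ P.semilength) :
    P.toList = runWord (fun i => exponent P (P.semilength - i)) P.semilength ++ [D] := by
  obtain ⟨m, hm⟩ : ∃ m, P.semilength = m + 1 := ⟨P.semilength - 1, by omega⟩
  conv_lhs => rw [eq_runWord P.toList]
  rw [eastRun_zero_dyckWord, List.replicate_zero, List.nil_append,
    show P.toList.count U = m + 1 from hm, hm, runWord_append_D]
  refine runWord_congr fun i hi => ?_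
  have h := exponent_add_ite P (j := P.semilength - i) hP
  rw [show P.semilength + 1 - (P.semilength - i) = i + 1 by omega] at h
  rw [← h, hm]
  congr 2
  simp; omega

theorem exists_dyckWord {m : ℕ} {c : ℕ → ℕ} (h : IsDyckSeq m c) :
    ∃ P : DyckWord, P.semilength = m ∧ exponent P = c := by
  have hm : 1 ≤ m := by have := h.sum; omega
  -- Runs are listed from the start and exponents from the end; the extra 1 restores the final east
  -- step.
  set g : ℕ → ℕ := fun i => c (m - i) + if m - i = 1 then 1 else 0 with hg
  set w := runWord g m with hw
  have hU : w.count U = m := count_U_runWord g m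
  have hrun : ∀ j, c j + (if j = 1 then 1 else 0) = eastRun w (m + 1 - j) := by
    intro j
    rcases Nat.eq_zero_or_pos j with rfl | hj
    · rw [eastRun_of_lt (by omega), h.zero]; simp
    rcases Nat.lt_or_ge m j with hj' | hj'
    · rw [h.gt j hj', if_neg (by omega), show m + 1 - j = 0 by omega, eastRun_runWord_zero]
    · rw [show m + 1 - j = m - j + 1 by omega, eastRun_runWord_succ,
        if_pos (by omega : m - j < m), hg]
      simp only [show m - (m - j) = j by omega]
  have hsum : ∀ t ≤ m, 1 ≤ t → ∑ j ∈ Finset.range (t + 1), c j + 1 + eastsBefore w (m - t) =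
      eastsBefore w m := by
    intro t ht h1
    induction t, h1 using Nat.le_induction with
    | base =>
      rw [Finset.sum_range_succ, Finset.sum_range_one, h.zero]
      have h1 := hrun 1
      obtain ⟨k, rfl⟩ : ∃ k, m = k + 1 := ⟨m - 1, by omega⟩
      rw [eastsBefore_succ]
      simp at h1 ⊢
      omega
    | succ t h1 ih =>
      rw [Finset.sum_range_succ, ← ih (by omega)]
      have h2 := hrun (t + 1)
      obtain ⟨k, rfl⟩ : ∃ k, m = k + t + 1 := ⟨m - t - 1, by omega⟩
      rw [show k + t + 1 - t = k + 1 by omega, eastsBefore_succ,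
        show k + t + 1 - (t + 1) = k by omega]
      rw [if_neg (by omega), show k + t + 1 + 1 - (t + 1) = k + 1 by omega] at h2
      omega
  have hm' : eastsBefore w m = m := by
    rw [← hsum m le_rfl hm, h.sum, Nat.sub_self, eastsBefore, Finset.sum_range_one,
      eastRun_runWord_zero, add_zero]
  have hle : ∀ k ≤ w.count U, eastsBefore w k ≤ k := by
    intro k hk
    rw [hU] at hk
    rcases hk.eq_or_lt with rfl | hk
    · exact hm'.le
    · have h1 := hsum (m - k) (by omega) (by omega)
      have h2 := h.lower (m - k) (by omega)
      rw [hm', show m - (m - k) = k by omega] at h1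
      omega
  have hUD : w.count U = w.count D := by rw [hU, ← eastsBefore_of_le hU.le, hm']
  refine ⟨⟨w, hUD, (count_D_le_count_U_iff w).2 hle⟩, hU, ?_⟩
  funext j
  have h1 : exponent ⟨w, hUD, (count_D_le_count_U_iff w).2 hle⟩ j =
    eastRun w (w.count U + 1 - j) - if j = 1 then 1 else 0 := rfl
  rw [h1, hU, ← hrun j, Nat.add_sub_cancel]

theorem neverBelow_iff_sum {P Q : DyckWord} {m : ℕ} (hm : 1 ≤ m) (hP : P.semilength = m)
    (hQ : Q.semilength = m) : NeverBelow P Q ↔ ∀ t ≤ m,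
      ∑ j ∈ Finset.range (t + 1), exponent Q j ≤ ∑ j ∈ Finset.range (t + 1), exponent P j := by
  rw [neverBelow_iff hP hQ]
  constructor
  · intro h t ht
    rcases Nat.eq_zero_or_pos t with rfl | h1
    · simp [exponent_zero]
    have h2 := sum_exponent P h1 (by omega)
    have h3 := sum_exponent Q h1 (by omega)
    have h4 := h (m - t) (by omega)
    rw [hP] at h2; rw [hQ] at h3
    omega
  · intro h k hk
    rcases hk.eq_or_lt with rfl | hk
    · have h1 := eastsBefore_dyckWord_self P
      have h2 := eastsBefore_dyckWord_self Q
      rw [hP] at h1; rw [hQ] at h2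
      omega
    · have h2 := sum_exponent P (t := m - k) (by omega) (by omega)
      have h3 := sum_exponent Q (t := m - k) (by omega) (by omega)
      have h4 := h (m - k) (by omega)
      rw [hP] at h2; rw [hQ] at h3
      rw [show m - (m - k) = k by omega] at h2 h3
      omega

/-- The pairs of sequences of exponents of the members of `DyckPair m`. -/
structure IsPairSeq (m : ℕ) (p q : ℕ → ℕ) : Prop where
  fst : IsDyckSeq m p
  snd : IsDyckSeq m q
  le : ∀ t ≤ m, ∑ j ∈ Finset.range (t + 1), q j ≤ ∑ j ∈ Finset.range (t + 1), p j

namespace DyckPair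

variable {m : ℕ}

theorem isPairSeq (hm : 1 ≤ m) (x : DyckPair m) : IsPairSeq m x.p x.q where
  fst := by
    have h := isDyckSeq_exponent x.1.1 (by rw [x.2.1]; exact hm)
    rwa [x.2.1] at h
  snd := by
    have h := isDyckSeq_exponent x.1.2 (by rw [x.2.2.1]; exact hm)
    rwa [x.2.2.1] at h
  le := (neverBelow_iff_sum hm x.2.1 x.2.2.1).1 x.2.2.2

theorem exists_of_isPairSeq {p q : ℕ → ℕ} (h : IsPairSeq m p q) :
    ∃ x : DyckPair m, x.p = p ∧ x.q = q := by
  have hm : 1 ≤ m := by have := h.fst.sum; omega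
  obtain ⟨P, hP, rfl⟩ := exists_dyckWord h.fst
  obtain ⟨Q, hQ, rfl⟩ := exists_dyckWord h.snd
  exact ⟨⟨(P, Q), hP, hQ, (neverBelow_iff_sum hm hP hQ).2 h.le⟩, rfl, rfl⟩

theorem toList_fst_eq (hm : 1 ≤ m) (x : DyckPair m) :
    x.1.1.toList = runWord (fun i => x.p (m - i)) m ++ [D] := by
  have h := toList_eq_runWord x.1.1 (by rw [x.2.1]; exact hm)
  rwa [x.2.1] at h

theorem toList_snd_eq (hm : 1 ≤ m) (x : DyckPair m) :
    x.1.2.toList = runWord (fun i => x.q (m - i)) m ++ [D] := by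
  have h := toList_eq_runWord x.1.2 (by rw [x.2.2.1]; exact hm)
  rwa [x.2.2.1] at h

theorem ext_of_eq (hm : 1 ≤ m) {x y : DyckPair m} (hp : x.p = y.p) (hq : x.q = y.q) : x = y := by
  apply Subtype.ext
  apply Prod.ext
  · apply DyckWord.ext
    rw [toList_fst_eq hm, toList_fst_eq hm, hp]
  · apply DyckWord.ext
    rw [toList_snd_eq hm, toList_snd_eq hm, hq]

end DyckPair

end TwoTri
namespace TwoTri

/-! ### The generating tree of pairs of Dyck paths -/

/-- The relation between the sequences `P`, `Q` of a parent and the sequences `p`, `q` of a child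
with `s = u + 2`. -/
structure SeqParent (u : ℕ) (P Q p q : ℕ → ℕ) : Prop where
  low_p : ∀ j ≤ u, P j = p j
  low_q : ∀ j ≤ u, Q j = q j
  mid_p : P (u + 1) + 1 = p (u + 1)
  mid_q : Q (u + 1) + 1 = q (u + 2) + q (u + 1)
  top_p : P (u + 2) = p (u + 3) + p (u + 2)
  high_p : ∀ j, u + 3 ≤ j → P j = p (j + 1)
  high_q : ∀ j, u + 2 ≤ j → Q j = q (j + 1)

namespace SeqParent

variable {u : ℕ} {P Q p q : ℕ → ℕ}

theorem sum_low_p (h : SeqParent u P Q p q) {t : ℕ} (ht : t ≤ u) :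
    ∑ j ∈ Finset.range (t + 1), P j = ∑ j ∈ Finset.range (t + 1), p j :=
  Finset.sum_congr rfl fun j hj => h.low_p j (by simp at hj; omega)

theorem sum_low_q (h : SeqParent u P Q p q) {t : ℕ} (ht : t ≤ u) :
    ∑ j ∈ Finset.range (t + 1), Q j = ∑ j ∈ Finset.range (t + 1), q j :=
  Finset.sum_congr rfl fun j hj => h.low_q j (by simp at hj; omega)

theorem sum_mid_p (h : SeqParent u P Q p q) :
    ∑ j ∈ Finset.range (u + 2), P j + 1 = ∑ j ∈ Finset.range (u + 2), p j := by
  rw [Finset.sum_range_succ, Finset.sum_range_succ p, h.sum_low_p le_rfl, add_assoc, h.mid_p]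

/-- From u + 1 on, the partial sums of the second sequence move one place and drop by one. For the
first sequence the drop already occurs at u + 1, while the move starts at u + 2. -/
theorem sum_high_q (h : SeqParent u P Q p q) {t : ℕ} (ht : u + 1 ≤ t) :
    ∑ j ∈ Finset.range (t + 1), Q j + 1 = ∑ j ∈ Finset.range (t + 2), q j := by
  induction t, ht using Nat.le_induction with
  | base =>
    rw [Finset.sum_range_succ, Finset.sum_range_succ q, Finset.sum_range_succ q,
      h.sum_low_q le_rfl]
    have := h.mid_q
    omega
  | succ t ht ih =>
    rw [Finset.sum_range_succ, Finset.sum_range_succ q, ← ih, h.high_q (t + 1) (by omega)]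
    exact add_right_comm _ _ _

theorem sum_high_p (h : SeqParent u P Q p q) {t : ℕ} (ht : u + 2 ≤ t) :
    ∑ j ∈ Finset.range (t + 1), P j + 1 = ∑ j ∈ Finset.range (t + 2), p j := by
  induction t, ht using Nat.le_induction with
  | base =>
    rw [Finset.sum_range_succ, Finset.sum_range_succ p, Finset.sum_range_succ p, ← h.sum_mid_p]
    have := h.top_p
    omega
  | succ t ht ih =>
    rw [Finset.sum_range_succ, Finset.sum_range_succ p, ← ih, h.high_p (t + 1) (by omega)]
    exact add_right_comm _ _ _

end SeqParent

/-- The lower path being Dyck makes the upper one Dyck, so the lower bound on partial sums is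
checked for q alone. -/
theorem IsPairSeq.mk_of_lower {m : ℕ} {p q : ℕ → ℕ} (hp0 : p 0 = 0) (hq0 : q 0 = 0)
    (hp : ∀ j, m < j → p j = 0) (hq : ∀ j, m < j → q j = 0)
    (hps : ∑ j ∈ Finset.range (m + 1), p j + 1 = m)
    (hqs : ∑ j ∈ Finset.range (m + 1), q j + 1 = m)
    (hle : ∀ t ≤ m, ∑ j ∈ Finset.range (t + 1), q j ≤ ∑ j ∈ Finset.range (t + 1), p j)
    (hl : ∀ t ≤ m, t ≤ ∑ j ∈ Finset.range (t + 1), q j + 1) : IsPairSeq m p q :=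
  ⟨⟨hp0, hp, hps, fun t ht => (hl t ht).trans (by have := hle t ht; omega)⟩, ⟨hq0, hq, hqs, hl⟩,
    hle⟩

namespace SeqParent

variable {u m : ℕ} {P Q p q : ℕ → ℕ}

/-- The delicate comparison is at t = u + 1, where q_1 + ... + q_{u+2} ≤ p_1 + ... + p_{u+1} is
needed. If p_{u+2} = 0 this is the comparison of the child at u + 2; if q_{u+2} = 0 it is the one at
u + 1. -/
theorem isPairSeq_parent (h : SeqParent u P Q p q) (hx : IsPairSeq (m + 1) p q) (hu : u ≤ m)
    (hs : p (u + 2) * q (u + 2) = 0) : IsPairSeq m P Q := by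
  have hps := hx.fst.sum
  have hqs := hx.snd.sum
  have h1 := hx.le m (by omega)
  have h2 := hx.snd.lower m (by omega)
  rw [Finset.sum_range_succ] at hps hqs
  have hs' := mul_eq_zero.1 hs
  have hmp := h.mid_p
  have hmq := h.mid_q
  have hsp : ∑ j ∈ Finset.range (m + 1), P j + 1 = m := by
    rcases Nat.lt_or_ge m (u + 2) with hm | hm
    · rcases Nat.lt_or_ge m (u + 1) with hm' | hm'
      · obtain rfl : m = u := by omega
        have := h.sum_low_p le_rfl
        omega
      -- One needs p_{u+2} = 0. If q_{u+2} = 0 instead, the first m exponents of q already sum to m,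
      -- hence so do those of p, and nothing remains for p_{u+2}.
      · obtain rfl : m = u + 1 := by omega
        have h3 : ∑ j ∈ Finset.range (u + 1 + 1), P j + 1 = ∑ j ∈ Finset.range (u + 1 + 1), p j :=
          h.sum_mid_p
        have e1 : p (u + 1 + 1) = p (u + 2) := rfl
        have e2 : q (u + 1 + 1) = q (u + 2) := rfl
        omega
    · have := h.sum_high_p hm
      rw [Finset.sum_range_succ p] at this
      omega
  have hsq : ∑ j ∈ Finset.range (m + 1), Q j + 1 = m := by
    rcases Nat.lt_or_ge m (u + 1) with hm' | hm'
    · obtain rfl : m = u := by omega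
      have := h.sum_low_q le_rfl
      have := hx.snd.gt (m + 2) (by omega)
      omega
    · have := h.sum_high_q hm'
      rw [Finset.sum_range_succ q] at this
      omega
  refine IsPairSeq.mk_of_lower ?_ ?_ ?_ ?_ hsp hsq ?_ ?_
  · rw [h.low_p 0 (by omega), hx.fst.zero]
  · rw [h.low_q 0 (by omega), hx.snd.zero]
  · intro j hj
    rcases Nat.lt_or_ge j (u + 3) with hm | hm
    · rcases Nat.lt_or_ge j (u + 2) with hm' | hm'
      · obtain rfl : j = u + 1 := by omega
        obtain rfl : m = u := by omega
        omega
      · obtain rfl : j = u + 2 := by omega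
        rw [h.top_p, hx.fst.gt (u + 3) (by omega), zero_add]
        rcases Nat.lt_or_ge (m + 1) (u + 2) with hm' | hm'
        · exact hx.fst.gt _ hm'
        · obtain rfl : m = u + 1 := by omega
          have e1 : p (u + 1 + 1) = p (u + 2) := rfl
          have e2 : q (u + 1 + 1) = q (u + 2) := rfl
          omega
    · rw [h.high_p j hm, hx.fst.gt _ (by omega)]
  · intro j hj
    rcases Nat.lt_or_ge j (u + 2) with hm | hm
    · obtain rfl : j = u + 1 := by omega
      obtain rfl : m = u := by omega
      have := hx.snd.gt (m + 2) (by omega)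
      omega
    · rw [h.high_q j hm, hx.snd.gt _ (by omega)]
  · intro t ht
    rcases Nat.lt_or_ge t (u + 1) with hm | hm
    · rw [h.sum_low_p (by omega), h.sum_low_q (by omega)]
      exact hx.le t (by omega)
    · have h3 := h.sum_high_q hm
      have h4 := hx.le (t + 1) (by omega)
      rcases Nat.lt_or_ge t (u + 2) with hm' | hm'
      · obtain rfl : t = u + 1 := by omega
        have h5 := h.sum_mid_p
        have h6 := hx.le (u + 1) (by omega)
        rw [Finset.sum_range_succ q] at h3 h4
        rw [Finset.sum_range_succ p] at h4
        rw [show u + 1 + 1 = u + 2 from rfl] at *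
        omega
      · have h5 := h.sum_high_p hm'
        rw [show t + 1 + 1 = t + 2 from rfl] at *
        omega
  · intro t ht
    rcases Nat.lt_or_ge t (u + 1) with hm | hm
    · rw [h.sum_low_q (by omega)]
      exact hx.snd.lower t (by omega)
    · have h3 := h.sum_high_q hm
      have h4 := hx.snd.lower (t + 1) (by omega)
      rw [show t + 1 + 1 = t + 2 from rfl] at *
      omega

/-- The positivity of q_{u+1} serves only the lower bound at t = u + 1, where the parent's bound at
u falls short by one. It is the origin of the condition a ≥ 1 in the succession rule. -/
theorem isPairSeq_child (h : SeqParent u P Q p q) (hy : IsPairSeq m P Q) (hu : u ≤ m)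
    (hq : 1 ≤ u → 1 ≤ q (u + 1)) : IsPairSeq (m + 1) p q := by
  have hps := hy.fst.sum
  have hqs := hy.snd.sum
  have hmp := h.mid_p
  have hmq := h.mid_q
  have htp := h.top_p
  have hsp : ∑ j ∈ Finset.range (m + 2), p j + 1 = m + 1 := by
    rcases Nat.lt_or_ge m (u + 2) with hm | hm
    · rcases Nat.lt_or_ge m (u + 1) with hm' | hm'
      · obtain rfl : m = u := by omega
        have h1 := h.sum_mid_p
        have h2 := hy.fst.gt (m + 1) (by omega)
        rw [Finset.sum_range_succ] at h1
        omega
      · obtain rfl : m = u + 1 := by omega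
        have h1 := h.sum_mid_p
        have h2 := hy.fst.gt (u + 2) (by omega)
        rw [Finset.sum_range_succ]
        rw [show u + 1 + 1 = u + 2 from rfl] at *
        omega
    · have := h.sum_high_p hm
      omega
  have hsq : ∑ j ∈ Finset.range (m + 2), q j + 1 = m + 1 := by
    rcases Nat.lt_or_ge m (u + 1) with hm' | hm'
    · obtain rfl : m = u := by omega
      have h1 := h.sum_low_q le_rfl
      have h2 := hy.snd.gt (m + 1) (by omega)
      rw [Finset.sum_range_succ]
      omega
    · have := h.sum_high_q hm'
      omega
  refine IsPairSeq.mk_of_lower ?_ ?_ ?_ ?_ hsp hsq ?_ ?_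
  · rw [← h.low_p 0 (by omega), hy.fst.zero]
  · rw [← h.low_q 0 (by omega), hy.snd.zero]
  · intro j hj
    rcases Nat.lt_or_ge j (u + 4) with hm | hm
    · have := hy.fst.gt (u + 2) (by omega)
      rcases (show j = u + 2 ∨ j = u + 3 by omega) with rfl | rfl <;> omega
    · obtain ⟨j, rfl⟩ : ∃ i, j = i + 1 := ⟨j - 1, by omega⟩
      rw [← h.high_p j (by omega), hy.fst.gt j (by omega)]
  · intro j hj
    rcases Nat.lt_or_ge j (u + 3) with hm | hm
    · have := hy.snd.gt (u + 1) (by omega)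
      obtain rfl : j = u + 2 := by omega
      omega
    · obtain ⟨j, rfl⟩ : ∃ i, j = i + 1 := ⟨j - 1, by omega⟩
      rw [← h.high_q j (by omega), hy.snd.gt j (by omega)]
  · intro t ht
    rcases Nat.lt_or_ge t (u + 1) with hm | hm
    · rw [← h.sum_low_p (by omega), ← h.sum_low_q (by omega)]
      exact hy.le t (by omega)
    have h5 := h.sum_mid_p
    rcases hm.eq_or_lt with rfl | hm
    · have h3 := h.sum_low_q le_rfl
      rw [Finset.sum_range_succ, ← h3, ← h5]
      rcases Nat.lt_or_ge m (u + 1) with hm' | hm'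
      · obtain rfl : m = u := by omega
        have h6 := hy.le m (by omega)
        have h2 := hy.snd.gt (m + 1) (by omega)
        rw [Finset.sum_range_succ P]
        omega
      · have h4 := hy.le (u + 1) (by omega)
        rw [Finset.sum_range_succ Q] at h4
        rw [show u + 1 + 1 = u + 2 from rfl] at *
        omega
    · obtain ⟨t, rfl⟩ : ∃ i, t = i + 1 := ⟨t - 1, by omega⟩
      have h3 := h.sum_high_q (t := t) (by omega)
      have h4 := hy.le t (by omega)
      rw [show t + 1 + 1 = t + 2 from rfl]
      rcases Nat.lt_or_ge t (u + 2) with hm' | hm'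
      · obtain rfl : t = u + 1 := by omega
        rw [Finset.sum_range_succ p]
        rw [show u + 1 + 1 = u + 2 from rfl] at *
        omega
      · have h6 := h.sum_high_p hm'
        omega
  · intro t ht
    rcases Nat.lt_or_ge t (u + 1) with hm | hm
    · rw [← h.sum_low_q (by omega)]
      rcases ht.eq_or_lt with rfl | ht
      · omega
      · exact hy.snd.lower t (by omega)
    rcases hm.eq_or_lt with rfl | hm
    · have h3 := h.sum_low_q le_rfl
      rw [Finset.sum_range_succ, ← h3]
      have := hy.snd.lower u (by omega)
      rcases Nat.eq_zero_or_pos u with rfl | h0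
      · omega
      · have := hq h0
        omega
    · obtain ⟨t, rfl⟩ : ∃ i, t = i + 1 := ⟨t - 1, by omega⟩
      have h3 := h.sum_high_q (t := t) (by omega)
      have h4 := hy.snd.lower t (by omega)
      rw [show t + 1 + 1 = t + 2 from rfl]
      omega

end SeqParent

namespace DyckPair

variable {m : ℕ}

theorem s_spec (x : DyckPair m) : 2 ≤ x.s ∧ x.p x.s * x.q x.s = 0 := by
  have h : {j | 2 ≤ j ∧ x.p j * x.q j = 0}.Nonempty := by
    refine ⟨m + 2, by omega, ?_⟩
    have : x.p (m + 2) = 0 := exponent_of_gt x.1.1 (by rw [x.2.1]; omega)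
    rw [this, zero_mul]
  exact Nat.sInf_mem h

theorem mul_ne_zero_of_lt_s (x : DyckPair m) {j : ℕ} (h2 : 2 ≤ j) (hj : j < x.s) :
    x.p j * x.q j ≠ 0 := fun h => Nat.notMem_of_lt_sInf hj ⟨h2, h⟩

theorem s_le (x : DyckPair m) {j : ℕ} (h2 : 2 ≤ j) (hj : x.p j * x.q j = 0) : x.s ≤ j :=
  Nat.sInf_le ⟨h2, hj⟩

theorem s_le_succ (hm : 1 ≤ m) (x : DyckPair m) : x.s ≤ m + 1 :=
  x.s_le (by omega) (by rw [(x.isPairSeq hm).fst.gt _ (by omega), zero_mul])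

theorem s_eq (x : DyckPair m) {u : ℕ} (h : x.p (u + 2) * x.q (u + 2) = 0)
    (h' : ∀ j, 2 ≤ j → j < u + 2 → x.p j * x.q j ≠ 0) : x.s = u + 2 := by
  apply le_antisymm (x.s_le (by omega) h)
  by_contra hlt
  exact h' _ x.s_spec.1 (by omega) x.s_spec.2

end DyckPair

theorem isDyckParent_iff {m u : ℕ} {y : DyckPair m} {x : DyckPair (m + 1)} (hm : 1 ≤ m)
    (hs : x.s = u + 2) : IsDyckParent y x ↔ SeqParent u y.p y.q x.p x.q := by
  have hx := x.isPairSeq (by omega)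
  have hy := y.isPairSeq hm
  simp only [IsDyckParent, hs]
  constructor
  · rintro ⟨h1, h2, h3, h4, h5, h6⟩
    refine ⟨fun j hj => ?_, fun j hj => ?_, h2, h3, h4, fun j hj => (h6 j (by omega)).1,
      fun j hj => ?_⟩
    · rcases Nat.eq_zero_or_pos j with rfl | h0
      · rw [hx.fst.zero, hy.fst.zero]
      · exact (h1 j h0 (by omega)).1
    · rcases Nat.eq_zero_or_pos j with rfl | h0
      · rw [hx.snd.zero, hy.snd.zero]
      · exact (h1 j h0 (by omega)).2
    · rcases hj.eq_or_lt with rfl | hj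
      · exact h5
      · exact (h6 j hj).2
  · intro h
    exact ⟨fun j _ hj => ⟨h.low_p j (by omega), h.low_q j (by omega)⟩, h.mid_p, h.mid_q, h.top_p,
      h.high_q _ le_rfl, fun j hj => ⟨h.high_p j hj, h.high_q j (by omega)⟩⟩

/-- What has to be checked is that the two subtractions of 1 in the parent are genuine. -/
theorem exists_seqParent {m u : ℕ} (hm : 1 ≤ m) {x : DyckPair (m + 1)} (hs : x.s = u + 2) :
    ∃ P Q, SeqParent u P Q x.p x.q := by
  have hx := x.isPairSeq (by omega)
  have hu : u ≤ m := by have := x.s_le_succ (by omega); omega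
  have hpos : 1 ≤ x.p (u + 1) ∧ 1 ≤ x.q (u + 2) + x.q (u + 1) := by
    -- For s = 2 minimality says nothing about index 1. There the Dyck condition gives q_1 + q_2 ≥
    -- 1, and comparing p with q at 1 or 2, according to which of q_2, p_2 vanishes, gives p_1 ≥ 1.
    rcases Nat.eq_zero_or_pos u with rfl | h0
    · have h1 := hx.le 2 (by omega)
      have h2 := hx.le 1 (by omega)
      have h3 := hx.snd.lower 2 (by omega)
      have h4 := mul_eq_zero.1 (hs ▸ x.s_spec.2)
      have h5 := hx.fst.zero
      have h6 := hx.snd.zero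
      simp only [zero_add, Finset.sum_range_succ, Finset.sum_range_zero] at *
      omega
    · have := x.mul_ne_zero_of_lt_s (j := u + 1) (by omega) (by omega)
      have h1 := Nat.pos_of_ne_zero (left_ne_zero_of_mul this)
      have h2 := Nat.pos_of_ne_zero (right_ne_zero_of_mul this)
      omega
  refine ⟨fun j => if j ≤ u then x.p j else if j = u + 1 then x.p j - 1 else
    if j = u + 2 then x.p (u + 3) + x.p (u + 2) else x.p (j + 1),
    fun j => if j ≤ u then x.q j else if j = u + 1 then x.q (u + 2) + x.q (u + 1) - 1 else
    x.q (j + 1), ?_⟩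
  constructor
  · intro j hj
    simp [hj]
  · intro j hj
    simp [hj]
  · simp; omega
  · simp; omega
  · simp
  · intro j hj
    simp [show ¬ j ≤ u by omega, show j ≠ u + 1 by omega, show j ≠ u + 2 by omega]
  · intro j hj
    simp [show ¬ j ≤ u by omega, show j ≠ u + 1 by omega]

theorem DyckPair.eq_zero_of_one (x : DyckPair 1) : x.p = 0 ∧ x.q = 0 := by
  have hx := x.isPairSeq le_rfl
  have h1 := hx.fst.sum
  have h2 := hx.snd.sum
  simp only [Finset.sum_range_succ, Finset.sum_range_zero] at h1 h2
  constructor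
  · funext j
    rcases Nat.lt_or_ge 1 j with hj | hj
    · exact hx.fst.gt j hj
    · have h3 : x.p 0 = 0 := by omega
      have h4 : x.p 1 = 0 := by omega
      interval_cases j <;> assumption
  · funext j
    rcases Nat.lt_or_ge 1 j with hj | hj
    · exact hx.snd.gt j hj
    · have h3 : x.q 0 = 0 := by omega
      have h4 : x.q 1 = 0 := by omega
      interval_cases j <;> assumption

theorem SeqParent.parent_unique {u : ℕ} {P Q P' Q' p q : ℕ → ℕ} (h : SeqParent u P Q p q)
    (h' : SeqParent u P' Q' p q) : P = P' ∧ Q = Q' := by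
  constructor
  · funext j
    rcases Nat.lt_or_ge j (u + 1) with hj | hj
    · rw [h.low_p j (by omega), h'.low_p j (by omega)]
    rcases Nat.lt_or_ge j (u + 3) with hj' | hj'
    · have := h.mid_p; have := h'.mid_p; have := h.top_p; have := h'.top_p
      rcases (show j = u + 1 ∨ j = u + 2 by omega) with rfl | rfl <;> omega
    · rw [h.high_p j hj', h'.high_p j hj']
  · funext j
    rcases Nat.lt_or_ge j (u + 1) with hj | hj
    · rw [h.low_q j (by omega), h'.low_q j (by omega)]
    rcases hj.eq_or_lt with rfl | hj
    · have := h.mid_q; have := h'.mid_q; omega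
    · rw [h.high_q j hj, h'.high_q j hj]

/-- Both q_{u+1} + q_{u+2} and p_{u+2} + q_{u+1} are prescribed, and p_{u+2} or q_{u+2} vanishes;
whether the second number exceeds the first decides which, and then every entry is determined. -/
theorem SeqParent.child_unique {u : ℕ} {P Q p q p' q' : ℕ → ℕ} (h : SeqParent u P Q p q)
    (h' : SeqParent u P Q p' q') (hs : p (u + 2) * q (u + 2) = 0)
    (hs' : p' (u + 2) * q' (u + 2) = 0) (he : p (u + 2) + q (u + 1) = p' (u + 2) + q' (u + 1)) :
    p = p' ∧ q = q' := by
  have h1 := mul_eq_zero.1 hs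
  have h2 := mul_eq_zero.1 hs'
  have hm := h.mid_q; have hm' := h'.mid_q
  have hp := h.mid_p; have hp' := h'.mid_p
  have ht := h.top_p; have ht' := h'.top_p
  constructor
  · funext j
    rcases Nat.lt_or_ge j (u + 1) with hj | hj
    · rw [← h.low_p j (by omega), ← h'.low_p j (by omega)]
    rcases Nat.lt_or_ge j (u + 4) with hj' | hj'
    · rcases (show j = u + 1 ∨ j = u + 2 ∨ j = u + 3 by omega) with rfl | rfl | rfl <;> omega
    · obtain ⟨j, rfl⟩ : ∃ i, j = i + 1 := ⟨j - 1, by omega⟩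
      rw [← h.high_p j (by omega), ← h'.high_p j (by omega)]
  · funext j
    rcases Nat.lt_or_ge j (u + 1) with hj | hj
    · rw [← h.low_q j (by omega), ← h'.low_q j (by omega)]
    rcases Nat.lt_or_ge j (u + 3) with hj' | hj'
    · rcases (show j = u + 1 ∨ j = u + 2 by omega) with rfl | rfl <;> omega
    · obtain ⟨j, rfl⟩ : ∃ i, j = i + 1 := ⟨j - 1, by omega⟩
      rw [← h.high_q j (by omega), ← h'.high_q j (by omega)]

/-- The amount a is spent on q_{u+1} first, up to its maximum Q_{u+1} + 1, and only the excess goes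
to p_{u+2}. Hence p_{u+2} > 0 forces q_{u+2} = 0. -/
theorem exists_seqChild (P Q : ℕ → ℕ) {u a : ℕ} (ha : a ≤ P (u + 2) + Q (u + 1) + 1) :
    ∃ p q, SeqParent u P Q p q ∧ p (u + 2) * q (u + 2) = 0 ∧ p (u + 2) + q (u + 1) = a ∧
      (1 ≤ a → 1 ≤ q (u + 1)) := by
  refine ⟨fun j => if j ≤ u then P j else if j = u + 1 then P j + 1 else
    if j = u + 2 then a - (Q (u + 1) + 1) else
    if j = u + 3 then P (u + 2) - (a - (Q (u + 1) + 1)) else P (j - 1),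
    fun j => if j ≤ u then Q j else if j = u + 1 then min a (Q (u + 1) + 1) else
    if j = u + 2 then Q (u + 1) + 1 - min a (Q (u + 1) + 1) else Q (j - 1), ?_, ?_, ?_, ?_⟩
  · constructor
    · intro j hj
      simp [hj]
    · intro j hj
      simp [hj]
    · simp
    · simp
    · simp; omega
    · intro j hj
      simp [show ¬ j + 1 ≤ u by omega, show j ≠ u by omega, show j ≠ u + 1 by omega,
        show j ≠ u + 2 by omega]
    · intro j hj
      simp [show ¬ j + 1 ≤ u by omega, show j ≠ u by omega, show j ≠ u + 1 by omega]
  · simp; omega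
  · simp
  · simp

theorem SeqParent.childData {m u : ℕ} {y : DyckPair m} {x : DyckPair (m + 1)}
    (h : SeqParent u y.p y.q x.p x.q) (hu : x.s = u + 2) :
    ChildData y.s (fun j => y.p (j + 1) + y.q j) x.s (fun j => x.p (j + 1) + x.q j) := by
  rw [hu]
  have hq0 : ∀ {m} (z : DyckPair m), z.q 0 = 0 := fun z => exponent_zero z.1.2
  have hm := h.mid_q
  have hp := h.mid_p
  have ht := h.top_p
  constructor
  · omega
  -- If s of the parent were at most u, the vanishing product at that index would be unchanged in
  -- the child and contradict the minimality of its s.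
  · by_contra hlt
    have h1 := y.s_spec
    rw [h.low_p _ (by omega), h.low_q _ (by omega)] at h1
    exact x.mul_ne_zero_of_lt_s h1.1 (by omega) h1.2
  · intro j hj
    rw [h.low_p (j + 1) (by omega), h.low_q j (by omega)]
  · simp only [Nat.add_sub_cancel]
    rw [h.low_q u le_rfl]; omega
  · have e : u + 2 - 1 = u + 1 := rfl
    simp only [e, add_assoc, Nat.reduceAdd]; omega
  · intro j hj
    rw [h.high_p (j + 1) (by omega), h.high_q j hj]
  · intro h3
    have := right_ne_zero_of_mul (x.mul_ne_zero_of_lt_s (j := u + 1) (by omega) (by omega))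
    simp only [Nat.add_succ_sub_one]
    omega

theorem dyckTree_isTree : dyckTree.IsTree := by
  constructor
  · have h0 : IsPairSeq 1 (fun _ => 0) (fun _ => 0) := by
      refine IsPairSeq.mk_of_lower rfl rfl ?_ ?_ ?_ ?_ ?_ ?_ <;> simp
    obtain ⟨x, -⟩ := DyckPair.exists_of_isPairSeq h0
    refine ⟨x, trivial, fun (y : DyckPair 1) _ => ?_⟩
    have key : ∀ z : DyckPair 1, z.p = 0 ∧ z.q = 0 := DyckPair.eq_zero_of_one
    exact DyckPair.ext_of_eq le_rfl ((key y).1.trans (key x).1.symm)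
      ((key y).2.trans (key x).2.symm)
  · intro l (x : DyckPair (l + 1 + 1))
    obtain ⟨u, hu⟩ : ∃ u, x.s = u + 2 := ⟨x.s - 2, by have := x.s_spec.1; omega⟩
    have hul : u ≤ l + 1 := by have := x.s_le_succ (by omega); omega
    obtain ⟨P, Q, h⟩ := exists_seqParent (by omega) hu
    obtain ⟨y, rfl, rfl⟩ := DyckPair.exists_of_isPairSeq
      (h.isPairSeq_parent (x.isPairSeq (by omega)) hul (hu ▸ x.s_spec.2))
    refine ⟨y, (isDyckParent_iff (by omega) hu).2 h, fun (z : DyckPair (l + 1)) hz => ?_⟩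
    have h' := (isDyckParent_iff (by omega) hu).1 hz
    exact DyckPair.ext_of_eq (by omega) (h'.parent_unique h).1 (h'.parent_unique h).2

/-- The data of the succession rule for a pair of Dyck paths. -/
noncomputable def dyckRule : GeneratingRule dyckTree where
  s {_} x := DyckPair.s x
  e {_} x j := DyckPair.p x (j + 1) + DyckPair.q x j
  label_eq _ := rfl
  root_s x := DyckPair.s_eq (u := 0) x
    (by rw [(DyckPair.eq_zero_of_one x).1]; simp) (by omega)
  root_e x := by
    rw [(DyckPair.eq_zero_of_one x).1, (DyckPair.eq_zero_of_one x).2]; rfl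
  child {l} := by
    intro (y : DyckPair (l + 1)) (x : DyckPair (l + 2)) hxy
    obtain ⟨u, hu⟩ : ∃ u, x.s = u + 2 := ⟨x.s - 2, by have := x.s_spec.1; omega⟩
    have h := (isDyckParent_iff (by omega) hu).1 hxy
    exact h.childData hu
  exists_child {l} := by
    intro (y : DyckPair (l + 1)) t a ht hts ha hpos
    obtain ⟨u, rfl⟩ : ∃ u, t = u + 2 := ⟨t - 2, by omega⟩
    obtain ⟨p, q, h, hs, rfl, hq'⟩ := exists_seqChild y.p y.q (u := u) ha
    have hu : u ≤ l + 1 := by have := y.s_le_succ (by omega); omega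
    have hq : 1 ≤ u → 1 ≤ q (u + 1) := fun h1 => hq' (hpos (by omega))
    obtain ⟨x, rfl, rfl⟩ := DyckPair.exists_of_isPairSeq
      (h.isPairSeq_child (y.isPairSeq (by omega)) hu hq)
    -- Below u + 1 the products are those of the parent, nonzero because t ≤ s + 1; at u + 1 one
    -- uses a ≥ 1 and the unit added to p_{u+1}.
    have hxs : x.s = u + 2 := x.s_eq hs fun j h2 hj => by
      rcases Nat.lt_or_ge j (u + 1) with hj' | hj'
      · rw [← h.low_p j (by omega), ← h.low_q j (by omega)]
        exact y.mul_ne_zero_of_lt_s h2 (by omega)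
      · obtain rfl : j = u + 1 := by omega
        have h1 := hq (by omega)
        have h2 := h.mid_p
        exact mul_ne_zero (by omega) (by omega)
    exact ⟨x, (isDyckParent_iff (by omega) hxs).2 h, hxs, rfl⟩
  child_unique {l} := by
    intro (y : DyckPair (l + 1)) (x : DyckPair (l + 2)) (x' : DyckPair (l + 2)) hx hx' hs he
    obtain ⟨u, hu⟩ : ∃ u, x.s = u + 2 := ⟨x.s - 2, by have := x.s_spec.1; omega⟩
    change x.s = x'.s at hs
    change x.p (x.s - 1 + 1) + x.q (x.s - 1) = x'.p (x.s - 1 + 1) + x'.q (x.s - 1) at he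
    have h := (isDyckParent_iff (by omega) hu).1 hx
    have h' := (isDyckParent_iff (by omega) (hs ▸ hu)).1 hx'
    have h1 := hu ▸ x.s_spec.2
    have h2 := (hs ▸ hu : x'.s = u + 2) ▸ x'.s_spec.2
    rw [hu] at he
    have := h.child_unique h' h1 h2 he
    exact DyckPair.ext_of_eq (by omega) this.1 this.2

end TwoTri
namespace TwoTri

/-! ### Crossings and maximality -/

theorem mem_diagonals {n a b : ℕ} :
    (a, b) ∈ diagonals n ↔ 1 ≤ a ∧ a + 2 ≤ b ∧ b ≤ n ∧ ¬ (a = 1 ∧ b = n) := by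
  simp only [diagonals, Finset.mem_filter, Finset.mem_product, Finset.mem_Icc, ne_eq,
    Prod.mk.injEq]
  omega

theorem mem_shape {n a b : ℕ} :
    (a, b) ∈ shape n ↔ 1 ≤ a ∧ a + 3 ≤ b ∧ b ≤ n ∧ b + 3 ≤ a + n := by
  simp only [shape, Finset.mem_filter, Finset.mem_product, Finset.mem_Icc]
  omega

theorem crosses_iff {a b c d : ℕ} : Crosses (a, b) (c, d) ↔
    (a < c ∧ c < b ∧ b < d) ∨ (c < a ∧ a < d ∧ d < b) := Iff.rfl

theorem Crosses.symm {d e : ℕ × ℕ} (h : Crosses d e) : Crosses e d := Or.symm h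

theorem Crosses.ne {d e : ℕ × ℕ} (h : Crosses d e) : d ≠ e := by
  rintro rfl
  rcases h with h | h <;> exact lt_irrefl _ h.1

/-- No three members of `S` cross pairwise. -/
def TriFree (S : Finset (ℕ × ℕ)) : Prop :=
  ∀ d ∈ S, ∀ e ∈ S, ∀ f ∈ S, Crosses d e → Crosses d f → ¬ Crosses e f

theorem triFree_iff (S : Finset (ℕ × ℕ)) : (∀ X ⊆ S, ¬ IsCrossing (2 + 1) X) ↔ TriFree S := by
  constructor
  · intro h d hd e he f hf h1 h2 h3
    refine h {d, e, f} ?_ ⟨Finset.card_eq_three.2 ⟨d, e, f, h1.ne, h2.ne, h3.ne, rfl⟩, ?_⟩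
    · simp [Finset.insert_subset_iff, hd, he, hf]
    · intro x hx y hy hxy
      simp only [Finset.coe_insert, Finset.coe_singleton, Set.mem_insert_iff,
        Set.mem_singleton_iff] at hx hy
      rcases hx with rfl | rfl | rfl <;> rcases hy with rfl | rfl | rfl <;>
        first | exact absurd rfl hxy | assumption | (apply Crosses.symm; assumption)
  · rintro h X hX ⟨h1, h2⟩
    obtain ⟨d, e, f, hde, hdf, hef, rfl⟩ := Finset.card_eq_three.1 h1
    exact h d (hX (by simp)) e (hX (by simp)) f (hX (by simp)) (h2 (by simp) (by simp) hde)
      (h2 (by simp) (by simp) hdf) (h2 (by simp) (by simp) hef)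

/-- A `2`-triangulation, described by its members. -/
structure IsTwoTri (n : ℕ) (T : Finset (ℕ × ℕ)) : Prop where
  sub : T ⊆ diagonals n
  free : TriFree T
  max : ∀ d ∈ diagonals n, d ∉ T → ∃ e ∈ T, ∃ f ∈ T, Crosses d e ∧ Crosses d f ∧ Crosses e f

theorem isKTriangulation_two_iff {n : ℕ} {T : Finset (ℕ × ℕ)} :
    IsKTriangulation 2 n T ↔ IsTwoTri n T := by
  unfold IsKTriangulation
  simp only [triFree_iff]
  constructor
  · rintro ⟨⟨h1, h2⟩, h3⟩
    refine ⟨h1, h2, fun d hd hdT => ?_⟩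
    by_contra! hno
    refine hdT (h3 (y := insert d T) ⟨Finset.insert_subset hd h1, ?_⟩ (Finset.subset_insert d T)
      (Finset.mem_insert_self d T))
    intro x hx y hy z hz hxy hxz hyz
    rcases Finset.mem_insert.1 hx with rfl | hx'
    · exact hno y ((Finset.mem_insert.1 hy).resolve_left hxy.ne.symm) z
        ((Finset.mem_insert.1 hz).resolve_left hxz.ne.symm) hxy hxz hyz
    rcases Finset.mem_insert.1 hy with rfl | hy'
    · exact hno x hx' z ((Finset.mem_insert.1 hz).resolve_left hyz.ne.symm) hxy.symm hyz hxz
    rcases Finset.mem_insert.1 hz with rfl | hz'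
    · exact hno x hx' y hy' hxz.symm hyz.symm hxy
    · exact h2 x hx' y hy' z hz' hxy hxz hyz
  · intro h
    refine ⟨⟨h.sub, h.free⟩, fun S hS hTS d hd => ?_⟩
    by_contra hdT
    obtain ⟨e, he, f, hf, h1, h2, h3⟩ := h.max d (hS.1 hd) hdT
    exact hS.2 d hd e (hTS he) f (hTS hf) h1 h2 h3

/-- Two crossing diagonals that both cross d have four distinct endpoints, two on either side of d.
So trivial diagonals never matter for 3-crossings. -/
theorem mem_shape_of_crosses {n : ℕ} {d e f : ℕ × ℕ} (hd : d ∈ diagonals n)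
    (he : e ∈ diagonals n) (hf : f ∈ diagonals n) (hde : Crosses d e) (hdf : Crosses d f)
    (hef : Crosses e f) : d ∈ shape n := by
  obtain ⟨a, b⟩ := d
  obtain ⟨c, g⟩ := e
  obtain ⟨i, k⟩ := f
  rw [mem_diagonals] at *
  rw [mem_shape]
  rw [crosses_iff] at *
  omega

namespace IsTwoTri

variable {n : ℕ} {T : Finset (ℕ × ℕ)}

theorem eq_of_subset (h : IsTwoTri n T) {S : Finset (ℕ × ℕ)} (hS : S ⊆ diagonals n)
    (hf : TriFree S) (hTS : T ⊆ S) : T = S := by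
  refine hTS.antisymm fun d hd => ?_
  by_contra hdT
  obtain ⟨e, he, f, hf', h1, h2, h3⟩ := h.max d (hS hd) hdT
  exact hf d hd e (hTS he) f (hTS hf') h1 h2 h3

theorem diag (h : IsTwoTri n T) {a b : ℕ} (hab : (a, b) ∈ T) :
    1 ≤ a ∧ a + 2 ≤ b ∧ b ≤ n ∧ ¬ (a = 1 ∧ b = n) := mem_diagonals.1 (h.sub hab)

theorem mem_of_notMem_shape (h : IsTwoTri n T) {d : ℕ × ℕ} (hd : d ∈ diagonals n)
    (hs : d ∉ shape n) : d ∈ T := by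
  by_contra hdT
  obtain ⟨e, he, f, hf, h1, h2, h3⟩ := h.max d hd hdT
  exact hs (mem_shape_of_crosses hd (h.sub he) (h.sub hf) h1 h2 h3)

/-- A diagonal outside `T` is crossed by two crossing non-trivial members of `T`. -/
theorem exists_crosses (h : IsTwoTri n T) {a b : ℕ} (hd : (a, b) ∈ diagonals n)
    (hdT : (a, b) ∉ T) : ∃ c g i k, (c, g) ∈ T ∧ (i, k) ∈ T ∧ (c, g) ∈ shape n ∧ (i, k) ∈ shape n ∧
      Crosses (a, b) (c, g) ∧ Crosses (a, b) (i, k) ∧ Crosses (c, g) (i, k) := by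
  obtain ⟨⟨c, g⟩, he, ⟨i, k⟩, hf, h1, h2, h3⟩ := h.max _ hd hdT
  exact ⟨c, g, i, k, he, hf, mem_shape_of_crosses (h.sub he) hd (h.sub hf) h1.symm h3 h2,
    mem_shape_of_crosses (h.sub hf) hd (h.sub he) h2.symm h3.symm h1, h1, h2, h3⟩

theorem exists_ear (h : IsTwoTri n T) {a b : ℕ} (hab : (a, b) ∈ T) (hl : a + 3 ≤ b) :
    ∃ c, a ≤ c ∧ c + 3 ≤ b ∧ (c, c + 3) ∈ T := by
  induction hk : b - a using Nat.strong_induction_on generalizing a b with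
  | _ k ih =>
    rcases hl.eq_or_lt with rfl | hl'
    · exact ⟨a, le_rfl, le_rfl, hab⟩
    have hd := h.diag hab
    by_cases hm : (a, b - 1) ∈ T
    · obtain ⟨c, h1, h2, h3⟩ := ih (b - 1 - a) (by omega) hm (by omega) rfl
      exact ⟨c, h1, by omega, h3⟩
    have key : ∀ c g i l, (c, g) ∈ T → (c, g) ∈ shape n → Crosses (a, b - 1) (c, g) →
        Crosses (c, g) (i, l) → Crosses (a, b - 1) (i, l) → ¬ Crosses (a, b) (c, g) →
        ∃ c, a ≤ c ∧ c + 3 ≤ b ∧ (c, c + 3) ∈ T := by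
      intro c g i l h1 h2 h3 h4 h5 h6
      rw [mem_shape] at h2
      rw [crosses_iff] at h3 h4 h5 h6
      obtain rfl : g = b := by omega
      obtain ⟨c', h7, h8, h9⟩ := ih (g - c) (by omega) h1 (by omega) rfl
      exact ⟨c', by omega, h8, h9⟩
    obtain ⟨c, g, i, l, h1, h2, h3, h4, h5, h6, h7⟩ :=
      h.exists_crosses (mem_diagonals.2 (by omega)) hm
    by_cases hc : Crosses (a, b) (c, g)
    · by_cases hc' : Crosses (a, b) (i, l)
      · exact absurd h7 (h.free _ hab _ h1 _ h2 hc hc')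
      · exact key i l c g h2 h4 h6 h7.symm h5 hc'
    · exact key c g i l h1 h3 h5 h7 h6 hc

/-- This makes the corner at least 2. If (2, 5) is missing, it has two distinct blockers; the only
non-trivial one that starts in row 1 is (1, 4), so some blocker starts further down and has an ear
under it. -/
theorem exists_ear_two_le (h : IsTwoTri n T) (hn : 5 ≤ n) :
    ∃ c, 2 ≤ c ∧ c + 3 ≤ n ∧ (c, c + 3) ∈ T := by
  by_cases hm : (2, 5) ∈ T
  · exact ⟨2, le_rfl, hn, hm⟩
  obtain ⟨c, g, i, l, h1, h2, h3, h4, h5, h6, h7⟩ :=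
    h.exists_crosses (mem_diagonals.2 (by omega)) hm
  rw [mem_shape] at h3 h4
  rw [crosses_iff] at h5 h6 h7
  have : 2 ≤ c ∨ 2 ≤ i := by omega
  rcases this with hc | hc
  · obtain ⟨x, _, _, hx⟩ := h.exists_ear h1 (by omega)
    exact ⟨x, by omega, by omega, hx⟩
  · obtain ⟨x, _, _, hx⟩ := h.exists_ear h2 (by omega)
    exact ⟨x, by omega, by omega, hx⟩

end IsTwoTri

/-- `r` is the corner of `T`: the rows below `r` contain only the trivial diagonals `(a, a + 2)`. -/
structure IsCornerRow (n : ℕ) (T : Finset (ℕ × ℕ)) (r : ℕ) : Prop where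
  two_le : 2 ≤ r
  le : r + 3 ≤ n
  ear : (r, r + 3) ∈ T
  row : ∀ a b, (a, b) ∈ T → r < a → b = a + 2

theorem IsTwoTri.isCornerRow_corner {n : ℕ} {T : Finset (ℕ × ℕ)} (h : IsTwoTri n T)
    (hn : 5 ≤ n) : IsCornerRow n T (corner n T) := by
  obtain ⟨c, h1, h2, h3⟩ := h.exists_ear_two_le hn
  set F := (Finset.Icc 1 (n - 3)).filter fun a => (a, a + 3) ∈ T with hF
  have hmem : ∀ a, a ∈ F ↔ 1 ≤ a ∧ a + 3 ≤ n ∧ (a, a + 3) ∈ T := by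
    intro a
    simp only [hF, Finset.mem_filter, Finset.mem_Icc, ← and_assoc]
    exact and_congr_left fun _ => by omega
  have hle : ∀ a ∈ F, a ≤ corner n T := fun a ha => Finset.le_sup (f := id) ha
  have hc : c ∈ F := (hmem c).2 ⟨by omega, h2, h3⟩
  obtain ⟨r, hr, hr'⟩ := Finset.exists_mem_eq_sup F ⟨c, hc⟩ id
  have hr' : corner n T = r := hr'
  have hc' := hle c hc
  rw [hr'] at hle hc' ⊢
  obtain ⟨h4, h5, h6⟩ := (hmem r).1 hr
  refine ⟨by omega, h5, h6, fun a b hab hra => ?_⟩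
  by_contra hne
  have := h.diag hab
  obtain ⟨x, h7, h8, h9⟩ := h.exists_ear hab (by omega)
  have := hle x ((hmem x).2 ⟨by omega, by omega, h9⟩)
  omega

theorem IsCornerRow.unique {n : ℕ} {T : Finset (ℕ × ℕ)} {r r' : ℕ} (h : IsCornerRow n T r)
    (h' : IsCornerRow n T r') : r = r' := by
  by_contra hne
  rcases Nat.lt_or_gt_of_ne hne with hlt | hlt
  · have := h.row _ _ h'.ear hlt; omega
  · have := h'.row _ _ h.ear hlt; omega

theorem IsTwoTri.corner_eq {n : ℕ} {T : Finset (ℕ × ℕ)} (h : IsTwoTri n T)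
    (hn : 5 ≤ n) {r : ℕ} (hr : IsCornerRow n T r) : corner n T = r :=
  (h.isCornerRow_corner hn).unique hr

/-- `j` is the common neighbour of `r + 1` and `r + 2` in `T`, where `r` is the corner. -/
structure IsApex (T : Finset (ℕ × ℕ)) (r j : ℕ) : Prop where
  pos : 1 ≤ j
  lt : j < r
  left : (j, r + 1) ∈ T
  right : (j, r + 2) ∈ T
  left_ge : ∀ a, (a, r + 1) ∈ T → j ≤ a
  right_le : ∀ a, (a, r + 2) ∈ T → a < r → a ≤ j

/-- Take the topmost member (j, r + 1) of column r + 1. A blocker of (j, r + 2) that misses (j, r +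
1) would lie in column r + 1 above row j or in row r + 1, both impossible for a non-trivial one;
hence (j, r + 2) ∈ T. A member (a, r + 2) with j < a < r would form a 3-crossing with (j, r + 1) and
(r, r + 3). -/
theorem IsTwoTri.exists_isApex {n : ℕ} {T : Finset (ℕ × ℕ)} (h : IsTwoTri n T) {r : ℕ}
    (hr : IsCornerRow n T r) : ∃ j, IsApex T r j := by
  have h2 := hr.two_le
  have hle := hr.le
  have hex : ∃ a, (a, r + 1) ∈ T := ⟨r - 1, h.mem_of_notMem_shape
    (mem_diagonals.2 (by omega)) (by rw [mem_shape]; omega)⟩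
  classical
  have hj := Nat.find_spec hex
  have hmin : ∀ a, (a, r + 1) ∈ T → Nat.find hex ≤ a := fun a => Nat.find_min' hex
  set j := Nat.find hex
  have hjd := h.diag hj
  have hjw : (j, r + 2) ∈ T := by
    by_contra hno
    obtain ⟨c, g, i, k, h1, h2, h3, h4, h5, h6, h7⟩ :=
      h.exists_crosses (mem_diagonals.2 (by omega)) hno
    have key : ∀ c g, (c, g) ∈ T → (c, g) ∈ shape n → Crosses (j, r + 2) (c, g) →
        Crosses (j, r + 1) (c, g) := by
      intro c g h1 h2 h3
      rw [mem_shape] at h2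
      rw [crosses_iff] at h3 ⊢
      have := hr.row c g h1
      have : g = r + 1 → j ≤ c := fun hg => hmin c (hg ▸ h1)
      omega
    exact h.free _ hj _ h1 _ h2 (key _ _ h1 h3 h5) (key _ _ h2 h4 h6) h7
  refine ⟨j, hjd.1, by omega, hj, hjw, hmin, fun a ha har => ?_⟩
  by_contra hlt
  refine h.free _ hj _ ha _ hr.ear ?_ ?_ ?_ <;> rw [crosses_iff] <;> omega

end TwoTri
namespace TwoTri

/-! ### Contraction and expansion -/

/-- The vertex `b'` becomes `b` when the side `(r + 1, r + 2)` is contracted. -/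
def Lift (r b b' : ℕ) : Prop := (b ≤ r + 1 ∧ b' = b) ∨ (r + 1 ≤ b ∧ b' = b + 1)

theorem Crosses.lift {r a b b' c g g' : ℕ} (h : Crosses (a, b) (c, g)) (ha : a ≤ r) (hc : c ≤ r)
    (hb : Lift r b b') (hg : Lift r g g') : Crosses (a, b') (c, g') := by
  unfold Lift at *
  rw [crosses_iff] at *
  omega

/-- Contraction destroys a crossing only by identifying right endpoints. Lifting, in contrast,
always preserves it, since the left endpoints stay where they are. -/
theorem Crosses.contract {r a b b' c g g' : ℕ} (h : Crosses (a, b') (c, g')) (ha : a ≤ r)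
    (hc : c ≤ r) (hb : Lift r b b') (hg : Lift r g g') (hbg : b ≠ g) :
    Crosses (a, b) (c, g) := by
  unfold Lift at *
  rw [crosses_iff] at *
  omega

theorem exists_lift (r : ℕ) {b' : ℕ} (hb : 1 ≤ b') : ∃ b, Lift r b b' := by
  rcases Nat.lt_or_ge b' (r + 2) with h | h
  · exact ⟨b', Or.inl (by omega)⟩
  · exact ⟨b' - 1, Or.inr (by omega)⟩

open Classical in
/-- The set of diagonals of the `n`-gon obtained from the set `T` of diagonals of the
`(n + 1)`-gon by contracting the side `(r + 1, r + 2)`, where `r` is the corner of `T`. -/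
noncomputable def contractSet (n : ℕ) (T : Finset (ℕ × ℕ)) (r : ℕ) : Finset (ℕ × ℕ) :=
  (diagonals n).filter fun d =>
    (r < d.1 ∧ d.2 = d.1 + 2) ∨ (d.1 ≤ r ∧ ∃ b, Lift r d.2 b ∧ (d.1, b) ∈ T)

theorem mem_contractSet {n r a b : ℕ} {T : Finset (ℕ × ℕ)} :
    (a, b) ∈ contractSet n T r ↔ (a, b) ∈ diagonals n ∧
      ((r < a ∧ b = a + 2) ∨ (a ≤ r ∧ ∃ b', Lift r b b' ∧ (a, b') ∈ T)) := by
  simp [contractSet]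

theorem contractSet_subset (n : ℕ) (T : Finset (ℕ × ℕ)) (r : ℕ) :
    contractSet n T r ⊆ diagonals n := by
  classical exact Finset.filter_subset _ _

open Classical in
/-- The set of diagonals of the `(n + 1)`-gon obtained from the set `S` of diagonals of the `n`-gon
by splitting the vertex `r + 1` along the diagonal `(j, r + 1)` and adding `(r, r + 3)`. -/
noncomputable def expandSet (n : ℕ) (S : Finset (ℕ × ℕ)) (r j : ℕ) : Finset (ℕ × ℕ) :=
  (diagonals (n + 1)).filter fun d => d.2 = d.1 + 2 ∨ d = (r, r + 3) ∨
    (d.1 ≤ r ∧ (d.2 = r + 1 → j ≤ d.1) ∧ (d.2 = r + 2 → d.1 ≤ j) ∧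
      ∃ b, Lift r b d.2 ∧ (d.1, b) ∈ S)

theorem mem_expandSet {n r j a b' : ℕ} {S : Finset (ℕ × ℕ)} :
    (a, b') ∈ expandSet n S r j ↔ (a, b') ∈ diagonals (n + 1) ∧ (b' = a + 2 ∨
      (a = r ∧ b' = r + 3) ∨ (a ≤ r ∧ (b' = r + 1 → j ≤ a) ∧ (b' = r + 2 → a ≤ j) ∧
        ∃ b, Lift r b b' ∧ (a, b) ∈ S)) := by
  simp [expandSet]

theorem expandSet_subset (n : ℕ) (S : Finset (ℕ × ℕ)) (r j : ℕ) :
    expandSet n S r j ⊆ diagonals (n + 1) := by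
  classical exact Finset.filter_subset _ _

section Contract

variable {n r j : ℕ} {T : Finset (ℕ × ℕ)}

theorem IsTwoTri.mem_contractSet_of_lift (h : IsTwoTri (n + 1) T) (hr : IsCornerRow (n + 1) T r)
    {a b b' : ℕ} (hab : (a, b') ∈ T) (hl : a + 3 ≤ b') (hb : Lift r b b') :
    a ≤ r ∧ (a, b) ∈ contractSet n T r := by
  have hd := h.diag hab
  have har : a ≤ r := by
    by_contra hlt
    have := hr.row a b' hab (by omega)
    omega
  refine ⟨har, mem_contractSet.2 ⟨mem_diagonals.2 ?_, Or.inr ⟨har, b', hb, hab⟩⟩⟩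
  have := hr.le
  unfold Lift at hb
  omega

theorem exists_lift_of_mem_contractSet {a b : ℕ} (hab : (a, b) ∈ contractSet n T r)
    (hl : a + 3 ≤ b) : a ≤ r ∧ ∃ b', Lift r b b' ∧ (a, b') ∈ T := by
  rcases (mem_contractSet.1 hab).2 with h | h
  · omega
  · exact h

/-- Crossing members of `T` do not end at `r + 1` and at `r + 2`, respectively. -/
theorem IsApex.lift_ne (hj : IsApex T r j) {a b b' c g g' : ℕ} (hab : (a, b') ∈ T)
    (hcg : (c, g') ∈ T) (ha : a + 3 ≤ b') (hc : c + 3 ≤ g') (hx : Crosses (a, b') (c, g'))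
    (hb : Lift r b b') (hg : Lift r g g') : b ≠ g := by
  rintro rfl
  have h1 : b' = r + 1 → j ≤ a := fun e => hj.left_ge a (e ▸ hab)
  have h2 : g' = r + 1 → j ≤ c := fun e => hj.left_ge c (e ▸ hcg)
  have h3 : b' = r + 2 → a < r → a ≤ j := fun e => hj.right_le a (e ▸ hab)
  have h4 : g' = r + 2 → c < r → c ≤ j := fun e => hj.right_le c (e ▸ hcg)
  unfold Lift at *
  rw [crosses_iff] at hx
  omega

theorem IsTwoTri.triFree_contractSet (h : IsTwoTri (n + 1) T) : TriFree (contractSet n T r) := by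
  have hsub : contractSet n T r ⊆ diagonals n := contractSet_subset _ _ _
  rintro ⟨a, b⟩ hd ⟨c, g⟩ he ⟨i, k⟩ hf h1 h2 h3
  have hd' := mem_shape.1 (mem_shape_of_crosses (hsub hd) (hsub he) (hsub hf) h1 h2 h3)
  have he' := mem_shape.1 (mem_shape_of_crosses (hsub he) (hsub hd) (hsub hf) h1.symm h3 h2)
  have hf' := mem_shape.1 (mem_shape_of_crosses (hsub hf) (hsub hd) (hsub he) h2.symm h3.symm h1)
  obtain ⟨ha, b', hb, hab⟩ := exists_lift_of_mem_contractSet hd (by omega)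
  obtain ⟨hc, g', hg, hcg⟩ := exists_lift_of_mem_contractSet he (by omega)
  obtain ⟨hi, k', hk, hik⟩ := exists_lift_of_mem_contractSet hf (by omega)
  exact h.free _ hab _ hcg _ hik (h1.lift ha hc hb hg) (h2.lift ha hi hb hk) (h3.lift hc hi hg hk)

/-- A missing diagonal is lifted to one missing from T. Its two blockers still cross each other
after contraction, by the apex property; the lift has to be chosen so that they also still cross the
diagonal. -/
theorem IsTwoTri.contractSet (h : IsTwoTri (n + 1) T) (hr : IsCornerRow (n + 1) T r)
    (hj : IsApex T r j) : IsTwoTri n (contractSet n T r) := by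
  refine ⟨contractSet_subset _ _ _, h.triFree_contractSet, ?_⟩
  rintro ⟨a, b⟩ hd hab
  have hd' := mem_diagonals.1 hd
  have hle := hr.le
  have hjr := hj.lt
  -- crossing members of `T` survive the contraction
  have key : ∀ c g i k : ℕ, (c, g) ∈ T → (i, k) ∈ T → (c, g) ∈ shape (n + 1) →
      (i, k) ∈ shape (n + 1) → Crosses (c, g) (i, k) →
      (∀ x y z, (x, z) ∈ T → x ≤ r → ((x, z) = (c, g) ∨ (x, z) = (i, k)) → x + 3 ≤ z →
        Lift r y z → Crosses (a, b) (x, y)) →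
      ∃ e ∈ TwoTri.contractSet n T r, ∃ f ∈ TwoTri.contractSet n T r,
        Crosses (a, b) e ∧ Crosses (a, b) f ∧ Crosses e f := by
    intro c g i k h1 h2 h3 h4 h5 h6
    rw [mem_shape] at h3 h4
    obtain ⟨g', hg⟩ := exists_lift r (b' := g) (by omega)
    obtain ⟨k', hk⟩ := exists_lift r (b' := k) (by omega)
    obtain ⟨hc, h7⟩ := h.mem_contractSet_of_lift hr h1 (by omega) hg
    obtain ⟨hi, h8⟩ := h.mem_contractSet_of_lift hr h2 (by omega) hk
    exact ⟨_, h7, _, h8, h6 c g' g h1 hc (Or.inl rfl) (by omega) hg,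
      h6 i k' k h2 hi (Or.inr rfl) (by omega) hk,
      h5.contract hc hi hg hk (hj.lift_ne h1 h2 (by omega) (by omega) h5 hg hk)⟩
  rcases Nat.lt_or_ge r a with har | har
  · have hb : b ≠ a + 2 := fun e => hab (mem_contractSet.2 ⟨hd, Or.inl ⟨har, e⟩⟩)
    -- Below the corner both endpoints move up by one, and the rows there hold no non-trivial member
    -- of T.
    obtain ⟨c, g, i, k, h1, h2, h3, h4, h5, h6, h7⟩ :=
      h.exists_crosses (a := a + 1) (b := b + 1) (mem_diagonals.2 (by omega))
        (fun hm => by have := hr.row _ _ hm (by omega); omega)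
    refine key c g i k h1 h2 h3 h4 h7 ?_
    rintro x y z - hx hxz hl hy
    have h8 : Crosses (a + 1, b + 1) (x, z) := by
      rcases hxz with e | e <;> rw [e] <;> assumption
    unfold Lift at hy
    rw [crosses_iff] at *
    omega
  have hno : ∀ b', Lift r b b' → (a, b') ∉ T := fun b' hb hm =>
    hab (mem_contractSet.2 ⟨hd, Or.inr ⟨har, b', hb, hm⟩⟩)
  -- Only this column has two lifts. Blockers of (a, r + 1) serve unless one of them ends at r + 2,
  -- which forces a < j. Then (a, r + 2) is used: its blockers cannot end at r + 1, because such
  -- members lie in rows ≥ j > a.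
  by_cases hbr : b = r + 1
  · subst hbr
    obtain ⟨c, g, i, k, h1, h2, h3, h4, h5, h6, h7⟩ := h.exists_crosses (a := a) (b := r + 1)
      (mem_diagonals.2 (by omega)) (hno _ (Or.inl ⟨le_rfl, rfl⟩))
    by_cases hgk : g ≠ r + 2 ∧ k ≠ r + 2
    · refine key c g i k h1 h2 h3 h4 h7 ?_
      rintro x y z - hx hxz hl hy
      have h8 : Crosses (a, r + 1) (x, z) ∧ z ≠ r + 2 := by
        rcases hxz with e | e <;> cases e
        · exact ⟨h5, hgk.1⟩
        · exact ⟨h6, hgk.2⟩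
      refine h8.1.contract har hx (Or.inl ⟨le_rfl, rfl⟩) hy ?_
      have h9 := h8.1
      unfold Lift at hy
      rw [crosses_iff] at h9
      omega
    have hlt : a < j := by
      have h8 : ∀ c g, (c, g) ∈ T → (c, g) ∈ shape (n + 1) → Crosses (a, r + 1) (c, g) →
          g = r + 2 → a < j := by
        rintro c _ h1 h2 h3 rfl
        rw [mem_shape] at h2
        rw [crosses_iff] at h3
        have := hj.right_le c h1 (by omega)
        omega
      by_contra hlt
      exact hgk ⟨fun e => hlt (h8 c g h1 h3 h5 e), fun e => hlt (h8 i k h2 h4 h6 e)⟩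
    clear hgk h1 h2 h3 h4 h5 h6 h7
    obtain ⟨c, g, i, k, h1, h2, h3, h4, h5, h6, h7⟩ := h.exists_crosses (a := a) (b := r + 2)
      (mem_diagonals.2 (by omega)) (hno _ (Or.inr ⟨le_rfl, rfl⟩))
    refine key c g i k h1 h2 h3 h4 h7 ?_
    rintro x y z hxz' hx hxz hl hy
    have h8 : Crosses (a, r + 2) (x, z) := by
      rcases hxz with e | e <;> rw [e] <;> assumption
    have h9 : z = r + 1 → j ≤ x := fun e => hj.left_ge x (e ▸ hxz')
    refine h8.contract har hx (Or.inr ⟨le_rfl, rfl⟩) hy ?_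
    unfold Lift at hy
    rw [crosses_iff] at h8
    omega
  · obtain ⟨b', hb⟩ : ∃ b', Lift r b b' := by
      rcases Nat.lt_or_ge b (r + 1) with h1 | h1
      · exact ⟨b, Or.inl ⟨by omega, rfl⟩⟩
      · exact ⟨b + 1, Or.inr ⟨h1, rfl⟩⟩
    obtain ⟨c, g, i, k, h1, h2, h3, h4, h5, h6, h7⟩ := h.exists_crosses (a := a) (b := b')
      (mem_diagonals.2 (by unfold Lift at hb; omega)) (hno _ hb)
    refine key c g i k h1 h2 h3 h4 h7 ?_
    rintro x y z hxz' hx hxz hl hy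
    have h8 : Crosses (a, b') (x, z) := by
      rcases hxz with e | e <;> rw [e] <;> assumption
    refine h8.contract har hx hb hy ?_
    unfold Lift at hy hb
    rw [crosses_iff] at h8
    omega

theorem row_of_mem_contractSet {a b : ℕ} (hab : (a, b) ∈ contractSet n T r) (ha : r < a) :
    b = a + 2 := by
  have := (mem_contractSet.1 hab).2
  omega

/-- A `2`-triangulation is recovered from its contraction and its apex. -/
theorem IsTwoTri.subset_expandSet (h : IsTwoTri (n + 1) T) (hr : IsCornerRow (n + 1) T r)
    (hj : IsApex T r j) : T ⊆ expandSet n (TwoTri.contractSet n T r) r j := by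
  rintro ⟨a, b'⟩ hab
  have hd := h.diag hab
  refine mem_expandSet.2 ⟨h.sub hab, ?_⟩
  by_cases hb : b' = a + 2
  · exact Or.inl hb
  obtain ⟨b, hb⟩ := exists_lift r (b' := b') (by omega)
  obtain ⟨har, h1⟩ := h.mem_contractSet_of_lift hr hab (by omega) hb
  refine Or.inr (Or.inr ⟨har, ?_, ?_, b, hb, h1⟩)
  · rintro rfl
    exact hj.left_ge a hab
  · rintro rfl
    exact hj.right_le a hab (by omega)

end Contract

section Expand

variable {n r j : ℕ} {S : Finset (ℕ × ℕ)}

theorem triFree_expandSet (h : IsTwoTri n S) : TriFree (expandSet n S r j) := by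
  have hsub : expandSet n S r j ⊆ diagonals (n + 1) := expandSet_subset _ _ _ _
  -- members that cross differ after the contraction
  have hne : ∀ {a b b' c g g'}, (a, b') ∈ expandSet n S r j → (c, g') ∈ expandSet n S r j →
      a + 3 ≤ b' → c + 3 ≤ g' → Crosses (a, b') (c, g') → Lift r b b' → Lift r g g' → b ≠ g := by
    rintro a b b' c g g' h1 h2 h3 h4 h5 h6 h7 rfl
    have h8 := (mem_expandSet.1 h1).2
    have h9 := (mem_expandSet.1 h2).2
    unfold Lift at h6 h7
    rw [crosses_iff] at h5
    omega
  -- Non-trivial members that cross the new ear end at r + 1 in rows ≥ j or at r + 2 in rows ≤ j,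
  -- and no two of these cross.
  have hear : ∀ {c g i k}, (c, g) ∈ expandSet n S r j → (i, k) ∈ expandSet n S r j →
      c + 3 ≤ g → i + 3 ≤ k → Crosses (r, r + 3) (c, g) → Crosses (r, r + 3) (i, k) →
      ¬ Crosses (c, g) (i, k) := by
    intro c g i k h1 h2 h3 h4 h5 h6 h7
    have h8 := (mem_expandSet.1 h1).2
    have h9 := (mem_expandSet.1 h2).2
    rw [crosses_iff] at h5 h6 h7
    omega
  have hmem : ∀ {a b'}, (a, b') ∈ expandSet n S r j → a + 3 ≤ b' → (a, b') ≠ (r, r + 3) →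
      a ≤ r ∧ ∃ b, Lift r b b' ∧ (a, b) ∈ S := by
    intro a b' h1 h2 h3
    rcases (mem_expandSet.1 h1).2 with h4 | h4 | h4
    · omega
    · exact absurd (Prod.ext h4.1 h4.2) h3
    · exact ⟨h4.1, h4.2.2.2⟩
  rintro ⟨a, b'⟩ hd ⟨c, g'⟩ he ⟨i, k'⟩ hf h1 h2 h3
  have hd' := mem_shape.1 (mem_shape_of_crosses (hsub hd) (hsub he) (hsub hf) h1 h2 h3)
  have he' := mem_shape.1 (mem_shape_of_crosses (hsub he) (hsub hd) (hsub hf) h1.symm h3 h2)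
  have hf' := mem_shape.1 (mem_shape_of_crosses (hsub hf) (hsub hd) (hsub he) h2.symm h3.symm h1)
  by_cases ed : (a, b') = (r, r + 3)
  · exact hear he hf (by omega) (by omega) (ed ▸ h1) (ed ▸ h2) h3
  by_cases ee : (c, g') = (r, r + 3)
  · exact hear hd hf (by omega) (by omega) (ee ▸ h1.symm) (ee ▸ h3) h2
  by_cases ef : (i, k') = (r, r + 3)
  · exact hear hd he (by omega) (by omega) (ef ▸ h2.symm) (ef ▸ h3.symm) h1
  obtain ⟨ha, b, hb, hab⟩ := hmem hd (by omega) ed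
  obtain ⟨hc, g, hg, hcg⟩ := hmem he (by omega) ee
  obtain ⟨hi, k, hk, hik⟩ := hmem hf (by omega) ef
  exact h.free _ hab _ hcg _ hik
    (h1.contract ha hc hb hg (hne hd he (by omega) (by omega) h1 hb hg))
    (h2.contract ha hi hb hk (hne hd hf (by omega) (by omega) h2 hb hk))
    (h3.contract hc hi hg hk (hne he hf (by omega) (by omega) h3 hg hk))

/-- The expansion contains T and has no 3-crossing, so maximality of T gives equality; hence T is
determined by its parent, its corner and its apex. -/
theorem IsTwoTri.eq_expandSet {T : Finset (ℕ × ℕ)} (h : IsTwoTri (n + 1) T)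
    (hr : IsCornerRow (n + 1) T r) (hj : IsApex T r j) :
    T = expandSet n (TwoTri.contractSet n T r) r j :=
  h.eq_of_subset (expandSet_subset _ _ _ _) (triFree_expandSet (h.contractSet hr hj))
    (h.subset_expandSet hr hj)

theorem isCornerRow_expandSet (hr2 : 2 ≤ r) (hrn : r + 2 ≤ n) :
    IsCornerRow (n + 1) (expandSet n S r j) r where
  two_le := hr2
  le := by omega
  ear := mem_expandSet.2 ⟨mem_diagonals.2 (by omega), by omega⟩
  row a b hab har := by
    have := (mem_expandSet.1 hab).2
    omega

theorem isApex_expandSet (hrn : r + 2 ≤ n) (hj1 : 1 ≤ j) (hjr : j < r)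
    (hj : (j, r + 1) ∈ S) : IsApex (expandSet n S r j) r j where
  pos := hj1
  lt := hjr
  left := mem_expandSet.2 ⟨mem_diagonals.2 (by omega), Or.inr (Or.inr
    ⟨hjr.le, fun _ => le_rfl, fun _ => le_rfl, r + 1, Or.inl ⟨le_rfl, rfl⟩, hj⟩)⟩
  right := mem_expandSet.2 ⟨mem_diagonals.2 (by omega), Or.inr (Or.inr
    ⟨hjr.le, fun _ => le_rfl, fun _ => le_rfl, r + 1, Or.inr ⟨le_rfl, rfl⟩, hj⟩)⟩
  left_ge a ha := by
    have := (mem_expandSet.1 ha).2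
    omega
  right_le a ha har := by
    have := (mem_expandSet.1 ha).2
    omega

/-- A missing diagonal either contracts to one missing from S, whose blockers are lifted, or is
missing because of the cut at j or below the new ear. In the latter cases the ear and an apex
diagonal block it. -/
theorem IsTwoTri.expandSet (h : IsTwoTri n S) (hr2 : 2 ≤ r) (hrn : r + 2 ≤ n)
    (hrow : ∀ a b, (a, b) ∈ S → r < a → b = a + 2) (hj1 : 1 ≤ j) (hjr : j < r)
    (hj : (j, r + 1) ∈ S) : IsTwoTri (n + 1) (expandSet n S r j) := by
  refine ⟨expandSet_subset _ _ _ _, triFree_expandSet h, ?_⟩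
  rintro ⟨a, b⟩ hd hab
  have hd' := mem_diagonals.1 hd
  have hr := isCornerRow_expandSet (S := S) (j := j) hr2 hrn
  have hap := isApex_expandSet hrn hj1 hjr hj
  have hnot : ¬ (b = a + 2 ∨ (a = r ∧ b = r + 3) ∨ (a ≤ r ∧ (b = r + 1 → j ≤ a) ∧
      (b = r + 2 → a ≤ j) ∧ ∃ b₁, Lift r b₁ b ∧ (a, b₁) ∈ S)) :=
    fun hm => hab (mem_expandSet.2 ⟨hd, hm⟩)
  have hlift : ∀ c g, (c, g) ∈ S → (c, g) ∈ shape n → c ≤ r ∧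
      ∃ g', Lift r g g' ∧ (c, g') ∈ TwoTri.expandSet n S r j := by
    intro c g h1 h2
    rw [mem_shape] at h2
    have hc : c ≤ r := by
      by_contra hlt
      have := hrow c g h1 (by omega)
      omega
    rcases Nat.lt_or_ge r g with hg | hg
    · by_cases hg' : g = r + 1 ∧ j ≤ c
      · refine ⟨hc, g, Or.inl ⟨by omega, rfl⟩, mem_expandSet.2 ⟨mem_diagonals.2 (by omega),
          Or.inr (Or.inr ⟨hc, by omega, by omega, g, Or.inl ⟨by omega, rfl⟩, h1⟩)⟩⟩
      · refine ⟨hc, g + 1, Or.inr ⟨by omega, rfl⟩, mem_expandSet.2 ⟨mem_diagonals.2 (by omega),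
          Or.inr (Or.inr ⟨hc, by omega, by omega, g, Or.inr ⟨by omega, rfl⟩, h1⟩)⟩⟩
    · refine ⟨hc, g, Or.inl ⟨by omega, rfl⟩, mem_expandSet.2 ⟨mem_diagonals.2 (by omega),
          Or.inr (Or.inr ⟨hc, by omega, by omega, g, Or.inl ⟨by omega, rfl⟩, h1⟩)⟩⟩
  -- crossing members of `S` can be lifted
  have key : ∀ c g i k : ℕ, (c, g) ∈ S → (i, k) ∈ S → (c, g) ∈ shape n →
      (i, k) ∈ shape n → Crosses (c, g) (i, k) →
      (∀ x y z, ((x, y) = (c, g) ∨ (x, y) = (i, k)) → x ≤ r →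
        Lift r y z → Crosses (a, b) (x, z)) →
      ∃ e ∈ TwoTri.expandSet n S r j, ∃ f ∈ TwoTri.expandSet n S r j,
        Crosses (a, b) e ∧ Crosses (a, b) f ∧ Crosses e f := by
    intro c g i k h1 h2 h3 h4 h5 h6
    obtain ⟨hc, g', hg, h7⟩ := hlift c g h1 h3
    obtain ⟨hi, k', hk, h8⟩ := hlift i k h2 h4
    exact ⟨_, h7, _, h8, h6 c g g' (Or.inl rfl) hc hg, h6 i k k' (Or.inr rfl) hi hk,
      h5.lift hc hi hg hk⟩
  rcases Nat.lt_or_ge r a with har | har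
  -- This one has no missing preimage, since (r + 1, r + 3) is trivial in the smaller polygon.
  · by_cases hb : a = r + 1 ∧ b = r + 4
    · refine ⟨_, hr.ear, _, hap.right, ?_, ?_, ?_⟩ <;> rw [crosses_iff] <;> omega
    obtain ⟨a', ha', ha''⟩ : ∃ a', r < a' ∧ (a' + 1 = a ∨ a' = a ∧ a = r + 1) := by
      rcases Nat.lt_or_ge (r + 1) a with h1 | h1
      · exact ⟨a - 1, by omega⟩
      · exact ⟨a, by omega⟩
    obtain ⟨c, g, i, k, h1, h2, h3, h4, h5, h6, h7⟩ :=
      h.exists_crosses (a := a') (b := b - 1) (mem_diagonals.2 (by omega))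
        (fun hm => by have := hrow _ _ hm ha'; omega)
    refine key c g i k h1 h2 h3 h4 h7 ?_
    rintro x y z hxz hx hy
    have h8 : Crosses (a', b - 1) (x, y) := by
      rcases hxz with e | e <;> rw [e] <;> assumption
    unfold Lift at hy
    rw [crosses_iff] at h8 ⊢
    omega
  obtain ⟨b₁, hb₁⟩ := exists_lift r (b' := b) (by omega)
  by_cases hm : (a, b₁) ∈ S
  -- With its contraction in S, the diagonal can be missing only because it lies on the wrong side
  -- of the cut.
  · rcases (show (b = r + 1 ∧ a < j) ∨ (b = r + 2 ∧ j < a) by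
      by_contra hcon
      exact hnot (Or.inr (Or.inr ⟨har, by omega, by omega, b₁, hb₁, hm⟩))) with ⟨rfl, hlt⟩ | ⟨rfl, hlt⟩
    · refine ⟨_, hr.ear, _, hap.right, ?_, ?_, ?_⟩ <;> rw [crosses_iff] <;> omega
    · refine ⟨_, hr.ear, _, hap.left, ?_, ?_, ?_⟩ <;> rw [crosses_iff] <;> omega
  · obtain ⟨c, g, i, k, h1, h2, h3, h4, h5, h6, h7⟩ :=
      h.exists_crosses (a := a) (b := b₁) (mem_diagonals.2 (by unfold Lift at hb₁; omega)) hm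
    refine key c g i k h1 h2 h3 h4 h7 ?_
    rintro x y z hxz hx hy
    have h8 : Crosses (a, b₁) (x, y) := by
      rcases hxz with e | e <;> rw [e] <;> assumption
    exact h8.lift har hx hb₁ hy

/-- Only one inclusion is checked; the maximality of S supplies the other. -/
theorem IsTwoTri.contractSet_expandSet (h : IsTwoTri n S) (hr2 : 2 ≤ r) (hrn : r + 2 ≤ n)
    (hrow : ∀ a b, (a, b) ∈ S → r < a → b = a + 2) (hj1 : 1 ≤ j) (hjr : j < r)
    (hj : (j, r + 1) ∈ S) : TwoTri.contractSet n (TwoTri.expandSet n S r j) r = S := by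
  symm
  refine h.eq_of_subset (contractSet_subset _ _ _)
    (h.expandSet hr2 hrn hrow hj1 hjr hj).triFree_contractSet ?_
  rintro ⟨a, b⟩ hab
  have hd := h.diag hab
  refine mem_contractSet.2 ⟨h.sub hab, ?_⟩
  rcases Nat.lt_or_ge r a with har | har
  · exact Or.inl ⟨har, hrow a b hab har⟩
  refine Or.inr ⟨har, ?_⟩
  by_cases hb : b ≤ r ∨ (b = r + 1 ∧ j ≤ a)
  · exact ⟨b, Or.inl ⟨by omega, rfl⟩, mem_expandSet.2 ⟨mem_diagonals.2 (by omega),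
      Or.inr (Or.inr ⟨har, by omega, by omega, b, Or.inl ⟨by omega, rfl⟩, hab⟩)⟩⟩
  · exact ⟨b + 1, Or.inr ⟨by omega, rfl⟩, mem_expandSet.2 ⟨mem_diagonals.2 (by omega),
      Or.inr (Or.inr ⟨har, by omega, by omega, b, Or.inr ⟨by omega, rfl⟩, hab⟩)⟩⟩

end Expand

end TwoTri
namespace TwoTri

/-! ### The generating tree of `2`-triangulations -/

theorem mem_diagram {n a b : ℕ} {T : Finset (ℕ × ℕ)} :
    (a, b) ∈ diagram n T ↔ (a, b) ∈ T ∧ (a, b) ∈ shape n := Finset.mem_inter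

theorem degree_eq_zero_iff {D : Finset (ℕ × ℕ)} {v : ℕ} :
    degree D v = 0 ↔ ∀ a b, (a, b) ∈ D → a ≠ v ∧ b ≠ v := by
  simp [degree, Finset.card_eq_zero, Finset.filter_eq_empty_iff]

section Parent

variable {n r j : ℕ} {T : Finset (ℕ × ℕ)}

theorem IsCornerRow.le_of_mem_diagram (hr : IsCornerRow n T r) {a b : ℕ}
    (h : (a, b) ∈ diagram n T) : a ≤ r := by
  have h1 := mem_diagram.1 h
  have h2 := mem_shape.1 h1.2
  by_contra hlt
  have := hr.row a b h1.1 (by omega)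
  omega

theorem IsCornerRow.degree_left_eq_zero_iff (hr : IsCornerRow n T r) :
    degree (diagram n T) (r + 1) = 0 ↔ ∀ a, (a, r + 1) ∉ diagram n T := by
  rw [degree_eq_zero_iff]
  constructor
  · intro h a ha
    exact (h a _ ha).2 rfl
  · intro h a b hab
    refine ⟨?_, ?_⟩
    · have := hr.le_of_mem_diagram hab; omega
    · rintro rfl; exact h a hab

theorem IsCornerRow.degree_right_eq_zero_iff (hr : IsCornerRow n T r) :
    degree (diagram n T) (r + 2) = 0 ↔ ∀ a, (a, r + 2) ∉ diagram n T := by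
  rw [degree_eq_zero_iff]
  constructor
  · intro h a ha
    exact (h a _ ha).2 rfl
  · intro h a b hab
    refine ⟨?_, ?_⟩
    · have := hr.le_of_mem_diagram hab; omega
    · rintro rfl; exact h a hab

/-- The second diagonal deleted in passing to the parent. -/
def secondDeleted (n : ℕ) (T : Finset (ℕ × ℕ)) (r : ℕ) : ℕ × ℕ :=
  if degree (diagram n T) (r + 1) = 0 then (r - 1, r + 2)
  else if degree (diagram n T) (r + 2) = 0 then (1, r + 1)
  else (((Finset.Ico 1 r).filter fun a => (a, r + 2) ∈ diagram n T).sup id, r + 2)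

theorem parentDiagram_eq (hr : corner n T = r) : parentDiagram n T =
    (((diagram n T).erase (r, r + 3)).erase (secondDeleted n T r)).image fun d =>
      (if d.1 ≤ r + 1 then d.1 else d.1 - 1, if d.2 ≤ r + 1 then d.2 else d.2 - 1) := by
  subst hr
  rfl

theorem IsApex.secondDeleted_eq (hj : IsApex T r j) (hr : IsCornerRow n T r)
    (h1 : degree (diagram n T) (r + 1) ≠ 0) (h2 : degree (diagram n T) (r + 2) ≠ 0) :
    secondDeleted n T r = (j, r + 2) ∧ (j, r + 1) ∈ diagram n T ∧ (j, r + 2) ∈ diagram n T := by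
  rw [Ne, hr.degree_left_eq_zero_iff] at h1
  rw [Ne, hr.degree_right_eq_zero_iff] at h2
  have h1' := h1
  have h2' := h2
  push Not at h1 h2
  obtain ⟨a, ha⟩ := h1
  obtain ⟨b, hb⟩ := h2
  rw [mem_diagram, mem_shape] at ha hb
  have hlt := hj.lt
  have hpos := hj.pos
  have h3 := hj.left_ge a ha.1
  have hle := hr.le
  have hbr : b < r := by omega
  have h4 := hj.right_le b hb.1 hbr
  have hjr : (j, r + 2) ∈ diagram n T := mem_diagram.2 ⟨hj.right, mem_shape.2 (by omega)⟩
  refine ⟨?_, mem_diagram.2 ⟨hj.left, mem_shape.2 (by omega)⟩, hjr⟩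
  rw [secondDeleted, if_neg (by rwa [hr.degree_left_eq_zero_iff]),
    if_neg (by rwa [hr.degree_right_eq_zero_iff])]
  congr 1
  apply le_antisymm
  · refine Finset.sup_le fun x hx => ?_
    rw [Finset.mem_filter, Finset.mem_Ico] at hx
    exact hj.right_le x (mem_diagram.1 hx.2).1 hx.1.2
  · exact Finset.le_sup (f := id) (Finset.mem_filter.2 ⟨Finset.mem_Ico.2 ⟨hpos, hlt⟩, hjr⟩)

/-- Contraction makes (r, r + 3) trivial and loses one more cross. If r + 1 has degree 0, the apex
is r - 1 and (r - 1, r + 2) becomes trivial. If r + 2 has degree 0, the apex is 1, the ear ends at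
the last vertex, and (1, r + 1) becomes trivial. Otherwise the two apex diagonals become equal.
These are the three cases of the second deletion. -/
theorem IsTwoTri.diagram_contractSet (h : IsTwoTri (n + 1) T) (hn : 5 ≤ n)
    (hr : IsCornerRow (n + 1) T r) (hj : IsApex T r j) :
    diagram n (TwoTri.contractSet n T r) = parentDiagram (n + 1) T := by
  rw [parentDiagram_eq (h.corner_eq (by omega) hr)]
  have hle := hr.le
  have hr2 := hr.two_le
  have hlt := hj.lt
  have hpos := hj.pos
  have hd1 := hr.degree_left_eq_zero_iff
  have hd2 := hr.degree_right_eq_zero_iff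
  ext ⟨a, b⟩
  simp only [Finset.mem_image, Finset.mem_erase, Prod.exists, Prod.mk.injEq]
  constructor
  · intro hab
    obtain ⟨hab, hs⟩ := mem_diagram.1 hab
    rw [mem_shape] at hs
    obtain ⟨har, b', hb, hab'⟩ := exists_lift_of_mem_contractSet hab (by omega)
    have key : ∀ b', Lift r b b' → (a, b') ∈ T → (a, b') ≠ secondDeleted (n + 1) T r →
        ∃ c g, ((c, g) ≠ secondDeleted (n + 1) T r ∧ (c, g) ≠ (r, r + 3) ∧
          (c, g) ∈ diagram (n + 1) T) ∧ (if c ≤ r + 1 then c else c - 1) = a ∧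
          (if g ≤ r + 1 then g else g - 1) = b := by
      intro b' hb hab' hne
      unfold Lift at hb
      refine ⟨a, b', ⟨hne, ?_, mem_diagram.2 ⟨hab', mem_shape.2 (by omega)⟩⟩, ?_, ?_⟩
      · rw [Ne, Prod.mk.injEq]; omega
      · rw [if_pos (by omega)]
      · split_ifs <;> omega
    by_cases hne : (a, b') = secondDeleted (n + 1) T r
    · by_cases h1 : degree (diagram (n + 1) T) (r + 1) = 0
      · rw [secondDeleted, if_pos h1, Prod.mk.injEq] at hne
        unfold Lift at hb
        omega
      · by_cases h2 : degree (diagram (n + 1) T) (r + 2) = 0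
        · have h3 : (j, r + 2) ∉ shape (n + 1) :=
            fun hs => hd2.1 h2 j (mem_diagram.2 ⟨hj.right, hs⟩)
          rw [mem_shape] at h3
          rw [secondDeleted, if_neg h1, if_pos h2, Prod.mk.injEq] at hne
          unfold Lift at hb
          omega
        · obtain ⟨h3, h4, h5⟩ := hj.secondDeleted_eq hr h1 h2
          rw [h3, Prod.mk.injEq] at hne
          obtain ⟨rfl, rfl⟩ := hne
          refine key (r + 1) (Or.inl ?_) hj.left ?_
          · unfold Lift at hb; omega
          · rw [h3, Ne, Prod.mk.injEq]; omega
    · exact key b' hb hab' hne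
  · rintro ⟨c, g, ⟨h1, h2, h3⟩, rfl, rfl⟩
    have hcr := hr.le_of_mem_diagram h3
    obtain ⟨h4, h5⟩ := mem_diagram.1 h3
    rw [mem_shape] at h5
    have hg : Lift r (if g ≤ r + 1 then g else g - 1) g := by
      unfold Lift
      split_ifs <;> omega
    rw [if_pos (by omega : c ≤ r + 1)]
    refine mem_diagram.2 ⟨(h.mem_contractSet_of_lift hr h4 (by omega) hg).2, mem_shape.2 ?_⟩
    have h6 : ¬ (c = r - 1 ∧ g = r + 2) := by
      rintro ⟨rfl, rfl⟩
      refine h1 ?_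
      have := hj.right_le _ h4 (by omega)
      rw [secondDeleted, if_pos]
      rw [hd1]
      intro a ha
      rw [mem_diagram, mem_shape] at ha
      have := hj.left_ge a ha.1
      omega
    have h7 : ¬ (c = 1 ∧ g = r + 1 ∧ r + 2 = n) := by
      rintro ⟨rfl, rfl, rfl⟩
      refine h1 ?_
      have h7 := hj.left_ge _ h4
      rw [secondDeleted, if_neg, if_pos]
      · rw [hd2]
        intro a ha
        rw [mem_diagram, mem_shape] at ha
        have := hj.right_le a ha.1 (by omega)
        omega
      · rw [hd1]
        exact fun hno => hno 1 h3
    have h8 : ¬ (c = r ∧ g = r + 3) := fun e => h2 (Prod.ext e.1 e.2)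
    split_ifs <;> omega

end Parent

/-! ### Column counts -/

theorem colCount_diagram (n : ℕ) (T : Finset (ℕ × ℕ)) (c : ℕ) : colCount (diagram n T) c =
    ((Finset.range c).filter fun a => (a, c) ∈ T ∧ (a, c) ∈ shape n).card := by
  unfold colCount
  symm
  apply Finset.card_nbij' (fun a => (a, c)) (fun d => d.1)
  · intro a ha
    simp only [Finset.coe_filter, Finset.mem_range, Set.mem_ofPred_eq] at ha
    simpa [diagram] using ha.2
  · rintro ⟨a, b⟩ ha
    simp only [Finset.coe_filter, Set.mem_ofPred_eq] at ha
    obtain ⟨ha, rfl⟩ := ha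
    have := mem_diagram.1 ha
    have := mem_shape.1 this.2
    simp only [Finset.coe_filter, Finset.mem_range, Set.mem_ofPred_eq]
    exact ⟨by omega, mem_diagram.1 ha⟩
  · intro a _; rfl
  · rintro ⟨a, b⟩ ha
    simp only [Finset.coe_filter, Set.mem_ofPred_eq] at ha
    rw [ha.2]

/-- The members of column `c` of `T` in the rows above `r`, trivial diagonals included. -/
def rowsAbove (T : Finset (ℕ × ℕ)) (r c : ℕ) : Finset ℕ :=
  (Finset.range r).filter fun a => (a, c) ∈ T

theorem mem_rowsAbove {T : Finset (ℕ × ℕ)} {r c a : ℕ} :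
    a ∈ rowsAbove T r c ↔ a < r ∧ (a, c) ∈ T := by
  simp [rowsAbove]

section Counts

variable {n r j : ℕ}

/-- The correction counts trivial members: (r - 1, r + 1) always, and (1, n - 1) when r + 1 = n - 1.
-/
theorem IsTwoTri.card_rowsAbove_left {S : Finset (ℕ × ℕ)} (h : IsTwoTri n S) (hn : 5 ≤ n)
    (hr2 : 2 ≤ r) (hrn : r + 2 ≤ n) : (rowsAbove S r (r + 1)).card =
      colCount (diagram n S) (r + 1) + 1 + if r + 2 = n then 1 else 0 := by
  rw [colCount_diagram]
  have hmem : ∀ a, 1 ≤ a → a < r → a + 1 = r ∨ (a = 1 ∧ r + 2 = n) → (a, r + 1) ∈ S :=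
    fun a _ _ _ => h.mem_of_notMem_shape (mem_diagonals.2 (by omega))
      (by rw [mem_shape]; omega)
  set R := (Finset.range (r + 1)).filter fun a => (a, r + 1) ∈ S ∧ (a, r + 1) ∈ shape n with hR
  have hRm : ∀ a, a ∈ R ↔ (a, r + 1) ∈ S ∧ (a, r + 1) ∈ shape n := by
    intro a
    simp only [hR, Finset.mem_filter, Finset.mem_range, and_iff_right_iff_imp]
    rintro ⟨-, hs⟩
    rw [mem_shape] at hs
    omega
  split_ifs with he
  · have : rowsAbove S r (r + 1) = insert 1 (insert (r - 1) R) := by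
      ext a
      rw [mem_rowsAbove, Finset.mem_insert, Finset.mem_insert, hRm, mem_shape]
      constructor
      · rintro ⟨h1, h2⟩
        have := h.diag h2
        by_cases h3 : a = 1 ∨ a = r - 1
        · tauto
        · exact Or.inr (Or.inr ⟨h2, by omega⟩)
      · rintro (rfl | rfl | ⟨h1, h2⟩)
        · exact ⟨by omega, hmem 1 (by omega) (by omega) (by omega)⟩
        · exact ⟨by omega, hmem _ (by omega) (by omega) (by omega)⟩
        · exact ⟨by omega, h1⟩
    rw [this, Finset.card_insert_of_notMem, Finset.card_insert_of_notMem]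
    · rw [hRm, mem_shape]; omega
    · rw [Finset.mem_insert, hRm, mem_shape]; omega
  · have : rowsAbove S r (r + 1) = insert (r - 1) R := by
      ext a
      rw [mem_rowsAbove, Finset.mem_insert, hRm, mem_shape]
      constructor
      · rintro ⟨h1, h2⟩
        have := h.diag h2
        by_cases h3 : a = r - 1
        · tauto
        · exact Or.inr ⟨h2, by omega⟩
      · rintro (rfl | ⟨h1, h2⟩)
        · exact ⟨by omega, hmem _ (by omega) (by omega) (by omega)⟩
        · exact ⟨by omega, h1⟩
    rw [this, Finset.card_insert_of_notMem, add_zero]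
    rw [hRm, mem_shape]; omega

theorem IsTwoTri.card_rowsAbove_right {T : Finset (ℕ × ℕ)} (h : IsTwoTri n T)
    (hr2 : 2 ≤ r) (hrn : r + 3 ≤ n) : (rowsAbove T r (r + 2)).card =
      colCount (diagram n T) (r + 2) + if r + 3 = n then 1 else 0 := by
  rw [colCount_diagram]
  set R := (Finset.range (r + 2)).filter fun a => (a, r + 2) ∈ T ∧ (a, r + 2) ∈ shape n with hR
  have hRm : ∀ a, a ∈ R ↔ (a, r + 2) ∈ T ∧ (a, r + 2) ∈ shape n := by
    intro a
    simp only [hR, Finset.mem_filter, Finset.mem_range, and_iff_right_iff_imp]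
    rintro ⟨-, hs⟩
    rw [mem_shape] at hs
    omega
  split_ifs with he
  · have : rowsAbove T r (r + 2) = insert 1 R := by
      ext a
      rw [mem_rowsAbove, Finset.mem_insert, hRm, mem_shape]
      constructor
      · rintro ⟨h1, h2⟩
        have := h.diag h2
        by_cases h3 : a = 1
        · tauto
        · exact Or.inr ⟨h2, by omega⟩
      · rintro (rfl | ⟨h1, h2⟩)
        · exact ⟨by omega, h.mem_of_notMem_shape (mem_diagonals.2 (by omega))
            (by rw [mem_shape]; omega)⟩
        · exact ⟨by omega, h1⟩
    rw [this, Finset.card_insert_of_notMem]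
    rw [hRm, mem_shape]; omega
  · rw [add_zero]
    congr 1
    ext a
    rw [mem_rowsAbove, hRm, mem_shape]
    constructor
    · rintro ⟨h1, h2⟩
      have := h.diag h2
      exact ⟨h2, by omega⟩
    · rintro ⟨h1, h2⟩
      exact ⟨by omega, h1⟩

variable {T : Finset (ℕ × ℕ)}

theorem IsTwoTri.rowsAbove_contractSet (h : IsTwoTri (n + 1) T) (hr : IsCornerRow (n + 1) T r) :
    rowsAbove (TwoTri.contractSet n T r) r (r + 1) =
      rowsAbove T r (r + 1) ∪ rowsAbove T r (r + 2) := by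
  have hle := hr.le
  ext a
  rw [Finset.mem_union, mem_rowsAbove, mem_rowsAbove, mem_rowsAbove, mem_contractSet]
  constructor
  · rintro ⟨h1, h2, h3 | ⟨-, b, hb | hb, h4⟩⟩
    · omega
    · obtain ⟨-, rfl⟩ := hb; exact Or.inl ⟨h1, h4⟩
    · obtain ⟨-, rfl⟩ := hb; exact Or.inr ⟨h1, h4⟩
  · rintro (⟨h1, h2⟩ | ⟨h1, h2⟩)
    · have := h.diag h2
      exact ⟨h1, mem_diagonals.2 (by omega), Or.inr ⟨h1.le, _, Or.inl ⟨le_rfl, rfl⟩, h2⟩⟩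
    · have := h.diag h2
      exact ⟨h1, mem_diagonals.2 (by omega), Or.inr ⟨h1.le, _, Or.inr ⟨le_rfl, rfl⟩, h2⟩⟩

theorem IsApex.rowsAbove_inter (hj : IsApex T r j) :
    rowsAbove T r (r + 1) ∩ rowsAbove T r (r + 2) = {j} := by
  ext a
  rw [Finset.mem_inter, mem_rowsAbove, mem_rowsAbove, Finset.mem_singleton]
  constructor
  · rintro ⟨⟨h1, h2⟩, -, h3⟩
    exact le_antisymm (hj.right_le a h3 h1) (hj.left_ge a h2)
  · rintro rfl
    exact ⟨⟨hj.lt, hj.left⟩, hj.lt, hj.right⟩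

/-- The new column r + 2 is the part of the parent's column up to the apex, so the rank of the apex
there is a column count of the child. -/
theorem IsTwoTri.rowsAbove_right_eq (h : IsTwoTri (n + 1) T) (hr : IsCornerRow (n + 1) T r)
    (hj : IsApex T r j) : rowsAbove T r (r + 2) =
      (rowsAbove (TwoTri.contractSet n T r) r (r + 1)).filter (· ≤ j) := by
  rw [h.rowsAbove_contractSet hr]
  ext a
  rw [Finset.mem_filter, Finset.mem_union, mem_rowsAbove, mem_rowsAbove]
  constructor
  · rintro ⟨h1, h2⟩
    exact ⟨Or.inr ⟨h1, h2⟩, hj.right_le a h2 h1⟩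
  · rintro ⟨⟨h1, h2⟩ | h1, h3⟩
    · obtain rfl := le_antisymm h3 (hj.left_ge a h2)
      exact ⟨h1, hj.right⟩
    · exact h1

/-- Above row r the merged column is the union of two columns sharing only the apex. The trivial
members in the three columns cancel out. -/
theorem IsTwoTri.colCount_split (h : IsTwoTri (n + 1) T) (hn : 5 ≤ n)
    (hr : IsCornerRow (n + 1) T r) (hj : IsApex T r j) :
    colCount (diagram (n + 1) T) (r + 1) + colCount (diagram (n + 1) T) (r + 2) =
      colCount (diagram n (TwoTri.contractSet n T r)) (r + 1) + 1 := by
  have hle := hr.le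
  have h1 := Finset.card_union_add_card_inter (rowsAbove T r (r + 1)) (rowsAbove T r (r + 2))
  rw [hj.rowsAbove_inter, Finset.card_singleton, ← h.rowsAbove_contractSet hr,
    (h.contractSet hr hj).card_rowsAbove_left hn hr.two_le (by omega),
    h.card_rowsAbove_left (by omega) hr.two_le (by omega),
    h.card_rowsAbove_right hr.two_le hle, if_neg (by omega : ¬ r + 2 = n + 1)] at h1
  have : (if r + 2 = n then 1 else 0) = if r + 3 = n + 1 then 1 else 0 := by
    split_ifs <;> omega
  omega

theorem IsCornerRow.colCount_low (hr : IsCornerRow (n + 1) T r) {c : ℕ} (hc : c ≤ r) :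
    colCount (diagram (n + 1) T) c = colCount (diagram n (TwoTri.contractSet n T r)) c := by
  rw [colCount_diagram, colCount_diagram]
  congr 1
  have hle := hr.le
  ext a
  simp only [Finset.mem_filter, Finset.mem_range, mem_contractSet, mem_shape, mem_diagonals]
  refine and_congr_right fun hac => ?_
  constructor
  · rintro ⟨h1, h2⟩
    exact ⟨⟨by omega, Or.inr ⟨by omega, c, Or.inl ⟨by omega, rfl⟩, h1⟩⟩, by omega⟩
  · rintro ⟨⟨h1, h2 | ⟨-, b, hb | hb, h2⟩⟩, h3⟩
    · omega
    · obtain ⟨-, rfl⟩ := hb; exact ⟨h2, by omega⟩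
    · omega

theorem IsCornerRow.colCount_high (hr : IsCornerRow (n + 1) T r) {c : ℕ} (hc : r + 3 ≤ c) :
    colCount (diagram (n + 1) T) (c + 1) =
      colCount (diagram n (TwoTri.contractSet n T r)) c := by
  rw [colCount_diagram, colCount_diagram]
  congr 1
  ext a
  simp only [Finset.mem_filter, Finset.mem_range, mem_contractSet, mem_shape, mem_diagonals]
  constructor
  · rintro ⟨h1, h2, h3⟩
    have har : a ≤ r := by
      by_contra hlt
      have := hr.row a _ h2 (by omega)
      omega
    exact ⟨by omega, ⟨by omega, Or.inr ⟨har, c + 1, Or.inr ⟨by omega, rfl⟩, h2⟩⟩, by omega⟩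
  · rintro ⟨h0, ⟨h1, h2 | ⟨har, b, hb | hb, h2⟩⟩, h3⟩
    · omega
    · omega
    · obtain ⟨-, rfl⟩ := hb; exact ⟨by omega, h2, by omega⟩

theorem IsCornerRow.colCount_ear (hn : 5 ≤ n)
    (hr : IsCornerRow (n + 1) T r) : colCount (diagram (n + 1) T) (r + 3) =
      colCount (diagram n (TwoTri.contractSet n T r)) (r + 2) + 1 := by
  rw [colCount_diagram, colCount_diagram]
  have hle := hr.le
  have hr2 := hr.two_le
  rw [← Finset.card_insert_of_notMem (a := r)
    (by simp only [Finset.mem_filter, mem_shape]; omega)]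
  congr 1
  ext a
  simp only [Finset.mem_insert, Finset.mem_filter, Finset.mem_range, mem_contractSet, mem_shape,
    mem_diagonals]
  constructor
  · rintro ⟨h1, h2, h3⟩
    have har : a ≤ r := by
      by_contra hlt
      have := hr.row a _ h2 (by omega)
      omega
    rcases har.eq_or_lt with har' | har'
    · exact Or.inl har'
    · exact Or.inr ⟨by omega, ⟨by omega, Or.inr ⟨har, r + 3, Or.inr ⟨by omega, rfl⟩, h2⟩⟩,
        by omega⟩
  · rintro (rfl | ⟨h0, ⟨h1, h2 | ⟨har, b, hb | hb, h2⟩⟩, h3⟩)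
    · exact ⟨by omega, hr.ear, by omega⟩
    · omega
    · omega
    · obtain ⟨-, rfl⟩ := hb; exact ⟨by omega, h2, by omega⟩

/-- The apex diagonal (j, r + 2) is non-trivial unless the ear ends at the last vertex; this is the
condition a ≥ 1. -/
theorem IsTwoTri.colCount_pos (h : IsTwoTri n T) (hr : IsCornerRow n T r) (hj : IsApex T r j)
    (hrn : r + 3 < n) : 1 ≤ colCount (diagram n T) (r + 2) := by
  have h1 := h.card_rowsAbove_right hr.two_le hr.le
  rw [if_neg (by omega), add_zero] at h1
  rw [← h1, Nat.one_le_iff_ne_zero, Ne, Finset.card_eq_zero]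
  exact Finset.ne_empty_of_mem (mem_rowsAbove.2 ⟨hj.lt, hj.right⟩)

end Counts

end TwoTri
-- Children of a 2-triangulation: the apex is chosen by its rank
namespace TwoTri

theorem exists_mem_card_filter_le (F : Finset ℕ) {k : ℕ} (h1 : 1 ≤ k) (hk : k ≤ F.card) :
    ∃ j ∈ F, (F.filter (· ≤ j)).card = k := by
  induction F using Finset.induction_on_max with
  | empty => simp at hk; omega
  | insert m F hm ih =>
    have hmF : m ∉ F := fun h => lt_irrefl _ (hm m h)
    rw [Finset.card_insert_of_notMem hmF] at hk
    rcases hk.eq_or_lt with rfl | hk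
    · refine ⟨m, Finset.mem_insert_self _ _, ?_⟩
      rw [Finset.filter_true_of_mem, Finset.card_insert_of_notMem hmF]
      intro x hx
      rcases Finset.mem_insert.1 hx with rfl | hx
      · exact le_rfl
      · exact (hm x hx).le
    · obtain ⟨j, hj, hjk⟩ := ih (by omega)
      refine ⟨j, Finset.mem_insert_of_mem hj, ?_⟩
      rw [Finset.filter_insert, if_neg (by have := hm j hj; omega), hjk]

theorem card_filter_le_injOn {F : Finset ℕ} {i j : ℕ} (hi : i ∈ F) (hj : j ∈ F)
    (h : (F.filter (· ≤ i)).card = (F.filter (· ≤ j)).card) : i = j := by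
  by_contra hne
  wlog hlt : i < j generalizing i j
  · exact this hj hi h.symm (Ne.symm hne) (by omega)
  refine h.not_lt (Finset.card_lt_card (Finset.ssubset_iff_of_subset ?_ |>.2 ⟨j, ?_, ?_⟩))
  · intro x hx
    rw [Finset.mem_filter] at hx ⊢
    exact ⟨hx.1, by omega⟩
  · exact Finset.mem_filter.2 ⟨hj, le_rfl⟩
  · rw [Finset.mem_filter]; omega

theorem IsTwoTri.eq_of_diagram_eq {n : ℕ} {S T : Finset (ℕ × ℕ)} (hS : IsTwoTri n S)
    (hT : IsTwoTri n T) (h : diagram n S = diagram n T) : S = T := by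
  refine hS.eq_of_subset hT.sub hT.free fun d hd => ?_
  by_cases hs : d ∈ shape n
  · exact (Finset.mem_inter.1 (h ▸ Finset.mem_inter.2 ⟨hd, hs⟩ : d ∈ diagram n T)).1
  · exact hT.mem_of_notMem_shape (hS.sub hd) hs

namespace TwoTriangulation

theorem isTwoTri {n : ℕ} (T : TwoTriangulation n) : IsTwoTri n T.1 :=
  isKTriangulation_two_iff.1 T.2

theorem isParent_iff {l r j : ℕ} {S : TwoTriangulation (l + 5)} {T : TwoTriangulation (l + 6)}
    (hr : IsCornerRow (l + 6) T.1 r) (hj : IsApex T.1 r j) :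
    triTree.IsParent (l := l) S T ↔ S.1 = contractSet (l + 5) T.1 r := by
  have h : IsTwoTri (l + 5 + 1) T.1 := T.isTwoTri
  change diagram (l + 5) S.1 = parentDiagram (l + 5 + 1) T.1 ↔ _
  rw [← h.diagram_contractSet (by omega) hr hj]
  constructor
  · exact S.isTwoTri.eq_of_diagram_eq (h.contractSet hr hj)
  · intro e; rw [e]

theorem diagram_five (T : TwoTriangulation 5) : diagram 5 T.1 = ∅ := by
  rw [Finset.eq_empty_iff_forall_notMem]
  rintro ⟨a, b⟩ h
  rw [mem_diagram, mem_shape] at h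
  omega

end TwoTriangulation

open TwoTriangulation

theorem isTwoTri_diagonals_five : IsTwoTri 5 (diagonals 5) := by
  refine ⟨subset_rfl, ?_, fun d hd hno => absurd hd hno⟩
  rintro ⟨a, b⟩ hd e he f hf h1 h2 h3
  have := mem_shape.1 (mem_shape_of_crosses hd he hf h1 h2 h3)
  omega

theorem triTree_isTree : triTree.IsTree := by
  constructor
  · refine ⟨(⟨diagonals 5, isKTriangulation_two_iff.2 isTwoTri_diagonals_five⟩ :
      TwoTriangulation 5), trivial, fun (T : TwoTriangulation 5) _ => ?_⟩
    apply Subtype.ext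
    refine T.isTwoTri.eq_of_diagram_eq isTwoTri_diagonals_five ?_
    rw [T.diagram_five]
    exact (diagram_five ⟨diagonals 5, isKTriangulation_two_iff.2 isTwoTri_diagonals_five⟩).symm
  · intro l (T : TwoTriangulation (l + 6))
    have h : IsTwoTri (l + 5 + 1) T.1 := T.isTwoTri
    have hr := h.isCornerRow_corner (by omega)
    obtain ⟨j, hj⟩ := h.exists_isApex hr
    refine ⟨(⟨_, isKTriangulation_two_iff.2 (h.contractSet hr hj)⟩ : TwoTriangulation (l + 5)),
      (isParent_iff hr hj).2 rfl, fun (S : TwoTriangulation (l + 5)) hS => ?_⟩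
    exact Subtype.ext ((isParent_iff hr hj).1 hS)

theorem IsCornerRow.le_of_contractSet {n r r' : ℕ} {T : Finset (ℕ × ℕ)}
    (h : IsCornerRow n (contractSet n T r) r') : r' ≤ r := by
  by_contra hlt
  have := row_of_mem_contractSet h.ear (by omega)
  omega

theorem triLabel_eq (n : ℕ) (T : Finset (ℕ × ℕ)) : triLabel n T =
    ((List.range' 1 (n - 1 - corner n T)).reverse).map fun j => colCount (diagram n T) (n - j) := by
  unfold triLabel
  refine List.ext_getElem (by simp) fun i h1 h2 => ?_
  simp only [List.getElem_map, List.getElem_reverse, List.getElem_range', List.length_range']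
  simp only [List.length_map, List.length_range'] at h1
  congr 1
  omega

/-- Index i stands for the i-th column from the right end, so low indices of the rule are the
columns beyond the ear. -/
theorem IsTwoTri.childData {l r j : ℕ} {T : Finset (ℕ × ℕ)} (h : IsTwoTri (l + 5 + 1) T)
    (hr : IsCornerRow (l + 5 + 1) T r) (hj : IsApex T r j) :
    ChildData (l + 5 - 1 - corner (l + 5) (TwoTri.contractSet (l + 5) T r))
      (fun i => colCount (diagram (l + 5) (TwoTri.contractSet (l + 5) T r)) (l + 5 - i))
      (l + 6 - 1 - r) (fun i => colCount (diagram (l + 6) T) (l + 6 - i)) := by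
  have hS := h.contractSet hr hj
  have hrS := (hS.isCornerRow_corner (by omega)).le_of_contractSet
  have hr2 := hr.two_le
  have hle := hr.le
  constructor
  · omega
  · omega
  · intro i hi
    have := hr.colCount_high (c := l + 5 - i) (by omega)
    rwa [show l + 5 - i + 1 = l + 6 - i by omega] at this
  · have := hr.colCount_ear (by omega)
    simp only [show l + 6 - (l + 6 - 1 - r - 2) = r + 3 by omega,
      show l + 5 - (l + 6 - 1 - r - 2) = r + 2 by omega]
    exact this
  · have := h.colCount_split (by omega) hr hj
    simp only [show l + 6 - (l + 6 - 1 - r - 1) = r + 2 by omega,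
      show l + 6 - (l + 6 - 1 - r) = r + 1 by omega,
      show l + 5 - (l + 6 - 1 - r - 1) = r + 1 by omega]
    rw [add_comm]
    exact this
  · intro i hi
    have := hr.colCount_low (c := l + 5 - i) (by omega)
    simp only [show l + 6 - (i + 1) = l + 5 - i by omega]
    exact this
  · intro hs
    have := h.colCount_pos hr hj (by omega)
    simp only [show l + 6 - (l + 6 - 1 - r - 1) = r + 2 by omega]
    exact this

theorem IsTwoTri.card_filter_rowsAbove {n r j : ℕ} {T : Finset (ℕ × ℕ)}
    (h : IsTwoTri (n + 1) T) (hr : IsCornerRow (n + 1) T r) (hj : IsApex T r j) :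
    ((rowsAbove (TwoTri.contractSet n T r) r (r + 1)).filter (· ≤ j)).card =
      colCount (diagram (n + 1) T) (r + 2) + if r + 2 = n then 1 else 0 := by
  rw [← h.rowsAbove_right_eq hr hj, h.card_rowsAbove_right hr.two_le hr.le]
  congr 1
  split_ifs <;> omega

/-- The data of the succession rule for a `2`-triangulation. -/
def triRule : GeneratingRule triTree where
  s {l} T := l + 5 - 1 - corner (l + 5) T.1
  e {l} T j := colCount (diagram (l + 5) T.1) (l + 5 - j)
  label_eq T := triLabel_eq _ _
  root_s := by
    intro (T : TwoTriangulation 5)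
    have h := T.isTwoTri.isCornerRow_corner le_rfl
    have h1 := h.two_le
    have h2 := h.le
    change 5 - 1 - corner 5 T.1 = 2
    omega
  root_e := by
    intro (T : TwoTriangulation 5)
    funext j
    change colCount (diagram 5 T.1) (5 - j) = 0
    rw [T.diagram_five]
    rfl
  child {l} := by
    intro (S : TwoTriangulation (l + 5)) (T : TwoTriangulation (l + 5 + 1)) hST
    have h := T.isTwoTri
    have hr := h.isCornerRow_corner (by omega)
    obtain ⟨j, hj⟩ := h.exists_isApex hr
    have hS := (isParent_iff hr hj).1 hST
    have key := h.childData hr hj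
    rw [← hS] at key
    exact key
  exists_child {l} := by
    intro (S : TwoTriangulation (l + 5)) t a ht hts ha hpos
    have h := S.isTwoTri
    have hrS := h.isCornerRow_corner (by omega)
    have hrS2 := hrS.two_le
    have hrSle := hrS.le
    change t ≤ l + 5 - 1 - corner (l + 5) S.1 + 1 at hts
    change a ≤ colCount (diagram (l + 5) S.1) (l + 5 - (t - 1)) + 1 at ha
    obtain ⟨r, hr⟩ : ∃ r, r + t = l + 5 := ⟨l + 5 - t, by omega⟩
    rw [show l + 5 - (t - 1) = r + 1 by omega] at ha
    have hcard := h.card_rowsAbove_left (by omega) (show 2 ≤ r by omega) (by omega)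
    have hif : (if r + 2 = l + 5 then 1 else 0) = if t = 2 then 1 else 0 := by
      split_ifs <;> omega
    -- The apex is the member whose rank gives the child a crosses in column r + 2. For t = 2 the
    -- trivial diagonal (1, r + 2) is counted too, which shifts ranks by one and admits a = 0.
    obtain ⟨j, hj, hjk⟩ := exists_mem_card_filter_le (rowsAbove S.1 r (r + 1))
      (k := a + if r + 2 = l + 5 then 1 else 0) (by rw [hif]; split_ifs <;> omega) (by omega)
    obtain ⟨hjr, hjS⟩ := mem_rowsAbove.1 hj
    have hj1 := (h.diag hjS).1
    have hrow : ∀ x y, (x, y) ∈ S.1 → r < x → y = x + 2 :=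
      fun x y hxy hx => hrS.row x y hxy (by omega)
    have hT := h.expandSet (by omega) (by omega) hrow hj1 hjr hjS
    have hrT := isCornerRow_expandSet (n := l + 5) (S := S.1) (j := j) (show 2 ≤ r by omega)
      (by omega)
    have hjT := isApex_expandSet (n := l + 5) (by omega) hj1 hjr hjS
    have hc := h.contractSet_expandSet (by omega) (by omega) hrow hj1 hjr hjS
    have hcount := hT.card_filter_rowsAbove hrT hjT
    rw [hc, hjk] at hcount
    have hcorner := hT.corner_eq (by omega) hrT
    refine ⟨(⟨_, isKTriangulation_two_iff.2 hT⟩ : TwoTriangulation (l + 5 + 1)),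
      (isParent_iff (l := l) hrT hjT).2 hc.symm, ?_, ?_⟩
    · change l + 5 + 1 - 1 - corner (l + 5 + 1) _ = t
      rw [hcorner]
      omega
    · change colCount (diagram (l + 5 + 1) _) (l + 1 + 5 - (t - 1)) = a
      rw [show l + 1 + 5 - (t - 1) = r + 2 by omega]
      exact (Nat.add_right_cancel hcount).symm
  child_unique {l} := by
    intro (S : TwoTriangulation (l + 5)) (T : TwoTriangulation (l + 5 + 1))
      (T' : TwoTriangulation (l + 5 + 1)) hT hT' hs he
    have h := T.isTwoTri
    have h' := T'.isTwoTri
    have hr := h.isCornerRow_corner (by omega)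
    have hr' := h'.isCornerRow_corner (by omega)
    have hr2 := hr.two_le
    have hle := hr.le
    have hle' := hr'.le
    change l + 5 + 1 - 1 - corner (l + 5 + 1) T.1 = l + 5 + 1 - 1 - corner (l + 5 + 1) T'.1 at hs
    change colCount (diagram (l + 5 + 1) T.1) (l + 5 + 1 - (l + 5 + 1 - 1 - corner (l + 5 + 1) T.1 - 1))
      = colCount (diagram (l + 5 + 1) T'.1) (l + 5 + 1 - (l + 5 + 1 - 1 - corner (l + 5 + 1) T.1 - 1))
      at he
    have hcc : corner (l + 5 + 1) T'.1 = corner (l + 5 + 1) T.1 := by omega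
    rw [hcc] at hr'
    set r := corner (l + 5 + 1) T.1
    rw [show l + 5 + 1 - (l + 5 + 1 - 1 - r - 1) = r + 2 by omega] at he
    obtain ⟨j, hj⟩ := h.exists_isApex hr
    obtain ⟨j', hj'⟩ := h'.exists_isApex hr'
    have hS := (isParent_iff hr hj).1 hT
    have hS' := (isParent_iff hr' hj').1 hT'
    have h1 := h.card_filter_rowsAbove hr hj
    have h2 := h'.card_filter_rowsAbove hr' hj'
    have m1 : j ∈ rowsAbove (contractSet (l + 5) T.1 r) r (r + 1) := by
      rw [h.rowsAbove_contractSet hr]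
      exact Finset.mem_union_left _ (mem_rowsAbove.2 ⟨hj.lt, hj.left⟩)
    have m2 : j' ∈ rowsAbove (contractSet (l + 5) T'.1 r) r (r + 1) := by
      rw [h'.rowsAbove_contractSet hr']
      exact Finset.mem_union_left _ (mem_rowsAbove.2 ⟨hj'.lt, hj'.left⟩)
    have e1 := h.eq_expandSet hr hj
    have e2 := h'.eq_expandSet hr' hj'
    rw [← hS] at h1 m1 e1
    rw [← hS'] at h2 m2 e2
    rw [← he, ← h1] at h2
    have hjj := card_filter_le_injOn m2 m1 h2
    subst hjj
    exact Subtype.ext (e1.trans e2.symm)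

end TwoTri
namespace TwoTri

/-! ### The coloring algorithm -/

open ColoringState

theorem ColoringState.block_zero (S : ColoringState) : S.block 0 = ∅ := if_pos rfl

theorem ColoringState.block_succ (S : ColoringState) (b : ℕ) :
    S.block (b + 1) = S.blocks.getD b ∅ := rfl

theorem ColoringState.block_of_lt {S : ColoringState} {b : ℕ} (h : S.blocks.length < b) :
    S.block b = ∅ := by
  obtain ⟨b, rfl⟩ : ∃ i, b = i + 1 := ⟨b - 1, by omega⟩
  rw [block_succ, List.getD_eq_default]
  omega

theorem ColoringState.mem_block_init {n b c : ℕ} :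
    c ∈ (ColoringState.init n).block b ↔ 1 ≤ b ∧ b + 3 ≤ n ∧ c = b + 3 := by
  rcases b with _ | b
  · simp [block_zero]
  rw [block_succ]
  rcases Nat.lt_or_ge b (n - 3) with h | h
  · have : (ColoringState.init n).blocks.getD b ∅ = {4 + b} := by
      rw [List.getD_eq_getElem _ _ (by simpa [ColoringState.init] using h)]
      simp [ColoringState.init]
    rw [this, Finset.mem_singleton]
    omega
  · rw [List.getD_eq_default _ _ (by simpa [ColoringState.init] using h)]
    simp
    omega

theorem ColoringState.length_mergedBlocks (S : ColoringState) {r : ℕ} (h2 : 2 ≤ r)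
    (hr : r ≤ S.blocks.length) : (S.mergedBlocks r).length + 1 = S.blocks.length := by
  unfold mergedBlocks
  split_ifs with h <;> simp <;> omega

/-- Merging blocks is contraction of columns, block b standing for column b + 3. For r = 2 the old
block 1 would merge into block 0, which b ≥ 1 leaves out: this is its disappearance. -/
theorem ColoringState.mem_block_iff_of_blocks_eq {S S₁ : ColoringState} {r : ℕ} (h2 : 2 ≤ r)
    (hr : r ≤ S.blocks.length) (h : S₁.blocks = S.mergedBlocks r) {b c : ℕ} (hb : 1 ≤ b) :
    c ∈ S₁.block b ↔ ∃ b', Lift r (b + 3) (b' + 3) ∧ c ∈ S.block b' := by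
  obtain ⟨b, rfl⟩ : ∃ i, b = i + 1 := ⟨b - 1, by omega⟩
  rw [block_succ, h]
  unfold mergedBlocks
  rcases Nat.lt_or_ge (b + 3) r with h1 | h1
  · have : ((S.blocks.take (r - 3) ++ if r = 2 then [] else [S.merged r]) ++
        S.blocks.drop (r - 1)).getD b ∅ = S.block (b + 1) := by
      rw [List.append_assoc, List.getD_append _ _ _ _ (by simp; omega), block_succ]
      simp only [List.getD_eq_getElem?_getD, List.getElem?_take]
      rw [if_pos (by omega)]
    rw [this]
    constructor
    · exact fun hc => ⟨b + 1, Or.inl (by omega), hc⟩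
    · rintro ⟨b', hl, hc⟩
      obtain rfl : b' = b + 1 := by unfold Lift at hl; omega
      exact hc
  rcases h1.eq_or_lt with h1 | h1
  · have : ((S.blocks.take (r - 3) ++ if r = 2 then [] else [S.merged r]) ++
        S.blocks.drop (r - 1)).getD b ∅ = S.merged r := by
      rw [if_neg (by omega), List.append_assoc,
        List.getD_append_right _ _ _ _ (by simp; omega)]
      rw [List.length_take, show b - min (r - 3) S.blocks.length = 0 by omega]
      rfl
    rw [this, merged, Finset.mem_union, show r - 2 = b + 1 by omega, show r - 1 = b + 2 by omega]
    constructor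
    · rintro (hc | hc)
      · exact ⟨b + 1, Or.inl (by omega), hc⟩
      · exact ⟨b + 2, Or.inr (by omega), hc⟩
    · rintro ⟨b', hl, hc⟩
      rcases (show b' = b + 1 ∨ b' = b + 2 by unfold Lift at hl; omega) with rfl | rfl
      · exact Or.inl hc
      · exact Or.inr hc
  · have : ((S.blocks.take (r - 3) ++ if r = 2 then [] else [S.merged r]) ++
        S.blocks.drop (r - 1)).getD b ∅ = S.block (b + 2) := by
      rw [block_succ, List.getD_append_right _ _ _ _ (by split_ifs <;> simp <;> omega)]
      simp only [List.getD_eq_getElem?_getD, List.getElem?_drop]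
      congr 2
      split_ifs <;> simp <;> omega
    rw [this]
    constructor
    · exact fun hc => ⟨b + 2, Or.inr (by omega), hc⟩
    · rintro ⟨b', hl, hc⟩
      obtain rfl : b' = b + 2 := by unfold Lift at hl; omega
      exact hc

/-- The uncolored crosses in the columns of `B`. -/
def uncoloredIn (D : Finset (ℕ × ℕ)) (S : ColoringState) (B : Finset ℕ) : Finset (ℕ × ℕ) :=
  D.filter fun z => z ∉ S.blue ∧ z ∉ S.red ∧ z.2 ∈ B

theorem mem_uncoloredIn {D : Finset (ℕ × ℕ)} {S : ColoringState} {B : Finset ℕ} {z : ℕ × ℕ} :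
    z ∈ uncoloredIn D S B ↔ Uncolored D S B z := by
  simp [uncoloredIn, Uncolored]

/-- The stage `S` of the algorithm on the diagram `D` corresponds to the ancestor `X`, a
`2`-triangulation of the `N`-gon: the block `b` plays the role of the column `b + 3` of `X`. -/
structure Stage (D : Finset (ℕ × ℕ)) (S : ColoringState) (N : ℕ) (X : Finset (ℕ × ℕ)) : Prop where
  length : S.blocks.length + 3 = N
  sorted : ∀ b b' c c', b < b' → c ∈ S.block b → c' ∈ S.block b' → c < c'
  blue_sub : S.blue ⊆ D
  red_sub : S.red ⊆ D
  disj : Disjoint S.blue S.red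
  cover : ∀ z ∈ D, z ∉ S.blue → z ∉ S.red → ∃ b, z.2 ∈ S.block b
  count : ∀ b, (uncoloredIn D S (S.block b)).card = colCount (diagram N X) (b + 3)
  pos : ∀ a c b, (a, c) ∈ D → c ∈ S.block b → (a, b + 3) ∈ diagram N X ∨ b < a ∨ a = 1
  exists_cross : ∀ a b, (a, b + 3) ∈ diagram N X → ∃ c ∈ S.block b, (a, c) ∈ D

theorem stage_init (n : ℕ) (hn : 3 ≤ n) (T : Finset (ℕ × ℕ)) :
    Stage (diagram n T) (ColoringState.init n) n T where
  length := by simp [ColoringState.init]; omega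
  sorted b b' c c' h h1 h2 := by
    rw [mem_block_init] at h1 h2
    omega
  blue_sub := Finset.empty_subset _
  red_sub := Finset.empty_subset _
  disj := Finset.disjoint_empty_left _
  cover := by
    rintro ⟨a, c⟩ hz - -
    have := mem_shape.1 (mem_diagram.1 hz).2
    exact ⟨c - 3, mem_block_init.2 (by simp only; omega)⟩
  count b := by
    unfold colCount
    congr 1
    ext ⟨a, c⟩
    rw [mem_uncoloredIn, Uncolored, mem_block_init, Finset.mem_filter]
    constructor
    · rintro ⟨h1, -, -, -, -, h2⟩
      exact ⟨h1, h2⟩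
    · rintro ⟨h1, h2⟩
      have := mem_shape.1 (mem_diagram.1 h1).2
      exact ⟨h1, Finset.notMem_empty _, Finset.notMem_empty _, by simp only at h2; omega,
        by simp only at h2; omega, h2⟩
  pos a c b h1 h2 := by
    rw [mem_block_init] at h2
    exact Or.inl (h2.2.2 ▸ h1)
  exists_cross a b h := by
    have := mem_shape.1 (mem_diagram.1 h).2
    exact ⟨b + 3, mem_block_init.2 (by omega), h⟩

section Step

variable {D X : Finset (ℕ × ℕ)} {S : ColoringState} {N r j : ℕ} {x y : ℕ × ℕ}

theorem Stage.block_unique (h : Stage D S N X) {b b' c : ℕ} (h1 : c ∈ S.block b)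
    (h2 : c ∈ S.block b') : b = b' := by
  rcases lt_trichotomy b b' with hlt | hlt | hlt
  · exact absurd (h.sorted _ _ _ _ hlt h1 h2) (lt_irrefl _)
  · exact hlt
  · exact absurd (h.sorted _ _ _ _ hlt h2 h1) (lt_irrefl _)

/-- Crosses of D, even colored ones, that no longer stand for a cross of X sit in a block of index
smaller than their row, or in row 1; neither can push the index beyond r. -/
theorem Stage.isCorner_iff (h : Stage D S N X) (hr : IsCornerRow N X r) (hN : 6 ≤ N) {a : ℕ} :
    IsCorner D S a ↔ a = r := by
  have hle := hr.le
  have hr2 := hr.two_le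
  have key : IsCorner D S r := by
    constructor
    · exact h.exists_cross r r (mem_diagram.2 ⟨hr.ear, mem_shape.2 (by omega)⟩)
    · rintro a ⟨c, hc, hac⟩
      rcases h.pos a c a hac hc with h1 | h1 | h1
      · exact hr.le_of_mem_diagram h1
      · omega
      · omega
  constructor
  · intro ha
    exact ha.unique key
  · rintro rfl
    exact key

theorem Stage.disjoint_uncoloredIn (h : Stage D S N X) {b b' : ℕ} (hb : b ≠ b') :
    Disjoint (uncoloredIn D S (S.block b)) (uncoloredIn D S (S.block b')) := by
  rw [Finset.disjoint_left]
  intro z h1 h2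
  rw [mem_uncoloredIn] at h1 h2
  exact hb (h.block_unique h1.2.2.2 h2.2.2.2)

theorem uncoloredIn_union {B B' : Finset ℕ} :
    uncoloredIn D S (B ∪ B') = uncoloredIn D S B ∪ uncoloredIn D S B' := by
  ext z
  simp only [Finset.mem_union, mem_uncoloredIn, Uncolored]
  tauto

theorem Stage.card_uncoloredIn_merged (h : Stage D S (N + 1) X) (hX : IsTwoTri (N + 1) X)
    (hN : 5 ≤ N) (hr : IsCornerRow (N + 1) X r) (hj : IsApex X r j) :
    (uncoloredIn D S (S.merged r)).card =
      colCount (diagram N (contractSet N X r)) (r + 1) + 1 := by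
  have hr2 := hr.two_le
  rw [merged, uncoloredIn_union, Finset.card_union_of_disjoint
    (h.disjoint_uncoloredIn (by omega)), h.count, h.count, ← hX.colCount_split hN hr hj,
    show r - 2 + 3 = r + 1 by omega, show r - 1 + 3 = r + 2 by omega]

/-- Column 3 plays the part of the empty block 0, so that the counts for r = 2 need no separate
formula. -/
theorem colCount_three (n : ℕ) (T : Finset (ℕ × ℕ)) : colCount (diagram n T) 3 = 0 := by
  rw [colCount_diagram, Finset.card_eq_zero, Finset.filter_eq_empty_iff]
  rintro a - ⟨-, h⟩
  rw [mem_shape] at h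
  omega

theorem uncolored_blueMerge {B : Finset ℕ} {z : ℕ × ℕ} :
    Uncolored D (S.blueMerge r x) B z ↔ Uncolored D S B z ∧ z ≠ x := by
  simp only [Uncolored, blueMerge, Finset.mem_insert, not_or]
  tauto

theorem uncolored_addRed {B : Finset ℕ} {z : ℕ × ℕ} :
    Uncolored D (S.addRed y) B z ↔ Uncolored D S B z ∧ z ≠ y := by
  simp only [Uncolored, addRed, Finset.mem_insert, not_or]
  tauto

theorem Stage.mem_merged (h : Stage D S N X) (hr2 : 2 ≤ r) {c b : ℕ} (hc : c ∈ S.merged r)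
    (hb : c ∈ S.block b) : b + 2 = r ∨ b + 1 = r := by
  rw [merged, Finset.mem_union] at hc
  rcases hc with hc | hc
  · have := h.block_unique hc hb; omega
  · have := h.block_unique hc hb; omega

theorem mem_merged_of_mem_block {c b : ℕ} (hc : c ∈ S.block b) (hb : b + 2 = r ∨ b + 1 = r) :
    c ∈ S.merged r := by
  rw [merged, Finset.mem_union]
  rcases hb with rfl | rfl
  · exact Or.inl hc
  · exact Or.inr hc

theorem Stage.exists_leftmost (h : Stage D S (N + 1) X) (hN : 5 ≤ N)
    (hr : IsCornerRow (N + 1) X r) : ∃ x, Leftmost D S (S.block r) x := by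
  have h1 := h.count r
  rw [hr.colCount_ear hN] at h1
  obtain ⟨x, hx, hmin⟩ := Finset.exists_min_image (uncoloredIn D S (S.block r)) (fun z => z.2)
    (Finset.card_pos.1 (by omega))
  exact ⟨x, mem_uncoloredIn.1 hx, fun z hz => hmin z (mem_uncoloredIn.2 hz)⟩

theorem Stage.exists_rightmost (h : Stage D S (N + 1) X) (hX : IsTwoTri (N + 1) X)
    (hN : 5 ≤ N) (hr : IsCornerRow (N + 1) X r) (hj : IsApex X r j)
    (hx : Leftmost D S (S.block r) x) :
    ∃ y, Rightmost D (S.blueMerge r x) (S.merged r) y := by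
  have h1 := h.card_uncoloredIn_merged hX hN hr hj
  obtain ⟨y, hy, hmax⟩ := Finset.exists_max_image (uncoloredIn D S (S.merged r)) (fun z => z.2)
    (Finset.card_pos.1 (by omega))
  rw [mem_uncoloredIn] at hy
  refine ⟨y, uncolored_blueMerge.2 ⟨hy, ?_⟩, fun z hz =>
    hmax z (mem_uncoloredIn.2 (uncolored_blueMerge.1 hz).1)⟩
  rintro rfl
  have := h.mem_merged hr.two_le hy.2.2.2 hx.1.2.2.2
  omega

/-- One iteration of the algorithm at a stage that corresponds to `X`. -/
structure StepData (D : Finset (ℕ × ℕ)) (S : ColoringState) (N : ℕ) (X : Finset (ℕ × ℕ))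
    (r j : ℕ) (x y : ℕ × ℕ) : Prop where
  stage : Stage D S (N + 1) X
  tri : IsTwoTri (N + 1) X
  five_le : 5 ≤ N
  row : IsCornerRow (N + 1) X r
  apex : IsApex X r j
  left : Leftmost D S (S.block r) x
  right : Rightmost D (S.blueMerge r x) (S.merged r) y

namespace StepData

theorem mem_block_iff (h : StepData D S N X r j x y) {b c : ℕ} (hb : 1 ≤ b) :
    c ∈ ((S.blueMerge r x).addRed y).block b ↔
      ∃ b', Lift r (b + 3) (b' + 3) ∧ c ∈ S.block b' :=
  mem_block_iff_of_blocks_eq h.row.two_le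
    (by have := h.row.le; have := h.stage.length; omega) rfl hb

theorem uncolored_iff {B : Finset ℕ} {z : ℕ × ℕ} :
    Uncolored D ((S.blueMerge r x).addRed y) B z ↔ Uncolored D S B z ∧ z ≠ x ∧ z ≠ y := by
  rw [uncolored_addRed, uncolored_blueMerge, and_assoc]

theorem right_uncolored (h : StepData D S N X r j x y) : Uncolored D S (S.merged r) y :=
  (uncolored_blueMerge.1 h.right.1).1

theorem left_ne_right (h : StepData D S N X r j x y) : x ≠ y := by
  rintro rfl
  exact (uncolored_blueMerge.1 h.right.1).2 rfl

/-- If the corner is `2`, then the block that disappears is fully colored. -/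
theorem eq_right_of_two (h : StepData D S N X 2 j x y) {z : ℕ × ℕ}
    (hz : Uncolored D S (S.merged 2) z) : z = y := by
  have h1 := h.stage.card_uncoloredIn_merged h.tri h.five_le h.row h.apex
  -- Splitting column 3 of the parent leaves 0 + 1 uncolored crosses, so the red one is the last.
  rw [colCount_three, zero_add, Finset.card_eq_one] at h1
  obtain ⟨w, hw⟩ := h1
  have h2 := mem_uncoloredIn.2 hz
  have h3 := mem_uncoloredIn.2 h.right_uncolored
  rw [hw, Finset.mem_singleton] at h2 h3
  rw [h2, h3]

/-- The blue cross accounts for the ear in column r + 3, the red one for the row shared by the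
merged columns. For this invariant any uncolored crosses in the right blocks would do; leftmost and
rightmost matter only for the final colors. -/
theorem next (h : StepData D S N X r j x y) :
    Stage D ((S.blueMerge r x).addRed y) N (contractSet N X r) := by
  have hs := h.stage
  have hr2 := h.row.two_le
  have hle := h.row.le
  have hlen := hs.length
  have hxu := h.left.1
  have hyu := h.right_uncolored
  constructor
  · have := S.length_mergedBlocks hr2 (by omega)
    change (S.mergedBlocks r).length + 3 = N
    omega
  · intro b b' c c' hbb hc hc'
    rcases Nat.eq_zero_or_pos b with rfl | hb
    · rw [block_zero] at hc; simp at hc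
    rw [h.mem_block_iff hb] at hc
    rw [h.mem_block_iff (by omega)] at hc'
    obtain ⟨b₁, hl, hc⟩ := hc
    obtain ⟨b₂, hl', hc'⟩ := hc'
    rcases Nat.lt_or_ge b₁ b₂ with hlt | hge
    · exact hs.sorted _ _ _ _ hlt hc hc'
    · unfold Lift at hl hl'; omega
  · exact Finset.insert_subset hxu.1 hs.blue_sub
  · exact Finset.insert_subset hyu.1 hs.red_sub
  · change Disjoint (insert x S.blue) (insert y S.red)
    rw [Finset.disjoint_insert_left, Finset.disjoint_insert_right, Finset.mem_insert, not_or]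
    exact ⟨⟨h.left_ne_right, hxu.2.2.1⟩, hyu.2.1, hs.disj⟩
  · intro z hz h1 h2
    have h1' : z ≠ x ∧ z ∉ S.blue := by
      simpa [addRed, blueMerge, not_or] using h1
    have h2' : z ≠ y ∧ z ∉ S.red := by
      simpa [addRed, blueMerge, not_or] using h2
    obtain ⟨b', hb'⟩ := hs.cover z hz h1'.2 h2'.2
    rcases Nat.eq_zero_or_pos b' with rfl | hb0
    · rw [block_zero] at hb'; simp at hb'
    by_cases hb : r = 2 ∧ b' = 1
    · obtain ⟨rfl, rfl⟩ := hb
      exact absurd (h.eq_right_of_two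
        ⟨hz, h1'.2, h2'.2, mem_merged_of_mem_block hb' (Or.inr rfl)⟩) h2'.1
    · rcases Nat.lt_or_ge (b' + 3) (r + 2) with hlt | hge
      · exact ⟨b', (h.mem_block_iff hb0).2 ⟨b', Or.inl (by omega), hb'⟩⟩
      · exact ⟨b' - 1, (h.mem_block_iff (by omega)).2 ⟨b', Or.inr (by omega), hb'⟩⟩
  · intro b
    rcases Nat.eq_zero_or_pos b with rfl | hb
    · rw [block_zero, zero_add, colCount_three, Finset.card_eq_zero]
      simp [uncoloredIn]
    have hmem : ∀ z, z ∈ uncoloredIn D ((S.blueMerge r x).addRed y)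
        (((S.blueMerge r x).addRed y).block b) ↔ (∃ b', Lift r (b + 3) (b' + 3) ∧
          z ∈ uncoloredIn D S (S.block b')) ∧ z ≠ x ∧ z ≠ y := by
      intro z
      rw [mem_uncoloredIn, uncolored_iff, Uncolored, h.mem_block_iff hb]
      simp only [mem_uncoloredIn, Uncolored]
      constructor
      · rintro ⟨⟨h1, h2, h3, b', h4, h5⟩, h6⟩
        exact ⟨⟨b', h4, h1, h2, h3, h5⟩, h6⟩
      · rintro ⟨⟨b', h4, h1, h2, h3, h5⟩, h6⟩
        exact ⟨⟨h1, h2, h3, b', h4, h5⟩, h6⟩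
    have hxb : ∀ b', x ∈ uncoloredIn D S (S.block b') → b' = r := fun b' hb' =>
      hs.block_unique (mem_uncoloredIn.1 hb').2.2.2 hxu.2.2.2
    have hyb : ∀ b', y ∈ uncoloredIn D S (S.block b') → b' + 2 = r ∨ b' + 1 = r := fun b' hb' =>
      hs.mem_merged hr2 hyu.2.2.2 (mem_uncoloredIn.1 hb').2.2.2
    have hsingle : ∀ b', (∀ b'', Lift r (b + 3) (b'' + 3) ↔ b'' = b') → b' ≠ r → b' + 2 ≠ r →
        b' + 1 ≠ r → uncoloredIn D ((S.blueMerge r x).addRed y)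
          (((S.blueMerge r x).addRed y).block b) = uncoloredIn D S (S.block b') := by
      intro b' hl h1 h2 h3
      ext z
      rw [hmem]
      simp only [hl, exists_eq_left]
      refine ⟨fun hz => hz.1, fun hz => ⟨hz, ?_, ?_⟩⟩
      · rintro rfl; exact h1 (hxb b' hz)
      · rintro rfl; have := hyb b' hz; omega
    rcases Nat.lt_or_ge (b + 2) r with h1 | h1
    · rw [hsingle b (fun b'' => by unfold Lift; omega) (by omega) (by omega) (by omega), hs.count,
        h.row.colCount_low (by omega)]
    rcases h1.eq_or_lt with h1 | h1
    · have h2 := hs.card_uncoloredIn_merged h.tri h.five_le h.row h.apex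
      have h3 : insert y (uncoloredIn D ((S.blueMerge r x).addRed y)
          (((S.blueMerge r x).addRed y).block b)) = uncoloredIn D S (S.merged r) := by
        ext z
        rw [Finset.mem_insert, hmem, merged, uncoloredIn_union, Finset.mem_union]
        have e1 : r - 2 = b := by omega
        have e2 : r - 1 = b + 1 := by omega
        constructor
        · rintro (rfl | ⟨⟨b', hl, hz⟩, -⟩)
          · rw [← Finset.mem_union, ← uncoloredIn_union]
            exact mem_uncoloredIn.2 hyu
          · rw [e1, e2]
            rcases (show b' = b ∨ b' = b + 1 by unfold Lift at hl; omega) with rfl | rfl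
            · exact Or.inl hz
            · exact Or.inr hz
        · intro hz
          by_cases hzy : z = y
          · exact Or.inl hzy
          · refine Or.inr ?_
            rw [e1, e2] at hz
            rcases hz with hz | hz
            · refine ⟨⟨b, Or.inl (by omega), hz⟩, ?_, hzy⟩
              rintro rfl; have := hxb _ hz; omega
            · refine ⟨⟨b + 1, Or.inr (by omega), hz⟩, ?_, hzy⟩
              rintro rfl; have := hxb _ hz; omega
      rw [← h3, Finset.card_insert_of_notMem (by rw [hmem]; tauto)] at h2
      rw [show b + 3 = r + 1 by omega]
      omega
    rcases Nat.eq_or_lt_of_le h1 with h1 | h1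
    · have h3 : insert x (uncoloredIn D ((S.blueMerge r x).addRed y)
          (((S.blueMerge r x).addRed y).block b)) = uncoloredIn D S (S.block r) := by
        ext z
        rw [Finset.mem_insert, hmem]
        constructor
        · rintro (rfl | ⟨⟨b', hl, hz⟩, -⟩)
          · exact mem_uncoloredIn.2 hxu
          · obtain rfl : b' = r := by unfold Lift at hl; omega
            exact hz
        · intro hz
          by_cases hzx : z = x
          · exact Or.inl hzx
          · refine Or.inr ⟨⟨r, Or.inr (by omega), hz⟩, hzx, ?_⟩
            rintro rfl; have := hyb _ hz; omega
      have h2 := hs.count r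
      rw [h.row.colCount_ear h.five_le, ← h3,
        Finset.card_insert_of_notMem (by rw [hmem]; tauto)] at h2
      rw [show b + 3 = r + 2 by omega]
      omega
    · rw [hsingle (b + 1) (fun b'' => by unfold Lift; omega) (by omega) (by omega) (by omega),
        hs.count, ← h.row.colCount_high (c := b + 3) (by omega)]
  -- A cross that leaves the shape by contraction becomes (a, a + 2) or lies in row 1, which the two
  -- alternatives record.
  · intro a c b hac hc
    rcases Nat.eq_zero_or_pos b with rfl | hb
    · rw [block_zero] at hc; simp at hc
    rw [h.mem_block_iff hb] at hc
    obtain ⟨b', hl, hc⟩ := hc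
    by_contra hcon
    push Not at hcon
    obtain ⟨h1, h2, h3⟩ := hcon
    rcases hs.pos a c b' hac hc with h4 | h4 | h4
    · have har := h.row.le_of_mem_diagram h4
      rw [mem_diagram, mem_shape] at h4
      refine h1 (mem_diagram.2 ⟨mem_contractSet.2 ⟨mem_diagonals.2 ?_,
        Or.inr ⟨har, b' + 3, hl, h4.1⟩⟩, mem_shape.2 ?_⟩)
      · unfold Lift at hl; omega
      · unfold Lift at hl; omega
    · unfold Lift at hl; omega
    · exact h3 h4
  · intro a b hab
    obtain ⟨h1, h2⟩ := mem_diagram.1 hab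
    rw [mem_shape] at h2
    obtain ⟨har, b', hl, h3⟩ := exists_lift_of_mem_contractSet h1 (by omega)
    obtain ⟨b', rfl⟩ : ∃ i, b' = i + 3 := ⟨b' - 3, by unfold Lift at hl; omega⟩
    obtain ⟨c, hc, hac⟩ := hs.exists_cross a b'
      (mem_diagram.2 ⟨h3, mem_shape.2 (by unfold Lift at hl; omega)⟩)
    exact ⟨c, (h.mem_block_iff (by omega)).2 ⟨b', hl, hc⟩, hac⟩

end StepData

end Step

end TwoTri
-- Reading the colors backwards; identification of the output
namespace TwoTri

open ColoringState

/-- `Bf` and `Rf` are the crosses still to be colored blue and red at the stage `S`; their numbers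
in the blocks are given by the sequences `p`, `q`, and in each block blue precedes red. -/
structure Future (D : Finset (ℕ × ℕ)) (S : ColoringState) (m : ℕ) (p q : ℕ → ℕ)
    (Bf Rf : Finset (ℕ × ℕ)) : Prop where
  mem_iff : ∀ z, z ∈ Bf ∨ z ∈ Rf ↔ z ∈ D ∧ z ∉ S.blue ∧ z ∉ S.red
  disj : Disjoint Bf Rf
  blue : ∀ b, (Bf.filter fun z => z.2 ∈ S.block b).card = p (m + 2 - b)
  red : ∀ b, (Rf.filter fun z => z.2 ∈ S.block b).card = q (m + 1 - b)
  le : ∀ b, ∀ z ∈ Bf, ∀ w ∈ Rf, z.2 ∈ S.block b → w.2 ∈ S.block b → z.2 ≤ w.2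

theorem card_filter_add_card_filter {D : Finset (ℕ × ℕ)} {S : ColoringState}
    {Bf Rf : Finset (ℕ × ℕ)} (hmem : ∀ z, z ∈ Bf ∨ z ∈ Rf ↔ z ∈ D ∧ z ∉ S.blue ∧ z ∉ S.red)
    (hdisj : Disjoint Bf Rf) (B : Finset ℕ) :
    (Bf.filter fun z => z.2 ∈ B).card + (Rf.filter fun z => z.2 ∈ B).card =
      (uncoloredIn D S B).card := by
  rw [← Finset.card_union_of_disjoint (Finset.disjoint_filter_filter hdisj)]
  congr 1
  ext z
  rw [Finset.mem_union, Finset.mem_filter, Finset.mem_filter, mem_uncoloredIn, Uncolored,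
    ← or_and_right, hmem]
  tauto

theorem Stage.future_final {D X : Finset (ℕ × ℕ)} {S : ColoringState} {p q : ℕ → ℕ}
    (h : Stage D S 5 X) (hX : diagram 5 X = ∅) (hp : p = 0) (hq : q = 0) :
    Future D S 1 p q ∅ ∅ where
  mem_iff z := by
    simp only [Finset.notMem_empty, or_self, false_iff]
    rintro ⟨h1, h2, h3⟩
    obtain ⟨b, hb⟩ := h.cover z h1 h2 h3
    have h4 := h.count b
    rw [hX] at h4
    exact Finset.notMem_empty z (Finset.card_eq_zero.1 h4 ▸ mem_uncoloredIn.2 ⟨h1, h2, h3, hb⟩)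
  disj := Finset.disjoint_empty_left _
  blue b := by simp [hp]
  red b := by simp [hq]
  le := by simp

/-- Away from the blocks r - 2, r - 1 and r the exponents are only shifted, and x adds one in block
r. In the merged block the totals of both colors are known; leftmost blue and rightmost red keep
blue weakly before red. Separating the block then poses the system solved uniquely in
`SeqParent.child_unique`. -/
theorem StepData.future {D X : Finset (ℕ × ℕ)} {S : ColoringState} {m r j u : ℕ} {x y : ℕ × ℕ}
    {P Q p q : ℕ → ℕ} {Bf Rf : Finset (ℕ × ℕ)} (h : StepData D S (m + 4) X r j x y)
    (hf : Future D ((S.blueMerge r x).addRed y) m P Q Bf Rf) (hu : r + u = m + 2)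
    (hseq : SeqParent u P Q p q) (hpq : p (u + 2) * q (u + 2) = 0)
    (hcount : colCount (diagram (m + 5) X) (r + 1) = p (u + 3) + q (u + 2))
    (hp0 : p 0 = 0) (hq0 : q 0 = 0) (hp : ∀ i, m + 2 ≤ i → p i = 0)
    (hq : ∀ i, m + 2 ≤ i → q i = 0) :
    Future D S (m + 1) p q (insert x Bf) (insert y Rf) := by
  have hs := h.stage
  have hr2 := h.row.two_le
  have hle := h.row.le
  have hlen := hs.length
  have hxu := h.left.1
  have hyu := h.right_uncolored
  have hxy := h.left_ne_right
  have hfu : ∀ z, z ∈ Bf ∨ z ∈ Rf ↔ (z ∈ D ∧ z ∉ S.blue ∧ z ∉ S.red) ∧ z ≠ x ∧ z ≠ y := by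
    intro z
    rw [hf.mem_iff]
    simp only [addRed, blueMerge, Finset.mem_insert, not_or]
    tauto
  have hxB : x ∉ Bf := fun hx => ((hfu x).1 (Or.inl hx)).2.1 rfl
  have hxR : x ∉ Rf := fun hx => ((hfu x).1 (Or.inr hx)).2.1 rfl
  have hyB : y ∉ Bf := fun hy => ((hfu y).1 (Or.inl hy)).2.2 rfl
  have hyR : y ∉ Rf := fun hy => ((hfu y).1 (Or.inr hy)).2.2 rfl
  have hmem : ∀ z, z ∈ insert x Bf ∨ z ∈ insert y Rf ↔ z ∈ D ∧ z ∉ S.blue ∧ z ∉ S.red := by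
    intro z
    rw [Finset.mem_insert, Finset.mem_insert]
    constructor
    · rintro ((rfl | hz) | (rfl | hz))
      · exact ⟨hxu.1, hxu.2.1, hxu.2.2.1⟩
      · exact ((hfu z).1 (Or.inl hz)).1
      · exact ⟨hyu.1, hyu.2.1, hyu.2.2.1⟩
      · exact ((hfu z).1 (Or.inr hz)).1
    · intro hz
      by_cases hzx : z = x
      · exact Or.inl (Or.inl hzx)
      by_cases hzy : z = y
      · exact Or.inr (Or.inl hzy)
      rcases (hfu z).2 ⟨hz, hzx, hzy⟩ with h1 | h1
      · exact Or.inl (Or.inr h1)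
      · exact Or.inr (Or.inr h1)
  have hdisj : Disjoint (insert x Bf) (insert y Rf) := by
    rw [Finset.disjoint_insert_left, Finset.disjoint_insert_right, Finset.mem_insert, not_or]
    exact ⟨⟨hxy, hxR⟩, hyB, hf.disj⟩
  have hyle : ∀ z ∈ Bf, z.2 ∈ S.merged r → z.2 ≤ y.2 := by
    intro z hz hzm
    have h1 := (hfu z).1 (Or.inl hz)
    exact h.right.2 z (uncolored_blueMerge.2 ⟨⟨h1.1.1, h1.1.2.1, h1.1.2.2, hzm⟩, h1.2.1⟩)
  -- the block into which a given block is merged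
  have hnext : ∀ b, 1 ≤ b → ∀ z, z ∈ Bf ∨ z ∈ Rf → z.2 ∈ S.block b →
      ∃ b₁, 1 ≤ b₁ ∧ Lift r (b₁ + 3) (b + 3) := by
    intro b hb z hz hzb
    have hz' := (hfu z).1 hz
    by_cases hb' : r = 2 ∧ b = 1
    · obtain ⟨rfl, rfl⟩ := hb'
      exact absurd (h.eq_right_of_two ⟨hz'.1.1, hz'.1.2.1, hz'.1.2.2,
        mem_merged_of_mem_block hzb (Or.inr rfl)⟩) hz'.2.2
    · rcases Nat.lt_or_ge (b + 3) (r + 2) with hlt | hge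
      · exact ⟨b, hb, Or.inl (by omega)⟩
      · exact ⟨b - 1, by omega, Or.inr (by omega)⟩
  -- In either case the two crosses share a block after the merge, where the order is already known.
  have hfle : ∀ b b', (b = b' ∨ b + 1 = r ∧ b' + 2 = r) → ∀ z ∈ Bf, ∀ w ∈ Rf, z.2 ∈ S.block b →
      w.2 ∈ S.block b' → z.2 ≤ w.2 := by
    intro b b' hbb z hz w hw hzb hwb
    rcases Nat.eq_zero_or_pos b' with rfl | hb'
    · rw [block_zero] at hwb; simp at hwb
    obtain ⟨b₁, hb₁, hl⟩ := hnext b' hb' w (Or.inr hw) hwb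
    refine hf.le b₁ z hz w hw ((h.mem_block_iff hb₁).2 ⟨b, ?_, hzb⟩)
      ((h.mem_block_iff hb₁).2 ⟨b', hl, hwb⟩)
    unfold Lift at hl ⊢
    omega
  have hxb : ∀ b, x.2 ∈ S.block b ↔ b = r := fun b =>
    ⟨fun hb => hs.block_unique hb hxu.2.2.2, fun hb => hb ▸ hxu.2.2.2⟩
  have hyb : ∀ b, y.2 ∈ S.block b → b + 2 = r ∨ b + 1 = r := fun b hb =>
    hs.mem_merged hr2 hyu.2.2.2 hb
  have hBx : ∀ b, ((insert x Bf).filter fun z => z.2 ∈ S.block b).card =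
      (Bf.filter fun z => z.2 ∈ S.block b).card + if b = r then 1 else 0 := by
    intro b
    rw [Finset.filter_insert]
    by_cases hb : b = r
    · rw [if_pos ((hxb b).2 hb), if_pos hb, Finset.card_insert_of_notMem]
      exact fun hx => hxB (Finset.mem_filter.1 hx).1
    · rw [if_neg (fun hx => hb ((hxb b).1 hx)), if_neg hb, add_zero]
  have hRy : ∀ b, b + 2 ≠ r → b + 1 ≠ r → ((insert y Rf).filter fun z => z.2 ∈ S.block b).card =
      (Rf.filter fun z => z.2 ∈ S.block b).card := by
    intro b h1 h2
    rw [Finset.filter_insert, if_neg]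
    intro hy
    have := hyb b hy
    omega
  have hblock : ∀ b₁ b, 1 ≤ b₁ → (∀ b', Lift r (b₁ + 3) (b' + 3) ↔ b' = b) →
      ((S.blueMerge r x).addRed y).block b₁ = S.block b := by
    intro b₁ b hb₁ hl
    ext c
    rw [h.mem_block_iff hb₁]
    simp only [hl, exists_eq_left]
  -- the two merged blocks
  have hL : (((insert x Bf).filter fun z => z.2 ∈ S.block (r - 2)).card = p (u + 3) ∧
      ((insert x Bf).filter fun z => z.2 ∈ S.block (r - 1)).card = p (u + 2)) ∧
      ((insert y Rf).filter fun z => z.2 ∈ S.block (r - 2)).card = q (u + 2) ∧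
      ((insert y Rf).filter fun z => z.2 ∈ S.block (r - 1)).card = q (u + 1) := by
    have hmdisj : Disjoint (S.block (r - 2)) (S.block (r - 1)) := by
      rw [Finset.disjoint_left]
      intro c h1 h2
      have := hs.block_unique h1 h2
      omega
    have hsplit : ∀ F : Finset (ℕ × ℕ), (F.filter fun z => z.2 ∈ S.merged r).card =
        (F.filter fun z => z.2 ∈ S.block (r - 2)).card +
        (F.filter fun z => z.2 ∈ S.block (r - 1)).card := by
      intro F
      rw [← Finset.card_union_of_disjoint, ← Finset.filter_or]
      · simp only [merged, Finset.mem_union]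
      · rw [Finset.disjoint_left]
        intro z h1 h2
        exact Finset.disjoint_left.1 hmdisj (Finset.mem_filter.1 h1).2 (Finset.mem_filter.1 h2).2
    have hmerged : 3 ≤ r → ((S.blueMerge r x).addRed y).block (r - 2) = S.merged r := by
      intro h3
      ext c
      rw [h.mem_block_iff (by omega), merged, Finset.mem_union]
      constructor
      · rintro ⟨b', hl, hc⟩
        rcases (show b' = r - 2 ∨ b' = r - 1 by unfold Lift at hl; omega) with rfl | rfl
        · exact Or.inl hc
        · exact Or.inr hc
      · rintro (hc | hc)
        · exact ⟨r - 2, Or.inl (by omega), hc⟩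
        · exact ⟨r - 1, Or.inr (by omega), hc⟩
    have hB : (Bf.filter fun z => z.2 ∈ S.merged r).card = P (u + 2) := by
      -- For r = 2 the merged block is gone from the later stage; it contains no future blue cross,
      -- and the exponents concerned lie beyond the size of the paths.
      rcases hr2.eq_or_lt with rfl | h3
      · obtain rfl : u = m := by omega
        rw [hseq.top_p, hp _ le_rfl, hp _ (by omega), Finset.card_eq_zero,
          Finset.filter_eq_empty_iff]
        intro z hz hzm
        have hz' := (hfu z).1 (Or.inl hz)
        exact hz'.2.2 (h.eq_right_of_two ⟨hz'.1.1, hz'.1.2.1, hz'.1.2.2, hzm⟩)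
      · have := hf.blue (r - 2)
        rwa [hmerged h3, show m + 2 - (r - 2) = u + 2 by omega] at this
    have hR : ((insert y Rf).filter fun z => z.2 ∈ S.merged r).card = Q (u + 1) + 1 := by
      rw [Finset.filter_insert, if_pos hyu.2.2.2, Finset.card_insert_of_notMem
        (fun hy => hyR (Finset.mem_filter.1 hy).1)]
      congr 1
      rcases hr2.eq_or_lt with rfl | h3
      · obtain rfl : u = m := by omega
        have hQ : Q (u + 1) = 0 := by
          have h1 := hf.red 0
          rw [block_zero] at h1
          simpa using h1.symm
        rw [hQ, Finset.card_eq_zero, Finset.filter_eq_empty_iff]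
        intro z hz hzm
        have hz' := (hfu z).1 (Or.inr hz)
        exact hz'.2.2 (h.eq_right_of_two ⟨hz'.1.1, hz'.1.2.1, hz'.1.2.2, hzm⟩)
      · have := hf.red (r - 2)
        rwa [hmerged h3, show m + 1 - (r - 2) = u + 1 by omega] at this
    have hB' : ((insert x Bf).filter fun z => z.2 ∈ S.merged r).card = P (u + 2) := by
      rw [← hB, hsplit, hsplit, hBx, hBx, if_neg (by omega), if_neg (by omega)]
      rfl
    have hU := card_filter_add_card_filter hmem hdisj (S.block (r - 2))
    rw [hs.count, show r - 2 + 3 = r + 1 by omega,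
      show colCount (diagram (m + 4 + 1) X) (r + 1) = _ from hcount] at hU
    rw [hsplit] at hR hB'
    -- A blue cross in the right block and a red one in the left block would put red strictly left
    -- of blue inside the merged block.
    have hprod : ((insert x Bf).filter fun z => z.2 ∈ S.block (r - 1)).card = 0 ∨
        ((insert y Rf).filter fun z => z.2 ∈ S.block (r - 2)).card = 0 := by
      by_contra hcon
      rw [not_or, ← Ne, ← Ne, Finset.card_ne_zero, Finset.card_ne_zero] at hcon
      obtain ⟨⟨z, hz⟩, ⟨w, hw⟩⟩ := hcon
      rw [Finset.mem_filter, Finset.mem_insert] at hz hw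
      have hlt := hs.sorted (r - 2) (r - 1) w.2 z.2 (by omega) hw.2 hz.2
      rcases hz.1 with rfl | hz1
      · have := (hxb _).1 hz.2; omega
      rcases hw.1 with rfl | hw1
      · have := hyle z hz1 (mem_merged_of_mem_block hz.2 (by omega))
        omega
      · have := hfle (r - 1) (r - 2) (by omega) z hz1 w hw1 hz.2 hw.2
        omega
    have h1 := hseq.top_p
    have h2 := hseq.mid_q
    have h3 := mul_eq_zero.1 hpq
    omega
  refine ⟨hmem, hdisj, ?_, ?_, ?_⟩
  · intro b
    rcases Nat.eq_zero_or_pos b with rfl | hb0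
    · rw [block_zero, hp _ (by omega)]; simp
    rcases Nat.lt_or_ge r b with h1 | h1
    · rcases Nat.lt_or_ge (m + 2) b with h2 | h2
      · rw [block_of_lt (by omega), show m + 1 + 2 - b = 0 by omega, hp0]; simp
      have h3 := hf.blue (b - 1)
      rw [hblock (b - 1) b (by omega) (fun b' => by unfold Lift; omega)] at h3
      rw [hBx, if_neg (by omega), add_zero, h3, show m + 1 + 2 - b = m + 2 - (b - 1) by omega]
      exact hseq.low_p _ (by omega)
    rcases h1.eq_or_lt with rfl | h1
    · have h3 := hf.blue (b - 1)
      rw [hblock (b - 1) b (by omega) (fun b' => by unfold Lift; omega),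
        show m + 2 - (b - 1) = u + 1 by omega] at h3
      rw [hBx, if_pos rfl, h3, hseq.mid_p, show m + 1 + 2 - b = u + 1 by omega]
    rcases Nat.lt_or_ge (b + 2) r with h2 | h2
    · have h3 := hf.blue b
      rw [hblock b b (by omega) (fun b' => by unfold Lift; omega)] at h3
      rw [hBx, if_neg (by omega), add_zero, h3, hseq.high_p _ (by omega)]
      congr 1; omega
    · rcases (show b = r - 2 ∨ b = r - 1 by omega) with rfl | rfl
      · rw [hL.1.1]; congr 1; omega
      · rw [hL.1.2]; congr 1; omega
  · intro b
    rcases Nat.eq_zero_or_pos b with rfl | hb0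
    · rw [block_zero, hq _ (by omega)]; simp
    rcases Nat.lt_or_ge b r with h1 | h1
    · rcases Nat.lt_or_ge (b + 2) r with h2 | h2
      · have h3 := hf.red b
        rw [hblock b b (by omega) (fun b' => by unfold Lift; omega)] at h3
        rw [hRy b (by omega) (by omega), h3, hseq.high_q _ (by omega)]
        congr 1; omega
      · rcases (show b = r - 2 ∨ b = r - 1 by omega) with rfl | rfl
        · rw [hL.2.1]; congr 1; omega
        · rw [hL.2.2]; congr 1; omega
    · rcases Nat.lt_or_ge (m + 2) b with h2 | h2
      · rw [block_of_lt (by omega), show m + 1 + 1 - b = 0 by omega, hq0]; simp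
      have h3 := hf.red (b - 1)
      rw [hblock (b - 1) b (by omega) (fun b' => by unfold Lift; omega)] at h3
      rw [hRy b (by omega) (by omega), h3, show m + 1 + 1 - b = m + 1 - (b - 1) by omega]
      exact hseq.low_q _ (by omega)
  · intro b z hz w hw hzb hwb
    rw [Finset.mem_insert] at hz hw
    rcases hw with rfl | hw
    · have h1 := hyb b hwb
      rcases hz with rfl | hz
      · have := (hxb b).1 hzb; omega
      · exact hyle z hz (mem_merged_of_mem_block hzb h1)
    · rcases hz with rfl | hz
      · obtain rfl := (hxb b).1 hzb
        have h1 := (hfu w).1 (Or.inr hw)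
        exact h.left.2 w ⟨h1.1.1, h1.1.2.1, h1.1.2.2, hwb⟩
      · exact hfle b b (Or.inl rfl) z hz w hw hzb hwb

/-- An isomorphism of the two trees that preserves the data of the succession rule. -/
structure IsDataIso (Ψ : ∀ l : ℕ, TwoTriangulation (l + 5) ≃ DyckPair (l + 1)) : Prop where
  preserves : ∀ l, GeneratingRule.Preserves triRule dyckRule (l := l) (Ψ l)
  parent : ∀ l (x : TwoTriangulation (l + 5)) (y : TwoTriangulation (l + 6)),
    triTree.IsParent (l := l) x y ↔ IsDyckParent (Ψ l x) (Ψ (l + 1) y)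

section Iso

variable {Ψ : ∀ l : ℕ, TwoTriangulation (l + 5) ≃ DyckPair (l + 1)}

theorem IsDataIso.s_eq (h : IsDataIso Ψ) {l : ℕ} (T : TwoTriangulation (l + 5)) :
    (Ψ l T).s = l + 5 - 1 - corner (l + 5) T.1 := (h.preserves l T).1

theorem IsDataIso.colCount_eq (h : IsDataIso Ψ) {l : ℕ} (T : TwoTriangulation (l + 5)) (j : ℕ) :
    colCount (diagram (l + 5) T.1) (l + 5 - j) = (Ψ l T).p (j + 1) + (Ψ l T).q j :=
  (congrFun (h.preserves l T).2 j).symm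

/-- A step of the algorithm at a stage that corresponds to a node of the tree leads to a stage that
corresponds to its parent. -/
theorem IsDataIso.step (h : IsDataIso Ψ) {i : ℕ} {X : TwoTriangulation (i + 6)}
    {D : Finset (ℕ × ℕ)} {S S₂ : ColoringState} (hS : Stage D S (i + 6) X.1)
    (hstep : Step D S S₂) : ∃ (Y : TwoTriangulation (i + 5)) (x y : ℕ × ℕ),
      Stage D S₂ (i + 5) Y.1 ∧ x ∉ S.blue ∧ y ∉ S.red ∧ S₂.blue = insert x S.blue ∧
      S₂.red = insert y S.red ∧
      ∀ Bf Rf, Future D S₂ (i + 1) (Ψ i Y).p (Ψ i Y).q Bf Rf →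
        Future D S (i + 2) (Ψ (i + 1) X).p (Ψ (i + 1) X).q (insert x Bf) (insert y Rf) := by
  obtain ⟨r, x, y, hr, hx, hy, rfl⟩ := hstep
  have hX : IsTwoTri (i + 5 + 1) X.1 := X.isTwoTri
  have hrow := hX.isCornerRow_corner (by omega)
  obtain rfl := (hS.isCorner_iff hrow (by omega)).1 hr
  obtain ⟨j, hj⟩ := hX.exists_isApex hrow
  have hd : StepData D S (i + 5) X.1 _ j x y := ⟨hS, hX, by omega, hrow, hj, hx, hy⟩
  let Y : TwoTriangulation (i + 5) := ⟨_, isKTriangulation_two_iff.2 (hX.contractSet hrow hj)⟩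
  refine ⟨Y, x, y, hd.next, hx.1.2.1, hd.right_uncolored.2.2.1, rfl, rfl, fun Bf Rf hf => ?_⟩
  have hpar : IsDyckParent (Ψ i Y) (Ψ (i + 1) X) :=
    (h.parent i Y X).1 ((TwoTriangulation.isParent_iff hrow hj).2 rfl)
  have hs := h.s_eq X
  have hle := hrow.le
  have hr2 := hrow.two_le
  obtain ⟨u, hu⟩ : ∃ u, u + corner (i + 1 + 5) X.1 = i + 3 :=
    ⟨i + 3 - corner (i + 1 + 5) X.1, Nat.sub_add_cancel (by
      change corner (i + 5 + 1) X.1 ≤ i + 3; omega)⟩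
  have hs' : (Ψ (i + 1) X).s = u + 2 := by omega
  have hseq := (isDyckParent_iff (by omega) hs').1 hpar
  have hps := (Ψ (i + 1) X).isPairSeq (by omega)
  refine hd.future (m := i + 1) hf (u := u) ?_ hseq (hs' ▸ (Ψ (i + 1) X).s_spec.2) ?_ hps.fst.zero
    hps.snd.zero (fun k hk => hps.fst.gt k (by omega)) (fun k hk => hps.snd.gt k (by omega))
  · rw [add_comm]; exact hu
  · have h1 := h.colCount_eq X (u + 2)
    rw [show i + 1 + 5 - (u + 2) = corner (i + 1 + 5) X.1 + 1 by omega] at h1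
    exact h1

/-- Colors are identified from the end, but stages are reached from the start. The induction
therefore carries the implication that a correct future of S, joined to the colors already given, is
a correct future of the initial stage. -/
theorem IsDataIso.of_reaches (h : IsDataIso Ψ) {l : ℕ} (T : TwoTriangulation (l + 5)) {k : ℕ}
    {S : ColoringState} (hS : Reaches (l + 5) (diagram (l + 5) T.1) k S) :
    ∀ i, k + i = l → S.blue.card = k ∧ S.red.card = k ∧ ∃ X : TwoTriangulation (i + 5),
      Stage (diagram (l + 5) T.1) S (i + 5) X.1 ∧
      ∀ Bf Rf, Future (diagram (l + 5) T.1) S (i + 1) (Ψ i X).p (Ψ i X).q Bf Rf →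
        Future (diagram (l + 5) T.1) (ColoringState.init (l + 5)) (l + 1) (Ψ l T).p (Ψ l T).q
          (S.blue ∪ Bf) (S.red ∪ Rf) := by
  induction hS with
  | start =>
    intro i hi
    obtain rfl : i = l := by omega
    refine ⟨rfl, rfl, T, stage_init _ (by omega) T.1, fun Bf Rf hf => ?_⟩
    rwa [show (ColoringState.init (i + 5)).blue = ∅ from rfl, Finset.empty_union,
      show (ColoringState.init (i + 5)).red = ∅ from rfl, Finset.empty_union]
  | @next k S S₂ hreach hstep ih =>
    intro i hi
    obtain ⟨h1, h2, X, hX, hf⟩ := ih (i + 1) (by omega)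
    obtain ⟨Y, x, y, hY, hx, hy, hb, hr, hf₂⟩ := h.step hX hstep
    rw [hb, hr, Finset.card_insert_of_notMem hx, Finset.card_insert_of_notMem hy, h1, h2]
    refine ⟨rfl, rfl, Y, hY, fun Bf Rf hF => ?_⟩
    have := hf _ _ (hf₂ Bf Rf hF)
    rwa [Finset.union_insert, Finset.union_insert, ← Finset.insert_union,
      ← Finset.insert_union] at this

theorem IsDataIso.not_stuck (h : IsDataIso Ψ) {l : ℕ} (T : TwoTriangulation (l + 5)) {k : ℕ}
    {S : ColoringState} (hk : k < l) (hS : Reaches (l + 5) (diagram (l + 5) T.1) k S) :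
    ∃ r, 2 ≤ r ∧ IsCorner (diagram (l + 5) T.1) S r ∧
      (∃ x, Leftmost (diagram (l + 5) T.1) S (S.block r) x) ∧
      ∀ x, Leftmost (diagram (l + 5) T.1) S (S.block r) x →
        ∃ y, Rightmost (diagram (l + 5) T.1) (S.blueMerge r x) (S.merged r) y := by
  obtain ⟨i, rfl⟩ : ∃ i, l = k + (i + 1) := ⟨l - k - 1, by omega⟩
  obtain ⟨-, -, X, hX, -⟩ := h.of_reaches T hS (i + 1) rfl
  have hX' : IsTwoTri (i + 5 + 1) X.1 := X.isTwoTri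
  have hrow := hX'.isCornerRow_corner (by omega)
  obtain ⟨j, hj⟩ := hX'.exists_isApex hrow
  exact ⟨_, hrow.two_le, (hX.isCorner_iff hrow (by omega)).2 rfl,
    Stage.exists_leftmost hX (by omega) hrow,
    fun x hx => Stage.exists_rightmost hX hX' (by omega) hrow hj hx⟩

theorem IsDataIso.exists_reaches (h : IsDataIso Ψ) {l : ℕ} (T : TwoTriangulation (l + 5)) {k : ℕ}
    (hk : k ≤ l) : ∃ S, Reaches (l + 5) (diagram (l + 5) T.1) k S := by
  induction k with
  | zero => exact ⟨_, .start⟩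
  | succ k ih =>
    obtain ⟨S, hS⟩ := ih (by omega)
    obtain ⟨r, -, hr, ⟨x, hx⟩, hy⟩ := h.not_stuck T (by omega) hS
    obtain ⟨y, hy⟩ := hy x hx
    exact ⟨_, .next hS ⟨r, x, y, hr, hx, hy, rfl⟩⟩

theorem IsDataIso.of_reaches_final (h : IsDataIso Ψ) {l : ℕ} (T : TwoTriangulation (l + 5))
    {S : ColoringState} (hS : Reaches (l + 5) (diagram (l + 5) T.1) l S) :
    S.blue.card = l ∧ S.red.card = l ∧ S.blocks.length = 2 ∧
      Future (diagram (l + 5) T.1) (ColoringState.init (l + 5)) (l + 1) (Ψ l T).p (Ψ l T).q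
        S.blue S.red := by
  obtain ⟨h1, h2, X, hX, hf⟩ := h.of_reaches T hS 0 rfl
  have hlen := hX.length
  have h0 := (Ψ 0 X).eq_zero_of_one
  have := hf ∅ ∅ (hX.future_final X.diagram_five h0.1 h0.2)
  rw [Finset.union_empty, Finset.union_empty] at this
  exact ⟨h1, h2, by omega, this⟩

theorem pathWord_eq (C : Finset (ℕ × ℕ)) (u t : ℕ) :
    pathWord C u t = runWord (fun i => colCount C (u + i)) t ++ [DyckStep.D] := by
  unfold pathWord
  rw [flatMap_range']

/-- At the initial stage every block is one column, so the block counts of the final colors are the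
runs of the two words. Nothing depends on the choices made in ties. -/
theorem IsDataIso.pathWord_eq (h : IsDataIso Ψ) {l : ℕ} (T : TwoTriangulation (l + 5))
    {S : ColoringState} (hS : Reaches (l + 5) (diagram (l + 5) T.1) l S) :
    pathWord S.blue 5 (l + 1) = (Ψ l T).1.1.toList ∧
      pathWord S.red 4 (l + 1) = (Ψ l T).1.2.toList := by
  obtain ⟨-, -, -, hf⟩ := h.of_reaches_final T hS
  rw [TwoTri.pathWord_eq, TwoTri.pathWord_eq, DyckPair.toList_fst_eq (by omega),
    DyckPair.toList_snd_eq (by omega)]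
  constructor
  · congr 1
    refine runWord_congr fun i hi => ?_
    have h1 := hf.blue (i + 2)
    rw [show l + 1 + 2 - (i + 2) = l + 1 - i by omega] at h1
    rw [← h1, colCount]
    congr 1
    refine Finset.filter_congr fun z _ => ?_
    rw [mem_block_init]
    omega
  · congr 1
    refine runWord_congr fun i hi => ?_
    have h1 := hf.red (i + 1)
    rw [show l + 1 + 1 - (i + 1) = l + 1 - i by omega] at h1
    rw [← h1, colCount]
    congr 1
    refine Finset.filter_congr fun z _ => ?_
    rw [mem_block_init]
    omega

theorem IsDataIso.isOutput_iff (h : IsDataIso Ψ) {l : ℕ} (T : TwoTriangulation (l + 5))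
    (P Q : List DyckStep) : IsOutput (l + 5) T.1 P Q ↔
      P = (Ψ l T).1.1.toList ∧ Q = (Ψ l T).1.2.toList := by
  constructor
  · rintro ⟨S, hS, rfl, rfl⟩
    exact h.pathWord_eq T hS
  · rintro ⟨rfl, rfl⟩
    obtain ⟨S, hS⟩ := h.exists_reaches T le_rfl
    obtain ⟨h1, h2⟩ := h.pathWord_eq T hS
    exact ⟨S, hS, h1.symm, h2.symm⟩

end Iso

theorem exists_isDataIso : ∃ Ψ : ∀ l : ℕ, TwoTriangulation (l + 5) ≃ DyckPair (l + 1),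
    IsDataIso Ψ := by
  obtain ⟨Ψ, h1, h2⟩ :=
    GeneratingRule.exists_preserving_iso triRule dyckRule triTree_isTree dyckTree_isTree
  exact ⟨Ψ, h1, h2⟩

theorem IsDataIso.isIso {Ψ : ∀ l : ℕ, TwoTriangulation (l + 5) ≃ DyckPair (l + 1)}
    (h : IsDataIso Ψ) : LabelledTree.IsIso triTree dyckTree Ψ :=
  ⟨h.parent, fun l T => (h.preserves l).label_eq T⟩

end TwoTri

/-- Throughout, `n = l + 5`, so that `n - 4 = l + 1`. -/
theorem mainTheorem3 :
    -- the two generating trees are trees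
    triTree.IsTree ∧ dyckTree.IsTree ∧
    -- there is exactly one label-preserving isomorphism `Ψ` between them
    ∃ Ψ : ∀ l : ℕ, TwoTriangulation (l + 5) ≃ DyckPair (l + 1),
      LabelledTree.IsIso triTree dyckTree Ψ ∧
      (∀ Θ : ∀ l : ℕ, TwoTriangulation (l + 5) ≃ DyckPair (l + 1),
        LabelledTree.IsIso triTree dyckTree Θ → Θ = Ψ) ∧
      ∀ l : ℕ,
        -- the column counts
        (∀ T : TwoTriangulation (l + 5),
          colCount (diagram (l + 5) T.1) 4 = DyckPair.q (Ψ l T) (l + 1) ∧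
          (∀ j, 5 ≤ j → j ≤ l + 4 →
            colCount (diagram (l + 5) T.1) j =
              DyckPair.p (Ψ l T) (l + 6 - j) + DyckPair.q (Ψ l T) (l + 5 - j)) ∧
          colCount (diagram (l + 5) T.1) (l + 5) = DyckPair.p (Ψ l T) 1) ∧
        -- the algorithm never gets stuck in its `n - 5` iterations
        (∀ (T : TwoTriangulation (l + 5)) (k : ℕ) (S : ColoringState), k < l →
          Reaches (l + 5) (diagram (l + 5) T.1) k S →
          ∃ r, 2 ≤ r ∧ ColoringState.IsCorner (diagram (l + 5) T.1) S r ∧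
            (∃ x, ColoringState.Leftmost (diagram (l + 5) T.1) S (S.block r) x) ∧
            ∀ x, ColoringState.Leftmost (diagram (l + 5) T.1) S (S.block r) x →
              ∃ y, ColoringState.Rightmost (diagram (l + 5) T.1)
                (S.blueMerge r x) (S.merged r) y) ∧
        -- at the end two blocks are left, and half of the crosses are blue, the others red
        (∀ (T : TwoTriangulation (l + 5)) (S : ColoringState),
          Reaches (l + 5) (diagram (l + 5) T.1) l S →
          S.blocks.length = 2 ∧ S.blue ∪ S.red = diagram (l + 5) T.1 ∧ Disjoint S.blue S.red ∧
            S.blue.card = l ∧ S.red.card = l) ∧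
        -- the algorithm defines a map `Φ`, which is a bijection and equals `Ψ`
        ∃ Φ : TwoTriangulation (l + 5) → DyckPair (l + 1),
          (∀ (T : TwoTriangulation (l + 5)) (P Q : List DyckStep),
            IsOutput (l + 5) T.1 P Q ↔ P = (Φ T).1.1.toList ∧ Q = (Φ T).1.2.toList) ∧
          Function.Bijective Φ ∧ ∀ T, Φ T = Ψ l T := by
  refine ⟨triTree_isTree, dyckTree_isTree, ?_⟩
  obtain ⟨Ψ, hΨ⟩ := exists_isDataIso
  refine ⟨Ψ, hΨ.isIso, fun Θ hΘ => GeneratingRule.iso_unique dyckRule triTree_isTree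
    dyckTree_isTree hΨ.isIso hΘ, fun l => ⟨fun T => ?_, fun T k S hk hS => hΨ.not_stuck T hk hS,
    fun T S hS => ?_, Ψ l, hΨ.isOutput_iff, (Ψ l).bijective, fun T => rfl⟩⟩
  · have hps := (Ψ l T).isPairSeq (by omega)
    refine ⟨?_, fun j h1 h2 => ?_, ?_⟩
    · have h1 := hΨ.colCount_eq T (l + 1)
      rwa [hps.fst.gt _ (by omega), zero_add, show l + 5 - (l + 1) = 4 by omega] at h1
    · have h3 := hΨ.colCount_eq T (l + 5 - j)
      rwa [show l + 5 - (l + 5 - j) = j by omega, show l + 5 - j + 1 = l + 6 - j by omega] at h3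
    · have h1 := hΨ.colCount_eq T 0
      rwa [hps.snd.zero, add_zero] at h1
  · obtain ⟨h1, h2, h3, hf⟩ := hΨ.of_reaches_final T hS
    refine ⟨h3, ?_, hf.disj, h1, h2⟩
    ext z
    rw [Finset.mem_union, hf.mem_iff]
    simp [ColoringState.init]
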